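/- Let $M$ be a smooth Hausdorff manifold of dimension $n=q+r$ ($q,r\ge 0$), and let $X = X_0+\sum_{i=1}^m X_i\circ \frac{dB^i_t}{dt}$ be a stochastic dynamical system on $M$, where $X_0,\dots,X_m$ are smooth vector fields; its generator is $A_X = X_0+\frac12\sum_{i=1}^m X_i^2$. Two systems on the same manifold are called diffusion equivalent if their generators coincide as operators on smooth functions. Suppose that $X$ is integrable of type $(0,q,r)$ with the aid of $(Z_1,\dots,Z_q,F_1,\dots,F_r)$. That is, $Z_1,\dots,Z_q$ are smooth vector fields and $F_1,\dots,F_r$ are smooth real functions on $M$ with $[Z_i,Z_j]=0$ and $Z_i(F_j)=0$ for all $i,j$; moreover $Z_1\wedge\dots\wedge Z_q\neq 0$ and $dF_1\wedge\dots\wedge dF_r\ne 0$ almost everywhere; and $A_X$ commutes, as a differential operator on $C^\infty(M)$, with every $Z_i$ and with multiplication by every $F_j$. Assume that the map $(F_1,\dots,F_r):M\to\mathbb R^r$ is proper, and let $N=\{F_1=c_1,\dots,F_r=c_r\}$ be a connected (in particular non-empty) level set which is regular, i.e. $Z_1\wedge\dots\wedge Z_q(x)\ne0$ and $dF_1\wedge\dots\wedge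 dF_r(x)\neq 0$ for every $x\in N$. Then $N$ is diffeomorphic to the torus $\mathbb T^q=(\mathbb R/\mathbb Z)^q$. Moreover there is a tubular neighborhood $\mathcal U(N)$ of $N$, i.e. an open neighborhood with a diffeomorphism $\mathcal U(N)\cong\mathbb T^q\times B^r$ ($B^r$ the open unit ball of $\mathbb R^r$) carrying $N$ onto $\mathbb T^q\times\{0\}$, with corresponding coordinates $(\theta_1 \bmod 1,\dots,\theta_q \bmod 1,\gamma_1,\dots,\gamma_r)$, in which the restriction of $X$ to $\mathcal U(N)$ is diffusion equivalent to a system $$Y=Y_0+\sum_{i=1}^m Y_i\circ\frac{dB^i_t}{dt},\qquad Y_i=\sum_{k=1}^q a_{ik}(\gamma_1,\dots,\gamma_r)\,\partial_{\theta_k}\quad(i=0,1,\dots,m),$$ with smooth coefficients $a_{ik}$ on $B^r$. In particular, each $Y_i$ is tangent to the tori $\mathbb T^q\times\{\mathrm{pt}\}$ and its coefficients are constant on them. -/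

import Mathlib

open Set MeasureTheory Manifold
open scoped ContDiff

noncomputable section

/-! ### The torus `𝕋^q = (ℝ/ℤ)^q` as a smooth manifold -/

/-- The `q`-dimensional torus `(ℝ/ℤ)^q`; a point is `(θ₁ mod 1, …, θ_q mod 1)`. -/
def Torus (q : ℕ) : Type := Fin q → AddCircle (1 : ℝ)

namespace Torus

variable {q : ℕ}

instance : TopologicalSpace (Torus q) :=
  inferInstanceAs (TopologicalSpace (Fin q → AddCircle (1 : ℝ)))

instance : AddCommGroup (Torus q) :=
  inferInstanceAs (AddCommGroup (Fin q → AddCircle (1 : ℝ)))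

instance : CompactSpace (Torus q) :=
  inferInstanceAs (CompactSpace (Fin q → AddCircle (1 : ℝ)))

instance : T2Space (Torus q) :=
  inferInstanceAs (T2Space (Fin q → AddCircle (1 : ℝ)))

/-- The covering projection `ℝ^q → 𝕋^q`, reduction mod 1 of every coordinate. -/
def proj (θ : Fin q → ℝ) : Torus q := fun k => (θ k : AddCircle (1 : ℝ))

/-- The coordinate chart of the torus inverse to the restriction of the covering projection
to the open cube `∏ₖ (aₖ, aₖ + 1)`. -/
def cubeChart (a : Fin q → ℝ) : OpenPartialHomeomorph (Torus q) (Fin q → ℝ) :=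
  (OpenPartialHomeomorph.pi fun k => AddCircle.openPartialHomeomorphCoe (1 : ℝ) (a k)).symm

/-- The corner of a cube whose projection has the given point as its centre. -/
def corner (t : Torus q) : Fin q → ℝ := fun k => (AddCircle.equivIco (1 : ℝ) 0 (t k) : ℝ) - 1 / 2

lemma cubeChart_symm_apply (a θ : Fin q → ℝ) : (cubeChart a).symm θ = proj θ := rfl

lemma cubeChart_target (a : Fin q → ℝ) :
    (cubeChart a).target = Set.pi univ fun k => Ioo (a k) (a k + 1) := rfl

lemma mem_cubeChart_source_corner (t : Torus q) : t ∈ (cubeChart (corner t)).source := by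
  have h : t = (cubeChart (corner t)).symm fun k => (AddCircle.equivIco (1 : ℝ) 0 (t k) : ℝ) := by
    funext k
    exact ((AddCircle.equivIco (1 : ℝ) 0).symm_apply_apply (t k)).symm
  suffices hc : (fun k => (AddCircle.equivIco (1 : ℝ) 0 (t k) : ℝ)) ∈
      (cubeChart (corner t)).target by
    have := (cubeChart (corner t)).map_target hc
    rwa [← h] at this
  rw [cubeChart_target]
  intro k _
  constructor <;> simp only [corner] <;> linarith

instance : ChartedSpace (Fin q → ℝ) (Torus q) where
  atlas := range cubeChart
  chartAt t := cubeChart (corner t)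
  mem_chart_source := mem_cubeChart_source_corner
  chart_mem_atlas _ := mem_range_self _

/-- The covering projection is injective up to integer translations. -/
lemma proj_eq_proj_iff (θ η : Fin q → ℝ) :
    proj θ = proj η ↔ ∃ m : Fin q → ℤ, ∀ k, η k = θ k + m k := by
  have key : ∀ k, ((θ k : AddCircle (1 : ℝ)) = (η k : AddCircle (1 : ℝ))) ↔
      ∃ m : ℤ, η k = θ k + m := by
    intro k
    rw [eq_comm, QuotientAddGroup.eq, AddSubgroup.mem_zmultiples_iff]
    constructor
    · rintro ⟨m, hm⟩
      refine ⟨-m, ?_⟩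
      simp only [zsmul_eq_mul, mul_one] at hm
      push_cast
      linarith
    · rintro ⟨m, hm⟩
      refine ⟨-m, ?_⟩
      simp only [zsmul_eq_mul, mul_one]
      push_cast
      linarith
  constructor
  · intro h
    choose m hm using fun k => (key k).1 (congrFun h k)
    exact ⟨m, hm⟩
  · rintro ⟨m, hm⟩
    funext k
    exact (key k).2 ⟨m k, hm k⟩

/-- Transition maps are locally integer translations, so the torus is a smooth manifold. -/
instance : IsManifold 𝓘(ℝ, Fin q → ℝ) ∞ (Torus q) := by
  refine isManifold_of_contDiffOn _ _ _ ?_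
  rintro _ _ ⟨a, rfl⟩ ⟨b, rfl⟩
  set g := (cubeChart a).symm ≫ₕ cubeChart b with hg
  suffices h : ContDiffOn ℝ ∞ g g.source by simpa using h
  have hproj : ∀ y ∈ g.source, proj y = proj (g y) := by
    intro y hy
    have hy' : (cubeChart a).symm y ∈ (cubeChart b).source := by
      rw [hg, OpenPartialHomeomorph.trans_source] at hy
      exact hy.2
    exact ((cubeChart b).left_inv hy').symm
  intro x hx
  have hcont : ContinuousAt (fun y => (g y - y) - (g x - x)) x :=
    ((g.continuousAt hx).sub continuousAt_id).sub continuousAt_const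
  have hnear : ∀ᶠ y in nhds x, ‖(g y - y) - (g x - x)‖ < 1 := by
    have h0 : ‖(g x - x) - (g x - x)‖ < 1 := by simp
    exact hcont.norm.eventually_lt_const h0
  have heq : ∀ᶠ y in nhds x, g y = y + (g x - x) := by
    filter_upwards [hnear, g.open_source.mem_nhds hx] with y hy hys
    obtain ⟨m, hm⟩ := (proj_eq_proj_iff _ _).1 (hproj y hys)
    obtain ⟨l, hl⟩ := (proj_eq_proj_iff _ _).1 (hproj x hx)
    funext k
    have h1 : |(m k : ℝ) - l k| < 1 := by
      have h2 := (norm_le_pi_norm ((g y - y) - (g x - x)) k).trans_lt hy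
      simp only [Pi.sub_apply, hm k, hl k, Real.norm_eq_abs] at h2
      rwa [add_sub_cancel_left, add_sub_cancel_left] at h2
    have h3 : m k = l k := by
      have h4 : |m k - l k| < 1 := by exact_mod_cast h1
      have := Int.abs_lt_one_iff.1 h4
      omega
    simp only [Pi.add_apply, Pi.sub_apply, hm k, hl k, h3]
    ring
  exact ((contDiffAt_id.add contDiffAt_const).congr_of_eventuallyEq heq).contDiffWithinAt

end Torus

section Systems

variable {n : ℕ} {M : Type*} [TopologicalSpace M] [ChartedSpace (EuclideanSpace ℝ (Fin n)) M]

/-- The derivative `V(f)` of a function along a vector field. -/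
def lieDeriv (V : (x : M) → TangentSpace (𝓡 n) x) (f : M → ℝ) (x : M) : ℝ :=
  mvfderiv (𝓡 n) f x (V x)

/-- `Z₁ ∧ … ∧ Z_q ≠ 0` and `dF₁ ∧ … ∧ dF_r ≠ 0` at the point `x`. -/
def IndependentAt {q r : ℕ} (Z : Fin q → (x : M) → TangentSpace (𝓡 n) x) (F : Fin r → M → ℝ)
    (x : M) : Prop :=
  LinearIndependent ℝ (fun i => Z i x) ∧ LinearIndependent ℝ (fun j => mvfderiv (𝓡 n) (F j) x)

variable (n) in
/-- A set is null if its image in every chart of the atlas is Lebesgue-null. -/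
def ManifoldNull (S : Set M) : Prop :=
  ∀ e ∈ atlas (EuclideanSpace ℝ (Fin n)) M, volume (e '' (S ∩ e.source)) = 0

/-! ### Coordinates on a tubular neighbourhood of a torus -/

/-- `Φ` is a diffeomorphism from `𝕋^q × B^r` (`B^r` the open unit ball) onto an open neighbourhood
`Φ.target` of `N` in `M`, mapping `𝕋^q × {0}` onto `N`.  The coordinates of `x ∈ Φ.target` are
`(θ, γ) = Φ.symm x`. -/
structure IsTubularChart {q r : ℕ} (N : Set M)
    (Φ : OpenPartialHomeomorph (Torus q × EuclideanSpace ℝ (Fin r)) M) : Prop where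
  source_eq : Φ.source = univ ×ˢ Metric.ball 0 1
  smooth : ContMDiffOn (𝓘(ℝ, Fin q → ℝ).prod (𝓡 r)) (𝓡 n) ∞ Φ Φ.source
  smooth_symm : ContMDiffOn (𝓡 n) (𝓘(ℝ, Fin q → ℝ).prod (𝓡 r)) ∞ Φ.symm Φ.target
  image_zero : Φ '' (univ ×ˢ {0}) = N

/-- The coordinate vector field `∂/∂θ_k` of the coordinates `(θ, γ) = Φ.symm x`: its value at `x` is
the velocity at `s = 0` of the curve `s ↦ Φ (θ + s e_k, γ)`. -/
def angularField {q r : ℕ} (Φ : OpenPartialHomeomorph (Torus q × EuclideanSpace ℝ (Fin r)) M)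
    (k : Fin q) (x : M) : TangentSpace (𝓡 n) x :=
  (mfderiv 𝓘(ℝ, ℝ) (𝓡 n)
    (fun s : ℝ => Φ ((Φ.symm x).1 + Torus.proj (Pi.single k s), (Φ.symm x).2)) 0 :
    ℝ →L[ℝ] EuclideanSpace ℝ (Fin n)) 1

/-! ### Stochastic dynamical systems and their generators -/

variable [IsManifold (𝓡 n) ∞ M]

variable (n M) in
/-- A stochastic dynamical system `X = X₀ + ∑_{i=1}^m Xᵢ ∘ dBⁱ/dt` on an open subset `U` of the
`n`-manifold `M`, given by its smooth vector fields `X₀, X₁, …, X_m` on `U`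
(their values outside `U` are irrelevant). -/
structure SDS (U : Set M) (m : ℕ) where
  /-- `field 0` is the drift `X₀`, and `field i` for `i = 1, …, m` is the coefficient of `dBⁱ`. -/
  field : Fin (m + 1) → (x : M) → TangentSpace (𝓡 n) x
  smooth : ∀ i, ContMDiffOn (𝓡 n) (𝓡 n).tangent ∞
    (fun x => (⟨x, field i x⟩ : TangentBundle (𝓡 n) M)) U

/-- The generator (diffusion operator) `A_X = X₀ + ½ ∑_{i=1}^m Xᵢ²`. -/
def SDS.generator {U : Set M} {m : ℕ} (X : SDS n M U m) (f : M → ℝ) (x : M) : ℝ :=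
  lieDeriv (X.field 0) f x +
    (1 / 2) * ∑ i : Fin m, lieDeriv (X.field i.succ) (lieDeriv (X.field i.succ) f) x

/-- Two systems are diffusion equivalent on an open set `W` (contained in both domains) if their
generators agree on `W`, as operators on smooth functions. -/
def SDS.DiffusionEquivOn {U V : Set M} {m l : ℕ} (X : SDS n M U m) (Y : SDS n M V l)
    (W : Set M) : Prop :=
  ∀ f : M → ℝ, ContMDiffOn (𝓡 n) 𝓘(ℝ, ℝ) ∞ f W → ∀ x ∈ W, X.generator f x = Y.generator f x

/-! ### Integrability -/

/-- `(Z₁, …, Z_q, F₁, …, F_r)` is a (deterministic) integrable system of type `(q, r)`. -/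
structure IsIntegrableSystem {q r : ℕ} (Z : Fin q → (x : M) → TangentSpace (𝓡 n) x)
    (F : Fin r → M → ℝ) : Prop where
  dim_eq : q + r = n
  smooth_field : ∀ i, ContMDiff (𝓡 n) (𝓡 n).tangent ∞
    (fun x => (⟨x, Z i x⟩ : TangentBundle (𝓡 n) M))
  smooth_fun : ∀ j, ContMDiff (𝓡 n) 𝓘(ℝ, ℝ) ∞ (F j)
  commute : ∀ i j x, VectorField.mlieBracket (𝓡 n) (Z i) (Z j) x = 0
  first_integral : ∀ i j x, lieDeriv (Z i) (F j) x = 0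
  independent_ae : ManifoldNull n {x | ¬ IndependentAt Z F x}

/-- `X` is integrable of type `(0, q, r)` with the aid of `(Z₁, …, Z_q, F₁, …, F_r)`: the latter is
an integrable system, and the generator of `X` commutes, as a differential operator, with every
`Zᵢ` and with multiplication by every `Fⱼ`. -/
structure SDS.IsIntegrableWith {m q r : ℕ} (X : SDS n M univ m)
    (Z : Fin q → (x : M) → TangentSpace (𝓡 n) x) (F : Fin r → M → ℝ) : Prop where
  system : IsIntegrableSystem Z F
  commute_field : ∀ i, ∀ f : M → ℝ, ContMDiff (𝓡 n) 𝓘(ℝ, ℝ) ∞ f →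
    ∀ x, X.generator (lieDeriv (Z i) f) x = lieDeriv (Z i) (X.generator f) x
  commute_fun : ∀ j, ∀ f : M → ℝ, ContMDiff (𝓡 n) 𝓘(ℝ, ℝ) ∞ f →
    ∀ x, X.generator (fun y => F j y * f y) x = F j x * X.generator f x

end Systems

end

noncomputable section

/-! ### Parameter integrals and primitives of closed forms depending on parameters. -/

section Analysis
open Filter Topology

/-! The geometric half is a Liouville–Arnold argument. At a regular point the `Zᵢ` span the common
kernel of the `dFⱼ`. In coordinates adapted to `F`, the inverse of the matrix of the commuting frame
is a closed form along the leaves; its primitives, together with `F`, are coordinates in which `Zᵢ`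
is the `i`-th coordinate field (`exists_primitive_of_commuting`, `exists_isRectifying`). Since `F`
is proper, these charts have a uniform size `ε` on all fibres over a neighbourhood `B` of `c`
(`exists_uniform_isRectifying`). In such a chart the flow of `∑ tᵢ Zᵢ` is translation by `t` as long
as `‖t‖ < ε`, so the small-time flows are additive with a uniform bound and generate an action `Ψ`
of `ℝ^q` over `B` (`exists_isLeafFlow`).

Orbits are open in fibres, so the connected fibre `N` is one orbit. The stabiliser of a point of `N`
is discrete by straightening and cocompact by compactness, hence a lattice
(`IsLeafFlow.exists_basis_stabilizer`). Along a local section `σ`, a basis of periods of `N` is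
corrected to periods of the nearby orbits, and these depend smoothly on `γ`; they form the matrix `Ω
γ` (`IsLeafFlow.exists_isPeriodFamily`). The map `(θ, γ) ↦ Ψ (Ω γ θ) (σ γ)` then descends to a
diffeomorphism from torus times ball onto a tube around `N` (`IsLeafFlow.exists_isLeafTube`).
Connectedness is needed for `N` only: over other values the tube consists of the orbits through `σ`.

The stochastic half compares generators. Commutation with multiplication by `Fⱼ`, tested on `1` and
on `Fⱼ`, makes the generator `A` kill `Fⱼ` and `Fⱼ²`; since `A(Fⱼ²) - 2 Fⱼ A(Fⱼ) = ∑ (Xᵢ Fⱼ)²`,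
every field is tangent to the leaves (`SDS.IsIntegrableWith.lieDeriv_field_eq_zero`). Over `B`
therefore `A = ∑ bₗ Zₗ + ½ ∑ aₖₗ Zₖ Zₗ`, and commutation with the `Zⱼ` forces `a` and `b` to be
constant along the flow (`SDS.IsIntegrableWith.lieDeriv_coeff_eq_zero`). The fields `Xᵢ` themselves
need not have constant coefficients. Freezing the coefficients of `X₁, …, X_m` at their values on
`σ` preserves `a`, and taking `b` as drift then gives the same generator
(`IsLeafTube.exists_normalForm`). No smooth square root of `a` has to be found. -/

lemma hasFDerivAt_intervalIntegral_of_contDiff {E F : Type*} [NormedAddCommGroup E]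
    [NormedSpace ℝ E] [FiniteDimensional ℝ E] [NormedAddCommGroup F] [NormedSpace ℝ F]
    {f : E × ℝ → F} (hf : ContDiff ℝ 1 f) (a b : ℝ) (x₀ : E) :
    HasFDerivAt (fun x => ∫ s in a..b, f (x, s))
      (∫ s in a..b, (fderiv ℝ f (x₀, s)).comp (ContinuousLinearMap.inl ℝ E ℝ)) x₀ := by
  have hc : Continuous fun p : E × ℝ =>
      (fderiv ℝ f p).comp (ContinuousLinearMap.inl ℝ E ℝ) :=
    (hf.continuous_fderiv one_ne_zero).clm_comp continuous_const
  obtain ⟨C, hC⟩ := ((isCompact_closedBall x₀ 1).prod (isCompact_uIcc (a := a) (b := b))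
    ).exists_bound_of_continuousOn hc.continuousOn
  refine intervalIntegral.hasFDerivAt_integral_of_dominated_of_fderiv_le (𝕜 := ℝ)
    (bound := fun _ => C) (F' := fun x s => (fderiv ℝ f (x, s)).comp
      (ContinuousLinearMap.inl ℝ E ℝ)) (Metric.closedBall_mem_nhds x₀ one_pos) ?_ ?_ ?_ ?_ ?_ ?_
  · filter_upwards with x
    exact (hf.continuous.comp (by fun_prop : Continuous fun s : ℝ => (x, s))).aestronglyMeasurable
  · exact (hf.continuous.comp (by fun_prop : Continuous fun s : ℝ => (x₀, s))).intervalIntegrable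
      _ _
  · exact (hc.comp (by fun_prop : Continuous fun s : ℝ => (x₀, s))).aestronglyMeasurable
  · filter_upwards with s hs x hx
    exact hC (x, s) ⟨hx, uIoc_subset_uIcc hs⟩
  · exact intervalIntegrable_const
  · filter_upwards with s _ x _
    have h1 : HasFDerivAt f (fderiv ℝ f (x, s)) (x, s) :=
      (hf.differentiable one_ne_zero (x, s)).hasFDerivAt
    exact h1.comp x (hasFDerivAt_prodMk_left x s)

/-- Induction on the order of smoothness, the derivative being again a parameter integral. `E` and
`F` share a universe because the induction replaces `F` by `E →L[ℝ] F`. -/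
lemma contDiff_intervalIntegral {E F : Type u} [NormedAddCommGroup E]
    [NormedSpace ℝ E] [FiniteDimensional ℝ E] [NormedAddCommGroup F] [NormedSpace ℝ F]
    {f : E × ℝ → F} (hf : ContDiff ℝ ∞ f) (a b : ℝ) :
    ContDiff ℝ ∞ fun x => ∫ s in a..b, f (x, s) := by
  rw [contDiff_infty]
  intro n
  induction n generalizing F with
  | zero =>
    rw [Nat.cast_zero, contDiff_zero]
    exact continuous_iff_continuousAt.2 fun x =>
      (hasFDerivAt_intervalIntegral_of_contDiff (hf.of_le (by simp)) a b x).continuousAt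
  | succ n ih =>
    push_cast
    rw [contDiff_succ_iff_fderiv]
    refine ⟨fun x => (hasFDerivAt_intervalIntegral_of_contDiff (hf.of_le (by simp)) a b
      x).differentiableAt, by simp, ?_⟩
    have : fderiv ℝ (fun x => ∫ s in a..b, f (x, s)) = fun x => ∫ s in a..b,
        (fderiv ℝ f (x, s)).comp (ContinuousLinearMap.inl ℝ E ℝ) :=
      funext fun x => (hasFDerivAt_intervalIntegral_of_contDiff (hf.of_le (by simp)) a b x).fderiv
    rw [this]
    exact ih (f := fun p => (fderiv ℝ f p).comp (ContinuousLinearMap.inl ℝ E ℝ))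
      ((hf.fderiv_right (by simp)).clm_comp contDiff_const)

lemma isOpen_setOf_isInvertible {E F : Type*} [NormedAddCommGroup E] [NormedSpace ℝ E]
    [NormedAddCommGroup F] [NormedSpace ℝ F] [CompleteSpace E] :
    IsOpen {A : E →L[ℝ] F | A.IsInvertible} := by
  have : {A : E →L[ℝ] F | A.IsInvertible} = range ((↑) : (E ≃L[ℝ] F) → E →L[ℝ] F) := rfl
  rw [this]
  exact ContinuousLinearEquiv.isOpen

lemma ContinuousLinearMap.IsInvertible.contDiffAt_inverse {E F : Type*} [NormedAddCommGroup E]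
    [NormedSpace ℝ E] [NormedAddCommGroup F] [NormedSpace ℝ F] [CompleteSpace E]
    {A : E →L[ℝ] F} (hA : A.IsInvertible) {n : WithTop ℕ∞} :
    ContDiffAt ℝ n ContinuousLinearMap.inverse A := by
  obtain ⟨e, rfl⟩ := hA
  exact _root_.contDiffAt_map_inverse e

/-- A closed frame depending smoothly on parameters is locally a coordinate frame. -/
lemma exists_primitive_of_commuting {V W : Type u} [NormedAddCommGroup V] [NormedSpace ℝ V]
    [FiniteDimensional ℝ V] [NormedAddCommGroup W] [NormedSpace ℝ W] [FiniteDimensional ℝ W]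
    {A : V × W → V →L[ℝ] V} {O : Set (V × W)} (hO : IsOpen O) {z₀ : V × W} (hz₀ : z₀ ∈ O)
    (hA : ContDiffOn ℝ ∞ A O) (hinv : (A z₀).IsInvertible)
    (hcomm : ∀ z ∈ O, ∀ u w, fderiv ℝ A z (A z u, 0) w = fderiv ℝ A z (A z w, 0) u) :
    ∃ T : V × W → V, ContDiff ℝ ∞ T ∧
      ∀ᶠ z in 𝓝 z₀, ∀ u, fderiv ℝ T z (A z u, 0) = u := by
  set B : V × W → V →L[ℝ] V := fun z => (A z).inverse with hB
  set O₁ := O ∩ A ⁻¹' {A | A.IsInvertible} with hO₁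
  have hO₁o : IsOpen O₁ := hA.continuousOn.isOpen_inter_preimage hO isOpen_setOf_isInvertible
  have hBs : ∀ z ∈ O₁, ContDiffAt ℝ ∞ B z := fun z hz =>
    hz.2.contDiffAt_inverse.comp z (hA.contDiffAt (hO.mem_nhds hz.1))
  obtain ⟨R, hR, hRO⟩ := Metric.isOpen_iff.1 hO₁o z₀ ⟨hz₀, hinv⟩
  -- The cutoff makes the integrand of `T` smooth everywhere; nothing is lost near `z₀`, since `χ =
  -- 1` on the ball of radius `R / 4`.
  let χ : ContDiffBump z₀ := ⟨R / 4, R / 2, by positivity, by linarith⟩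
  set C : V × W → V →L[ℝ] V := fun z => χ z • B z with hC
  have hCs : ContDiff ℝ ∞ C := by
    rw [contDiff_iff_contDiffAt]
    intro z
    by_cases hz : z ∈ O₁
    · exact χ.contDiffAt.smul (hBs z hz)
    · have h1 : z ∉ tsupport χ := by
        rw [χ.tsupport_eq]
        exact fun h => hz (hRO (Metric.closedBall_subset_ball (by simp [χ]; linarith) h))
      have h2 : C =ᶠ[𝓝 z] fun _ => 0 := by
        filter_upwards [notMem_tsupport_iff_eventuallyEq.1 h1] with y hy
        simp [hC, hy]
      exact contDiffAt_const.congr_of_eventuallyEq h2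
  have hCB : ∀ z ∈ Metric.ball z₀ (R / 4), C z = B z := fun z hz => by
    have : χ z = 1 := χ.one_of_mem_closedBall (Metric.ball_subset_closedBall hz)
    simp [hC, this]
  set T : V × W → V := fun z => ∫ s in (0 : ℝ)..1, C (z₀.1 + s • (z.1 - z₀.1), z.2) (z.1 - z₀.1)
    with hT
  have hTs : ContDiff ℝ ∞ T := by
    refine contDiff_intervalIntegral (f := fun p : (V × W) × ℝ =>
      C (z₀.1 + p.2 • (p.1.1 - z₀.1), p.1.2) (p.1.1 - z₀.1)) ?_ 0 1
    exact (hCs.comp (by fun_prop)).clm_apply (by fun_prop)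
  refine ⟨T, hTs, ?_⟩
  have hball : ∀ z ∈ Metric.ball z₀ (R / 4), z ∈ O₁ := fun z hz =>
    hRO (Metric.ball_subset_ball (by linarith) hz)
  have hBA : ∀ z ∈ O₁, ∀ u, B z (A z u) = u := fun z hz u => by
    obtain ⟨e, he⟩ := hz.2
    simp [hB, ← he]
  have hAB : ∀ z ∈ O₁, ∀ u, A z (B z u) = u := fun z hz u => by
    obtain ⟨e, he⟩ := hz.2
    simp [hB, ← he]
  -- Differentiating `B A = id` turns the vanishing brackets of the frame `A` into closedness of the
  -- form `B` in the `V` directions.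
  have hclosed : ∀ z ∈ O₁, ∀ u w, fderiv ℝ B z (u, 0) w = fderiv ℝ B z (w, 0) u := by
    intro z hz
    have hBd : HasFDerivAt B (fderiv ℝ B z) z :=
      ((hBs z hz).differentiableAt (by simp)).hasFDerivAt
    have hAd : HasFDerivAt A (fderiv ℝ A z) z :=
      ((hA.contDiffAt (hO.mem_nhds hz.1)).differentiableAt (by simp)).hasFDerivAt
    have key : ∀ h u, fderiv ℝ B z h (A z u) = - B z (fderiv ℝ A z h u) := by
      intro h u
      have h1 : HasFDerivAt (fun y => B y (A y u)) _ z :=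
        hBd.clm_apply (hAd.clm_apply (hasFDerivAt_const u z))
      have h2 : HasFDerivAt (fun y => B y (A y u)) (0 : V × W →L[ℝ] V) z := by
        refine (hasFDerivAt_const u z).congr_of_eventuallyEq ?_
        filter_upwards [hO₁o.mem_nhds hz] with y hy
        exact hBA y hy u
      have h3 := congrArg (fun L => L h) (h1.unique h2)
      simp at h3
      rw [eq_neg_iff_add_eq_zero, add_comm]
      exact h3
    intro u w
    rw [← hAB z hz u, ← hAB z hz w, key, key, hcomm z hz.1]
  filter_upwards [Metric.ball_mem_nhds z₀ (by positivity : 0 < R / 4)] with z hz u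
  have hz' := hz
  rw [← ball_prod_same] at hz'
  have hγ : ∀ y ∈ Metric.ball z₀.1 (R / 4), (y, z.2) ∈ Metric.ball z₀ (R / 4) := fun y hy => by
    rw [← ball_prod_same]; exact ⟨hy, hz'.2⟩
  have hd : ∀ y ∈ Metric.ball z₀.1 (R / 4), HasFDerivAt (fun y => B (y, z.2))
      ((fderiv ℝ B (y, z.2)).comp (ContinuousLinearMap.inl ℝ V W)) y := fun y hy =>
    HasFDerivAt.comp (g := B) (f := fun y => (y, z.2)) y
      ((hBs _ (hball _ (hγ y hy))).differentiableAt (by simp)).hasFDerivAt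
      (hasFDerivAt_prodMk_left y z.2)
  have hdo : DifferentiableOn ℝ (fun y => B (y, z.2)) (Metric.ball z₀.1 (R / 4)) := fun y hy =>
    (hd y hy).differentiableAt.differentiableWithinAt
  -- The Poincaré lemma supplies `P` for one frozen parameter, with no control of the dependence on
  -- it. The explicit integral `T` is jointly smooth, and the fundamental theorem of calculus
  -- identifies it with `P` up to a constant.
  obtain ⟨P, hP⟩ := (convex_ball z₀.1 (R / 4)).exists_forall_hasFDerivAt_of_fderiv_symmetric
    Metric.isOpen_ball hdo (fun y hy u w => by
      rw [(hd y hy).fderiv]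
      simpa using hclosed _ (hball _ (hγ y hy)) u w)
  have hTP : ∀ y ∈ Metric.ball z₀.1 (R / 4), T (y, z.2) = P y - P z₀.1 := by
    intro y hy
    have hseg : ∀ s ∈ uIcc (0 : ℝ) 1, z₀.1 + s • (y - z₀.1) ∈ Metric.ball z₀.1 (R / 4) := by
      intro s hs
      rw [uIcc_of_le zero_le_one] at hs
      exact (convex_ball z₀.1 (R / 4)).add_smul_sub_mem (Metric.mem_ball_self (by positivity)) hy hs
    have hder : ∀ s ∈ uIcc (0 : ℝ) 1, HasDerivAt (fun s : ℝ => P (z₀.1 + s • (y - z₀.1)))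
        (C (z₀.1 + s • (y - z₀.1), z.2) (y - z₀.1)) s := by
      intro s hs
      rw [hCB _ (hγ _ (hseg s hs))]
      have h1 : HasDerivAt (fun s : ℝ => z₀.1 + s • (y - z₀.1)) (y - z₀.1) s := by
        simpa using ((hasDerivAt_id s).smul_const (y - z₀.1)).const_add z₀.1
      exact (hP _ (hseg s hs)).comp_hasDerivAt s h1
    have h2 := intervalIntegral.integral_eq_sub_of_hasDerivAt hder
      (Continuous.intervalIntegrable (by
        exact (hCs.continuous.comp (by fun_prop)).clm_apply (by fun_prop)) _ _)
    simp only [hT]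
    rw [h2]
    simp
  have h1 : HasFDerivAt (fun y => T (y, z.2)) (B z) z.1 := by
    refine ((hP z.1 hz'.1).sub_const (P z₀.1)).congr_of_eventuallyEq ?_
    filter_upwards [Metric.isOpen_ball.mem_nhds hz'.1] with y hy using hTP y hy
  have h2 : HasFDerivAt (fun y => T (y, z.2)) _ z.1 :=
    HasFDerivAt.comp (g := T) (f := fun y => (y, z.2)) z.1
      (hTs.differentiable (by simp) (z.1, z.2)).hasFDerivAt
      (hasFDerivAt_prodMk_left z.1 z.2)
  have h3 := congrArg (fun L => L (A z u)) (h2.unique h1)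
  simp only [ContinuousLinearMap.comp_apply, ContinuousLinearMap.inl_apply] at h3
  rw [hBA z (hball z hz)] at h3
  exact h3

end Analysis

/-! ### From local to global homomorphisms. -/

section LocalHom
variable {V N : Type*} [NormedAddCommGroup V] [NormedSpace ℝ V] [Monoid N]

/-- The norms `‖j • s‖` increase with `j`, so no partial sum leaves the ball where `f` is additive.
-/
lemma map_nsmul_of_local_add {f : V → N} {ε : ℝ} (h0 : f 0 = 1)
    (hadd : ∀ s t, ‖s‖ < ε → ‖t‖ < ε → ‖s + t‖ < ε → f (s + t) = f s * f t) (k : ℕ) (s : V)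
    (hs : ‖k • s‖ < ε) : f (k • s) = f s ^ k := by
  induction k with
  | zero => simp [h0]
  | succ k ih =>
    have hle : ‖k • s‖ ≤ ‖(k + 1) • s‖ := by
      rw [← Nat.cast_smul_eq_nsmul ℝ, ← Nat.cast_smul_eq_nsmul ℝ, norm_smul, norm_smul]
      simp only [Real.norm_natCast]
      gcongr
      simp
    have hle1 : ‖s‖ ≤ ‖(k + 1) • s‖ := by
      rw [← Nat.cast_smul_eq_nsmul ℝ, norm_smul]
      simp only [Real.norm_natCast]
      refine le_mul_of_one_le_left (norm_nonneg s) ?_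
      simp
    rw [add_nsmul, one_nsmul] at hs hle hle1 ⊢
    rw [hadd _ _ (hle.trans_lt hs) (hle1.trans_lt hs) hs, ih (hle.trans_lt hs), pow_succ]

/-- A map which is additive near `0` extends to a global homomorphism. -/
lemma exists_global_extension_of_local_add {f : V → N} {ε : ℝ} (hε : 0 < ε) (h0 : f 0 = 1)
    (hadd : ∀ s t, ‖s‖ < ε → ‖t‖ < ε → ‖s + t‖ < ε → f (s + t) = f s * f t) :
    ∃ g : V → N, (∀ s t, g (s + t) = g s * g t) ∧ (∀ t, ‖t‖ < ε → g t = f t) ∧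
      ∀ t, ∃ (k : ℕ) (s : V), ‖s‖ < ε ∧ g t = f s ^ k := by
  have hk : ∀ t : V, ∃ k : ℕ, 0 < k ∧ ‖t‖ < k * ε := by
    intro t
    obtain ⟨k, hk⟩ := exists_nat_gt (‖t‖ / ε)
    refine ⟨k, ?_, by rwa [div_lt_iff₀ hε] at hk⟩
    exact_mod_cast (div_nonneg (norm_nonneg t) hε.le).trans_lt hk
  choose K hKpos hK using hk
  have hsmall : ∀ (t : V) (k : ℕ), 0 < k → ‖t‖ < k * ε → ‖(k : ℝ)⁻¹ • t‖ < ε := by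
    intro t k hk0 hk
    have : (0 : ℝ) < k := by exact_mod_cast hk0
    rw [norm_smul, norm_inv, Real.norm_natCast, inv_mul_lt_iff₀ this]
    exact hk
  -- The extension is `f (t / k) ^ k` for any large `k`. Two denominators `k` and `l` are compared
  -- through `k * l`.
  have hrefine : ∀ (t : V) (k l : ℕ), 0 < k → 0 < l → ‖t‖ < k * ε →
      f ((k : ℝ)⁻¹ • t) ^ k = f (((k * l : ℕ) : ℝ)⁻¹ • t) ^ (k * l) := by
    intro t k l hk0 hl0 hk
    have hl : (l : ℝ) ≠ 0 := by exact_mod_cast hl0.ne'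
    have h1 : (k : ℝ)⁻¹ • t = l • (((k * l : ℕ) : ℝ)⁻¹ • t) := by
      rw [← Nat.cast_smul_eq_nsmul ℝ, smul_smul]
      congr 1
      push_cast
      field_simp
    have h2 := hsmall t k hk0 hk
    rw [h1] at h2
    rw [h1, map_nsmul_of_local_add h0 hadd l _ h2, ← pow_mul, mul_comm]
  have hindep : ∀ (t : V) (k l : ℕ), 0 < k → 0 < l → ‖t‖ < k * ε → ‖t‖ < l * ε →
      f ((k : ℝ)⁻¹ • t) ^ k = f ((l : ℝ)⁻¹ • t) ^ l := by
    intro t k l hk0 hl0 hk hl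
    rw [hrefine t k l hk0 hl0 hk, hrefine t l k hl0 hk0 hl, mul_comm]
  refine ⟨fun t => f ((K t : ℝ)⁻¹ • t) ^ K t, ?_, ?_, fun t =>
    ⟨K t, _, hsmall t _ (hKpos t) (hK t), rfl⟩⟩
  · intro s t
    -- A single denominator large enough for `s`, `t` and `s + t`.
    set k := K s + K t + K (s + t) with hk
    have hcast : (k : ℝ) = K s + K t + K (s + t) := by rw [hk]; push_cast; ring
    have hk0 : 0 < k := by have := hKpos s; omega
    have h1 : ‖s‖ < k * ε := (hK s).trans_le (by rw [hcast]; gcongr; linarith [(Nat.cast_nonneg (K t) : (0:ℝ) ≤ _), (Nat.cast_nonneg (K (s+t)) : (0:ℝ) ≤ _)])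
    have h2 : ‖t‖ < k * ε := (hK t).trans_le (by rw [hcast]; gcongr; linarith [(Nat.cast_nonneg (K s) : (0:ℝ) ≤ _), (Nat.cast_nonneg (K (s+t)) : (0:ℝ) ≤ _)])
    have h3 : ‖s + t‖ < k * ε := (hK (s + t)).trans_le (by rw [hcast]; gcongr; linarith [(Nat.cast_nonneg (K s) : (0:ℝ) ≤ _), (Nat.cast_nonneg (K t) : (0:ℝ) ≤ _)])
    show f ((K (s + t) : ℝ)⁻¹ • (s + t)) ^ K (s + t) =
      f ((K s : ℝ)⁻¹ • s) ^ K s * f ((K t : ℝ)⁻¹ • t) ^ K t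
    rw [hindep _ _ k (hKpos _) hk0 (hK _) h3, hindep _ _ k (hKpos _) hk0 (hK s) h1,
      hindep _ _ k (hKpos _) hk0 (hK t) h2, smul_add]
    have h1' := hsmall s k hk0 h1
    have h2' := hsmall t k hk0 h2
    have h3' := hsmall (s + t) k hk0 h3
    rw [smul_add] at h3'
    -- The target is not commutative, but values of `f` at small vectors commute, because addition
    -- in `V` does.
    have hcomm : Commute (f ((k : ℝ)⁻¹ • s)) (f ((k : ℝ)⁻¹ • t)) := by
      rw [commute_iff_eq, ← hadd _ _ h1' h2' h3', add_comm, hadd _ _ h2' h1' (by rwa [add_comm])]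
    rw [hadd _ _ h1' h2' h3', hcomm.mul_pow]
  · intro t ht
    show f ((K t : ℝ)⁻¹ • t) ^ K t = f t
    rw [hindep t (K t) 1 (hKpos t) one_pos (hK t) (by simpa using ht)]
    simp

end LocalHom

/-! ### Calculus on the manifold: commuting derivatives and the inverse function theorem. -/

section Derivatives
open Filter Topology VectorField

variable {n : ℕ} {M : Type*} [TopologicalSpace M] [ChartedSpace (EuclideanSpace ℝ (Fin n)) M]
  [IsManifold (𝓡 n) ∞ M] {E' : Type*} [NormedAddCommGroup E'] [NormedSpace ℝ E']

omit [IsManifold (𝓡 n) ∞ M] in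
lemma mvfderiv_congr_of_eventuallyEq {f g : M → E'} {x : M} (h : f =ᶠ[𝓝 x] g) :
    mvfderiv (𝓡 n) f x = mvfderiv (𝓡 n) g x := by
  have := h.mfderiv_eq (I := 𝓡 n) (I' := 𝓘(ℝ, E'))
  ext v
  exact congrArg (fun L : EuclideanSpace ℝ (Fin n) →L[ℝ] E' => L v) this

lemma contMDiffOn_mvfderiv_apply {f : M → E'} {V : (x : M) → TangentSpace (𝓡 n) x} {O : Set M}
    (hO : IsOpen O) (hf : ContMDiffOn (𝓡 n) 𝓘(ℝ, E') ∞ f O)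
    (hV : ContMDiffOn (𝓡 n) (𝓡 n).tangent ∞
      (fun x => (⟨x, V x⟩ : TangentBundle (𝓡 n) M)) O) :
    ContMDiffOn (𝓡 n) 𝓘(ℝ, E') ∞ (fun x => mvfderiv (𝓡 n) f x (V x)) O := by
  have : IsManifold (𝓡 n) 1 M := IsManifold.of_le (n := ∞) (by simp)
  have h1 := (hf.contMDiffOn_tangentMapWithin (m := ∞) (by simp) hO.uniqueMDiffOn).comp hV
    (fun x hx => hx)
  have h2 := (contMDiff_snd_tangentBundle_modelSpace E' 𝓘(ℝ, E') (n := ∞)).comp_contMDiffOn h1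
  refine h2.congr fun x hx => ?_
  have h3 := mfderivWithin_of_isOpen (I := 𝓡 n) (I' := 𝓘(ℝ, E')) (f := f) hO hx
  exact congrArg (fun L : EuclideanSpace ℝ (Fin n) →L[ℝ] E' => L (V x)) h3.symm

lemma mvfderiv_eq_fderiv_chart {f : M → E'} {x y : M} (hy : y ∈ (extChartAt (𝓡 n) x).source)
    (hf : MDifferentiableAt (𝓡 n) 𝓘(ℝ, E') f y) (v : TangentSpace (𝓡 n) y) :
    mvfderiv (𝓡 n) f y v = fderiv ℝ (f ∘ (extChartAt (𝓡 n) x).symm) (extChartAt (𝓡 n) x y)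
      (mfderiv (𝓡 n) 𝓘(ℝ, EuclideanSpace ℝ (Fin n)) (extChartAt (𝓡 n) x) y v) := by
  have : IsManifold (𝓡 n) 1 M := IsManifold.of_le (n := ∞) (by simp)
  set φ := extChartAt (𝓡 n) x with hφ
  have hs : MDifferentiableAt 𝓘(ℝ, EuclideanSpace ℝ (Fin n)) (𝓡 n) φ.symm (φ y) :=
    ((contMDiffOn_extChartAt_symm (n := 1) x).mdifferentiableOn one_ne_zero _
      (φ.map_source hy)).mdifferentiableAt ((isOpen_extChartAt_target x).mem_nhds (φ.map_source hy))
  have hφd : MDifferentiableAt (𝓡 n) 𝓘(ℝ, EuclideanSpace ℝ (Fin n)) φ y :=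
    mdifferentiableAt_extChartAt (by simpa [hφ] using hy)
  have hfd : MDifferentiableAt 𝓘(ℝ, EuclideanSpace ℝ (Fin n)) 𝓘(ℝ, E') (f ∘ φ.symm) (φ y) := by
    refine MDifferentiableAt.comp (φ y) ?_ hs
    rwa [φ.left_inv hy]
  have he : f =ᶠ[𝓝 y] (f ∘ φ.symm) ∘ φ := by
    filter_upwards [(isOpen_extChartAt_source x).mem_nhds hy] with z hz
    simp [φ.left_inv hz]
  rw [mvfderiv_congr_of_eventuallyEq he]
  refine (mfderiv_comp_apply y hfd hφd v).trans ?_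
  rw [mfderiv_eq_fderiv]
  rfl

/-- `mlieBracket` is defined through the pullback by the inverse chart; here that pullback is
recognised as the image of the field under the derivative of the chart. -/
lemma mpullbackWithin_chart_apply (V : (x : M) → TangentSpace (𝓡 n) x) {x y : M}
    (hy : y ∈ (extChartAt (𝓡 n) x).source) :
    mpullbackWithin 𝓘(ℝ, EuclideanSpace ℝ (Fin n)) (𝓡 n) (extChartAt (𝓡 n) x).symm V
      (range (𝓡 n)) (extChartAt (𝓡 n) x y) =
    mfderiv (𝓡 n) 𝓘(ℝ, EuclideanSpace ℝ (Fin n)) (extChartAt (𝓡 n) x) y (V y) := by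
  have : IsManifold (𝓡 n) 1 M := IsManifold.of_le (n := ∞) (by simp)
  set φ := extChartAt (𝓡 n) x with hφ
  have h1 := mfderivWithin_extChartAt_symm_comp_mfderiv_extChartAt' (I := 𝓡 n) (x := x) (y := y) hy
  have h2 := isInvertible_mfderivWithin_extChartAt_symm (I := 𝓡 n) (x := x) (φ.map_source hy)
  rw [mpullbackWithin_apply]
  obtain ⟨e, he⟩ := h2
  rw [← hφ] at h1 
  rw [← he] at h1 ⊢
  rw [ContinuousLinearMap.inverse_equiv]
  have h3 : φ.symm (φ y) = y := φ.left_inv hy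
  have h4 : V (φ.symm (φ y)) = (V y : EuclideanSpace ℝ (Fin n)) := by rw [h3]
  have h5 := congrArg (fun L : EuclideanSpace ℝ (Fin n) →L[ℝ] EuclideanSpace ℝ (Fin n) =>
    L (V y)) h1
  refine e.injective ?_
  refine (e.apply_symm_apply _).trans ?_
  exact h4.trans h5.symm

/-- Derivatives along commuting vector fields commute. -/
lemma mvfderiv_mvfderiv_comm {f : M → E'} {V W : (x : M) → TangentSpace (𝓡 n) x} {O : Set M}
    (hO : IsOpen O) (hf : ContMDiffOn (𝓡 n) 𝓘(ℝ, E') ∞ f O)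
    (hV : ContMDiff (𝓡 n) (𝓡 n).tangent ∞ (fun x => (⟨x, V x⟩ : TangentBundle (𝓡 n) M)))
    (hW : ContMDiff (𝓡 n) (𝓡 n).tangent ∞ (fun x => (⟨x, W x⟩ : TangentBundle (𝓡 n) M)))
    {x : M} (hx : x ∈ O) (hVW : mlieBracket (𝓡 n) V W x = 0) :
    mvfderiv (𝓡 n) (fun y => mvfderiv (𝓡 n) f y (W y)) x (V x) =
      mvfderiv (𝓡 n) (fun y => mvfderiv (𝓡 n) f y (V y)) x (W x) := by
  have : IsManifold (𝓡 n) 1 M := IsManifold.of_le (n := ∞) (by simp)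
  have : IsManifold (𝓡 n) 2 M := IsManifold.of_le (n := ∞) (WithTop.coe_le_coe.2 le_top)
  set φ := extChartAt (𝓡 n) x with hφ
  have hxφ : x ∈ φ.source := mem_extChartAt_source x
  set V' : EuclideanSpace ℝ (Fin n) → EuclideanSpace ℝ (Fin n) :=
    mpullbackWithin 𝓘(ℝ, EuclideanSpace ℝ (Fin n)) (𝓡 n) φ.symm V (range (𝓡 n)) with hV'
  set W' : EuclideanSpace ℝ (Fin n) → EuclideanSpace ℝ (Fin n) :=
    mpullbackWithin 𝓘(ℝ, EuclideanSpace ℝ (Fin n)) (𝓡 n) φ.symm W (range (𝓡 n)) with hW'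
  have hdiff : ∀ U : (x : M) → TangentSpace (𝓡 n) x,
      ContMDiff (𝓡 n) (𝓡 n).tangent ∞ (fun x => (⟨x, U x⟩ : TangentBundle (𝓡 n) M)) →
      DifferentiableAt ℝ (mpullbackWithin 𝓘(ℝ, EuclideanSpace ℝ (Fin n)) (𝓡 n) φ.symm U
        (range (𝓡 n)) : EuclideanSpace ℝ (Fin n) → EuclideanSpace ℝ (Fin n)) (φ x) := by
    intro U hU
    have h := (((hU x).mdifferentiableAt (by simp)).mdifferentiableWithinAt
      (s := univ)).differentiableWithinAt_mpullbackWithin_vectorField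
    have h3 : (φ.symm ⁻¹' univ ∩ range (𝓡 n) : Set (EuclideanSpace ℝ (Fin n))) = univ := by simp
    rw [← hφ, h3] at h
    exact differentiableWithinAt_univ.1 h
  have hV'd := hdiff V hV
  have hW'd := hdiff W hW
  have hbr : fderiv ℝ W' (φ x) (V' (φ x)) = fderiv ℝ V' (φ x) (W' (φ x)) := by
    rw [← mlieBracketWithin_univ, mlieBracketWithin_apply] at hVW
    obtain ⟨e, he⟩ := isInvertible_mfderiv_extChartAt (I := 𝓡 n) (x := x) hxφ
    rw [← he, ContinuousLinearMap.inverse_equiv] at hVW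
    have h2 : lieBracketWithin ℝ V' W' (φ.symm ⁻¹' univ ∩ range (𝓡 n)) (φ x) = 0 := by
      have := congrArg e hVW
      rw [map_zero] at this
      exact (e.apply_symm_apply _).symm.trans this
    have h3 : (φ.symm ⁻¹' univ ∩ range (𝓡 n) : Set (EuclideanSpace ℝ (Fin n))) = univ := by simp
    rw [h3, lieBracketWithin_univ, lieBracket_eq] at h2
    exact sub_eq_zero.1 h2
  set g := f ∘ φ.symm with hg
  have hOφ : IsOpen (φ.target ∩ φ.symm ⁻¹' O) :=
    (continuousOn_extChartAt_symm x).isOpen_inter_preimage (isOpen_extChartAt_target x) hO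
  have hmem : φ x ∈ φ.target ∩ φ.symm ⁻¹' O :=
    ⟨φ.map_source hxφ, by simpa [φ.left_inv hxφ] using hx⟩
  have hgs : ContDiffAt ℝ ∞ g (φ x) := by
    have h1 : ContMDiffOn 𝓘(ℝ, EuclideanSpace ℝ (Fin n)) 𝓘(ℝ, E') ∞ g
        (φ.target ∩ φ.symm ⁻¹' O) :=
      hf.comp ((contMDiffOn_extChartAt_symm x).mono inter_subset_left) fun z hz => hz.2
    exact (contMDiffAt_iff_contDiffAt.1 (h1.contMDiffAt (hOφ.mem_nhds hmem)))
  have hg' : DifferentiableAt ℝ (fderiv ℝ g) (φ x) :=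
    (hgs.fderiv_right (m := 1) (WithTop.coe_le_coe.2 le_top)).differentiableAt one_ne_zero
  have hsymm : IsSymmSndFDerivAt ℝ g (φ x) :=
    hgs.isSymmSndFDerivAt (by
    rw [minSmoothness_of_isRCLikeNormedField]
    exact WithTop.coe_le_coe.2 le_top)
  have key : ∀ U : (x : M) → TangentSpace (𝓡 n) x, ∀ hU : ContMDiff (𝓡 n) (𝓡 n).tangent ∞
      (fun x => (⟨x, U x⟩ : TangentBundle (𝓡 n) M)), ∀ v : TangentSpace (𝓡 n) x,
      mvfderiv (𝓡 n) (fun y => mvfderiv (𝓡 n) f y (U y)) x v =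
      fderiv ℝ (fun z => fderiv ℝ g z ((mpullbackWithin 𝓘(ℝ, EuclideanSpace ℝ (Fin n)) (𝓡 n)
        φ.symm U (range (𝓡 n)) : EuclideanSpace ℝ (Fin n) → EuclideanSpace ℝ (Fin n)) z)) (φ x)
        (mfderiv (𝓡 n) 𝓘(ℝ, EuclideanSpace ℝ (Fin n)) φ x v) := by
    intro U hU v
    have hs := contMDiffOn_mvfderiv_apply hO hf hU.contMDiffOn
    rw [mvfderiv_eq_fderiv_chart hxφ
      ((hs.contMDiffAt (hO.mem_nhds hx)).mdifferentiableAt (by simp)) v]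
    congr 1
    refine Filter.EventuallyEq.fderiv_eq ?_
    filter_upwards [hOφ.mem_nhds hmem] with z hz
    have hz1 : φ.symm z ∈ φ.source := φ.map_target hz.1
    have hz2 : φ (φ.symm z) = z := φ.right_inv hz.1
    have h1 := mpullbackWithin_chart_apply U hz1
    rw [Function.comp_apply, mvfderiv_eq_fderiv_chart hz1
      ((hf.contMDiffAt (hO.mem_nhds hz.2)).mdifferentiableAt (by simp))]
    rw [← hφ] at h1 ⊢
    rw [← h1, hz2]
  rw [key V hV, key W hW]
  have hfd : ∀ U' : EuclideanSpace ℝ (Fin n) → EuclideanSpace ℝ (Fin n),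
      DifferentiableAt ℝ U' (φ x) → ∀ v, fderiv ℝ (fun z => fderiv ℝ g z (U' z)) (φ x) v =
        fderiv ℝ (fderiv ℝ g) (φ x) v (U' (φ x)) + fderiv ℝ g (φ x) (fderiv ℝ U' (φ x) v) := by
    intro U' hU' v
    rw [(hg'.hasFDerivAt.clm_apply hU'.hasFDerivAt).fderiv]
    simp [add_comm]
  -- Both sides are `D²g(V', W')` plus a first order term. The second derivatives agree by symmetry,
  -- the first order terms by `hbr`.
  refine (hfd _ hW'd _).trans (Eq.trans ?_ (hfd _ hV'd _).symm)
  have h1 := mpullbackWithin_chart_apply V hxφ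
  have h2 := mpullbackWithin_chart_apply W hxφ
  rw [← hφ] at h1 h2
  rw [← h1, ← h2]
  have h3 := hsymm (V' (φ x)) (W' (φ x))
  exact congrArg₂ (· + ·) h3 (congrArg _ hbr)

/-- Inverse function theorem on a manifold. -/
lemma exists_openPartialHomeomorph_of_injective_mvfderiv [FiniteDimensional ℝ E']
    (hdim : Module.finrank ℝ E' = n) {f : M → E'} {O : Set M} (hO : IsOpen O)
    (hf : ContMDiffOn (𝓡 n) 𝓘(ℝ, E') ∞ f O) {x : M} (hx : x ∈ O)
    (hinj : ∀ v, mvfderiv (𝓡 n) f x v = 0 → v = 0) :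
    ∃ ψ : OpenPartialHomeomorph M E', x ∈ ψ.source ∧ ψ.source ⊆ O ∧ (∀ y ∈ ψ.source, ψ y = f y) ∧
      ContMDiffOn (𝓡 n) 𝓘(ℝ, E') ∞ ψ ψ.source ∧ ContMDiffOn 𝓘(ℝ, E') (𝓡 n) ∞ ψ.symm ψ.target := by
  have : IsManifold (𝓡 n) 1 M := IsManifold.of_le (n := ∞) (by simp)
  set e := chartAt (EuclideanSpace ℝ (Fin n)) x with he
  have heφ : ⇑(extChartAt (𝓡 n) x).symm = e.symm := by simp [he, mfld_simps]
  have heφ' : ⇑(extChartAt (𝓡 n) x) = e := by simp [he, mfld_simps]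
  have hxe : x ∈ e.source := mem_chart_source _ x
  set g : EuclideanSpace ℝ (Fin n) → E' := f ∘ e.symm with hg
  set O₁ := e.target ∩ e.symm ⁻¹' O with hO₁
  have hO₁o : IsOpen O₁ := e.continuousOn_symm.isOpen_inter_preimage e.open_target hO
  have hxO₁ : e x ∈ O₁ := ⟨e.map_source hxe, by simpa [e.left_inv hxe] using hx⟩
  have hes : ContMDiffOn 𝓘(ℝ, EuclideanSpace ℝ (Fin n)) (𝓡 n) ∞ e.symm e.target :=
    contMDiffOn_chart_symm
  have hec : ContMDiffOn (𝓡 n) 𝓘(ℝ, EuclideanSpace ℝ (Fin n)) ∞ e e.source := contMDiffOn_chart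
  have hgs : ContDiffOn ℝ ∞ g O₁ := contMDiffOn_iff_contDiffOn.1
    (hf.comp (hes.mono inter_subset_left) fun z hz => hz.2)
  have hga : ∀ z ∈ O₁, ContDiffAt ℝ ∞ g z := fun z hz => hgs.contDiffAt (hO₁o.mem_nhds hz)
  have hginj : Function.Injective (fderiv ℝ g (e x)) := by
    rw [injective_iff_map_eq_zero]
    intro w hw
    obtain ⟨E, hE⟩ := isInvertible_mfderiv_extChartAt (I := 𝓡 n) (x := x)
      (mem_extChartAt_source x)
    have h1 := mvfderiv_eq_fderiv_chart (mem_extChartAt_source x)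
      ((hf.contMDiffAt (hO.mem_nhds hx)).mdifferentiableAt (by simp)) (E.symm w)
    rw [← hE] at h1
    have h2 : mvfderiv (𝓡 n) f x (E.symm w) = 0 := by
      refine h1.trans ?_
      rw [heφ, heφ', ← hw]
      exact congrArg _ (E.apply_symm_apply w)
    have h3 := hinj _ h2
    have h4 : E.symm w = E.symm 0 := by rw [h3, map_zero]
    exact E.symm.injective h4
  have hfin : Module.finrank ℝ (EuclideanSpace ℝ (Fin n)) = Module.finrank ℝ E' := by
    rw [hdim, finrank_euclideanSpace_fin]
  set L : EuclideanSpace ℝ (Fin n) ≃L[ℝ] E' :=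
    (LinearEquiv.ofInjectiveOfFinrankEq (fderiv ℝ g (e x) : _ →ₗ[ℝ] E') hginj
      hfin).toContinuousLinearEquiv with hL
  have hLe : (L : EuclideanSpace ℝ (Fin n) →L[ℝ] E') = fderiv ℝ g (e x) := by
    ext v; rfl
  have hLd : HasFDerivAt g (L : EuclideanSpace ℝ (Fin n) →L[ℝ] E') (e x) := by
    rw [hLe]; exact ((hga _ hxO₁).differentiableAt (by simp)).hasFDerivAt
  set G := (hga _ hxO₁).toOpenPartialHomeomorph g hLd (by simp) with hG
  have hGc : ⇑G = g := rfl
  -- The restriction keeps the derivative invertible at every point, so that the inverse is smooth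
  -- on its whole domain and not only near the image of `x`.
  set O₂ := O₁ ∩ fderiv ℝ g ⁻¹' {A | A.IsInvertible} with hO₂
  have hO₂o : IsOpen O₂ := (hgs.continuousOn_fderiv_of_isOpen hO₁o (by simp)).isOpen_inter_preimage
    hO₁o isOpen_setOf_isInvertible
  have hGx : e x ∈ G.source := (hga _ hxO₁).mem_toOpenPartialHomeomorph_source hLd (by simp)
  set G' := G.restrOpen O₂ hO₂o with hG'
  have hG's : G'.source = G.source ∩ O₂ := rfl
  have hG'c : ⇑G' = g := rfl
  have hG't : ∀ z ∈ G'.target, G'.symm z ∈ G'.source := fun z hz => G'.map_target hz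
  have hG'i : ∀ z ∈ G'.target, ContDiffAt ℝ ∞ G'.symm z := by
    intro z hz
    have h1 := hG't z hz
    obtain ⟨K, hK⟩ := h1.2.2
    refine G'.contDiffAt_symm hz (f₀' := K) ?_ (hga _ h1.2.1)
    rw [hK]
    exact ((hga _ h1.2.1).differentiableAt (by simp)).hasFDerivAt
  have hsrc : ∀ y ∈ (e ≫ₕ G').source, y ∈ e.source ∧ e y ∈ G'.source := fun y hy => by
    rwa [OpenPartialHomeomorph.trans_source] at hy
  have hO' : (e ≫ₕ G').source ⊆ O := fun y hy => by
    have := (hsrc y hy).2.2.1.2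
    rwa [mem_preimage, e.left_inv (hsrc y hy).1] at this
  have heq : ∀ y ∈ (e ≫ₕ G').source, (e ≫ₕ G') y = f y := fun y hy => by
    show f (e.symm (e y)) = f y
    rw [e.left_inv (hsrc y hy).1]
  refine ⟨e ≫ₕ G', ?_, hO', heq, (hf.mono hO').congr heq, ?_⟩
  · rw [OpenPartialHomeomorph.trans_source]
    refine ⟨hxe, hGx, hxO₁, L, hLe⟩
  · rw [OpenPartialHomeomorph.trans_symm_eq_symm_trans_symm]
    refine hes.comp (t := e.target) (f := G'.symm) (fun z hz => ?_) fun z hz => ?_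
    · exact ((hG'i z hz.1).contMDiffAt).contMDiffWithinAt
    · exact (hG't z hz.1).2.1.1

end Derivatives

/-! ### Straightening a commuting frame together with its first integrals. -/

section Rectifying
open Filter Topology

variable {n : ℕ} {M : Type*} [TopologicalSpace M] [ChartedSpace (EuclideanSpace ℝ (Fin n)) M]

section LinearAlgebra
variable {T : Type*} [NormedAddCommGroup T] [NormedSpace ℝ T] [FiniteDimensional ℝ T] {q r : ℕ}

/-- A functional vanishing on the range of `(D₁, …, D_r)` would be a linear relation between the
`Dⱼ`, so this map is onto and its kernel has dimension `q`. The `q` independent vectors `zᵢ` lie in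
the kernel and hence span it. -/
lemma exists_eq_sum_smul_of_forall_eq_zero {z : Fin q → T} {D : Fin r → T →L[ℝ] ℝ}
    (hdim : q + r = Module.finrank ℝ T) (hz : LinearIndependent ℝ z) (hD : LinearIndependent ℝ D)
    (hDz : ∀ i j, D j (z i) = 0) {v : T} (hv : ∀ j, D j v = 0) :
    ∃ c : Fin q → ℝ, v = ∑ i, c i • z i := by
  let A : T →ₗ[ℝ] (Fin r → ℝ) := LinearMap.pi fun j => (D j : T →ₗ[ℝ] ℝ)
  have hA : LinearMap.range A = ⊤ := by
    by_contra hne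
    obtain ⟨f, hf0, hf⟩ := Submodule.exists_le_ker_of_lt_top _ (lt_top_iff_ne_top.2 hne)
    have h1 : ∑ j, f (Pi.single j 1) • D j = 0 := by
      ext w
      have h2 : f (A w) = 0 := hf ⟨w, rfl⟩
      rw [LinearMap.pi_apply_eq_sum_univ f] at h2
      rw [sum_apply]
      refine Eq.trans (Finset.sum_congr rfl fun j _ => ?_) h2
      rw [smul_apply, smul_eq_mul, smul_eq_mul, mul_comm]
      congr 2
      ext k
      simp [Pi.single_apply, eq_comm]
    have h3 := Fintype.linearIndependent_iff.1 hD _ h1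
    refine hf0 (LinearMap.pi_ext' fun j => LinearMap.ext_ring ?_)
    simpa using h3 j
  have hker : Module.finrank ℝ (LinearMap.ker A) = q := by
    have h1 := LinearMap.finrank_range_add_finrank_ker A
    rw [hA, finrank_top] at h1
    simp at h1
    omega
  have hspan : Submodule.span ℝ (range z) = LinearMap.ker A := by
    refine Submodule.eq_of_le_of_finrank_eq ?_ ?_
    · rw [Submodule.span_le]
      rintro _ ⟨i, rfl⟩
      exact funext fun j => hDz i j
    · rw [hker, finrank_span_eq_card hz, Fintype.card_fin]
  have hmem : v ∈ LinearMap.ker A := funext fun j => hv j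
  rw [← hspan, Submodule.mem_span_range_iff_exists_fun] at hmem
  obtain ⟨c, hc⟩ := hmem
  exact ⟨c, hc.symm⟩

lemma exists_dual_of_linearIndependent {z : Fin q → T} (hz : LinearIndependent ℝ z) :
    ∃ L : T →L[ℝ] (Fin q → ℝ), ∀ i, L (z i) = Pi.single i 1 := by
  obtain ⟨L, hL⟩ := (Fintype.linearCombination ℝ z).exists_leftInverse_of_injective
    (LinearMap.ker_eq_bot.2 hz.fintypeLinearCombination_injective)
  refine ⟨L.toContinuousLinearMap, fun i => ?_⟩
  have h1 := LinearMap.congr_fun hL (Pi.single i 1)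
  simpa [Fintype.linearCombination_apply_single] using h1

end LinearAlgebra

section Calculus
variable {E' F' : Type*} [NormedAddCommGroup E'] [NormedSpace ℝ E'] [NormedAddCommGroup F']
  [NormedSpace ℝ F']

lemma mvfderiv_prodMk {f : M → E'} {g : M → F'} {x : M}
    (hf : MDifferentiableAt (𝓡 n) 𝓘(ℝ, E') f x) (hg : MDifferentiableAt (𝓡 n) 𝓘(ℝ, F') g x)
    (v : TangentSpace (𝓡 n) x) :
    mvfderiv (𝓡 n) (fun y => (f y, g y)) x v = (mvfderiv (𝓡 n) f x v, mvfderiv (𝓡 n) g x v) := by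
  have h : HasMFDerivAt (𝓡 n) 𝓘(ℝ, E' × F') (fun y => (f y, g y)) x
      (ContinuousLinearMap.prod (mfderiv (𝓡 n) 𝓘(ℝ, E') f x : EuclideanSpace ℝ (Fin n) →L[ℝ] E')
        (mfderiv (𝓡 n) 𝓘(ℝ, F') g x : EuclideanSpace ℝ (Fin n) →L[ℝ] F')) :=
    ⟨ContinuousAt.prodMk hf.continuousAt hg.continuousAt,
      hf.hasMFDerivAt.2.prodMk hg.hasMFDerivAt.2⟩
  have h := h.mfderiv
  exact congrArg (fun L : EuclideanSpace ℝ (Fin n) →L[ℝ] E' × F' => L v) h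

lemma mvfderiv_comp_fderiv {f : M → E'} {g : E' → F'} {x : M}
    (hg : DifferentiableAt ℝ g (f x)) (hf : MDifferentiableAt (𝓡 n) 𝓘(ℝ, E') f x)
    (v : TangentSpace (𝓡 n) x) :
    mvfderiv (𝓡 n) (g ∘ f) x v = fderiv ℝ g (f x) (mvfderiv (𝓡 n) f x v) := by
  refine (mfderiv_comp_apply x hg.mdifferentiableAt hf v).trans ?_
  rw [mfderiv_eq_fderiv]
  rfl

lemma mvfderiv_clm_comp {f : M → E'} (L : E' →L[ℝ] F') {x : M}
    (hf : MDifferentiableAt (𝓡 n) 𝓘(ℝ, E') f x) (v : TangentSpace (𝓡 n) x) :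
    mvfderiv (𝓡 n) (fun y => L (f y)) x v = L (mvfderiv (𝓡 n) f x v) := by
  have := mvfderiv_comp_fderiv (g := L) L.differentiableAt hf v
  rwa [L.fderiv] at this

end Calculus

/-- The map `(F₁, …, F_r) : M → ℝ^r`, with values in Euclidean space. -/
def jointMap {r : ℕ} (F : Fin r → M → ℝ) (x : M) : EuclideanSpace ℝ (Fin r) :=
  WithLp.toLp 2 fun j => F j x

/-- The product `ℝ^q × ℝ^r`, the model of a manifold fibred by `q`-dimensional leaves. -/
abbrev FlatModel (q r : ℕ) : Type := (Fin q → ℝ) × EuclideanSpace ℝ (Fin r)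

variable {q r : ℕ} {Z : Fin q → (x : M) → TangentSpace (𝓡 n) x} {F : Fin r → M → ℝ}

lemma contMDiff_jointMap (hF : ∀ j, ContMDiff (𝓡 n) 𝓘(ℝ, ℝ) ∞ (F j)) :
    ContMDiff (𝓡 n) 𝓘(ℝ, EuclideanSpace ℝ (Fin r)) ∞ (jointMap F) := by
  have h1 : ContMDiff (𝓡 n) 𝓘(ℝ, Fin r → ℝ) ∞ fun x j => F j x := contMDiff_pi_space.2 hF
  exact (EuclideanSpace.equiv (Fin r) ℝ).symm.contDiff.contMDiff.comp h1

lemma mvfderiv_jointMap_apply (hF : ∀ j, ContMDiff (𝓡 n) 𝓘(ℝ, ℝ) ∞ (F j)) (x : M)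
    (v : TangentSpace (𝓡 n) x) (j : Fin r) :
    mvfderiv (𝓡 n) (jointMap F) x v j = mvfderiv (𝓡 n) (F j) x v :=
  (mvfderiv_clm_comp (EuclideanSpace.proj j : EuclideanSpace ℝ (Fin r) →L[ℝ] ℝ)
    ((contMDiff_jointMap hF x).mdifferentiableAt (by simp)) v).symm

/-- The common kernel of the `dFⱼ` is spanned by the `Zᵢ`. -/
lemma exists_eq_sum_smul_of_mvfderiv_eq_zero (hdim : q + r = n) {x : M}
    (hind : IndependentAt Z F x) (hZF : ∀ i j, lieDeriv (Z i) (F j) x = 0)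
    {v : TangentSpace (𝓡 n) x} (hv : ∀ j, mvfderiv (𝓡 n) (F j) x v = 0) :
    ∃ c : Fin q → ℝ, v = ∑ i, c i • Z i x :=
  exists_eq_sum_smul_of_forall_eq_zero (T := EuclideanSpace ℝ (Fin n)) (z := fun i => Z i x)
    (D := fun j => mvfderiv (𝓡 n) (F j) x) (by simp [hdim]) hind.1 hind.2 hZF hv

variable [IsManifold (𝓡 n) ∞ M]

/-- Coordinates in which the functions `Fⱼ` are the last `r` coordinates and the fields `Zᵢ` are
the first `q` coordinate fields. -/
structure IsRectifying (Z : Fin q → (x : M) → TangentSpace (𝓡 n) x) (F : Fin r → M → ℝ)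
    (ψ : OpenPartialHomeomorph M (FlatModel q r)) : Prop where
  smooth : ContMDiffOn (𝓡 n) 𝓘(ℝ, FlatModel q r) ∞ ψ ψ.source
  smooth_symm : ContMDiffOn 𝓘(ℝ, FlatModel q r) (𝓡 n) ∞ ψ.symm ψ.target
  snd_eq : ∀ x ∈ ψ.source, (ψ x).2 = jointMap F x
  mvfderiv_field : ∀ x ∈ ψ.source, ∀ i, mvfderiv (𝓡 n) ψ x (Z i x) = (Pi.single i 1, 0)

/-- A vector killed by all `dFⱼ` is a combination of the `Zᵢ`, and `dh` reads off its coefficients.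
-/
lemma injective_mvfderiv_prod_jointMap (hsys : IsIntegrableSystem Z F) {x : M}
    (hind : IndependentAt Z F x) {h : M → Fin q → ℝ}
    (hh : MDifferentiableAt (𝓡 n) 𝓘(ℝ, Fin q → ℝ) h x)
    (hZ : ∀ i, mvfderiv (𝓡 n) h x (Z i x) = Pi.single i 1) (v : TangentSpace (𝓡 n) x)
    (hv : mvfderiv (𝓡 n) (fun y => (h y, jointMap F y)) x v = 0) : v = 0 := by
  rw [mvfderiv_prodMk hh ((contMDiff_jointMap hsys.smooth_fun x).mdifferentiableAt (by simp)),
    Prod.mk_eq_zero] at hv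
  obtain ⟨c, hc⟩ := exists_eq_sum_smul_of_mvfderiv_eq_zero hsys.dim_eq hind
    (fun i j => hsys.first_integral i j x) (v := v) (fun j => by
      rw [← mvfderiv_jointMap_apply hsys.smooth_fun, hv.2]; rfl)
  have h1 := hv.1
  rw [hc, map_sum] at h1
  simp only [map_smul, hZ] at h1
  have h2 : c = 0 := by
    rw [← h1]
    ext k
    simp [Finset.sum_apply, Pi.single_apply]
  rw [hc, h2]
  simp

/-- A frame of commuting fields can be straightened near a regular point. -/
theorem exists_isRectifying (hsys : IsIntegrableSystem Z F) {x : M}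
    (hind : IndependentAt Z F x) :
    ∃ ψ : OpenPartialHomeomorph M (FlatModel q r), x ∈ ψ.source ∧ IsRectifying Z F ψ := by
  have : IsManifold (𝓡 n) 1 M := IsManifold.of_le (n := ∞) (by simp)
  have hdim : Module.finrank ℝ (FlatModel q r) = n := by
    simp [FlatModel, hsys.dim_eq]
  have hF := contMDiff_jointMap hsys.smooth_fun
  have hFd : ∀ y, MDifferentiableAt (𝓡 n) 𝓘(ℝ, EuclideanSpace ℝ (Fin r)) (jointMap F) y :=
    fun y => (hF y).mdifferentiableAt (by simp)
  have hZF : ∀ y i, mvfderiv (𝓡 n) (jointMap F) y (Z i y) = 0 := fun y i => by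
    ext j
    rw [mvfderiv_jointMap_apply hsys.smooth_fun]
    exact hsys.first_integral i j y
  -- functions dual to the frame at the given point
  obtain ⟨l, O, hO, hxO, hl, hlZ⟩ : ∃ (l : M → Fin q → ℝ) (O : Set M), IsOpen O ∧ x ∈ O ∧
      ContMDiffOn (𝓡 n) 𝓘(ℝ, Fin q → ℝ) ∞ l O ∧
      ∀ i, mvfderiv (𝓡 n) l x (Z i x) = Pi.single i 1 := by
    let φ := extChartAt (𝓡 n) x
    obtain ⟨E, hE⟩ := isInvertible_mfderiv_extChartAt (I := 𝓡 n) (x := x)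
      (mem_extChartAt_source x)
    obtain ⟨L, hL⟩ := exists_dual_of_linearIndependent (T := EuclideanSpace ℝ (Fin n))
      (z := fun i => E (Z i x)) (hind.1.map' E.toLinearEquiv.toLinearMap E.toLinearEquiv.ker)
    refine ⟨fun y => L (φ y), (chartAt (EuclideanSpace ℝ (Fin n)) x).source,
      (chartAt _ x).open_source, mem_chart_source _ x, ?_, fun i => ?_⟩
    · exact L.contDiff.contMDiff.comp_contMDiffOn contMDiffOn_extChartAt
    · rw [mvfderiv_clm_comp (f := φ) _ (mdifferentiableAt_extChartAt (mem_chart_source _ x))]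
      refine Eq.trans ?_ (hL i)
      refine congrArg L ?_
      exact (congrArg (fun A : EuclideanSpace ℝ (Fin n) →L[ℝ] EuclideanSpace ℝ (Fin n) =>
        A (Z i x)) hE).symm
  have hld : ∀ y ∈ O, MDifferentiableAt (𝓡 n) 𝓘(ℝ, Fin q → ℝ) l y := fun y hy =>
    (hl.contMDiffAt (hO.mem_nhds hy)).mdifferentiableAt (by simp)
  obtain ⟨g, hxg, hgO, hgf, hgs, hgi⟩ := exists_openPartialHomeomorph_of_injective_mvfderiv hdim hO
    (f := fun y => (l y, jointMap F y)) (hl.prodMk_space hF.contMDiffOn) hxO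
    (injective_mvfderiv_prod_jointMap hsys hind (hld x hxO) hlZ)
  have hgd : ∀ y ∈ g.source, MDifferentiableAt (𝓡 n) 𝓘(ℝ, FlatModel q r) g y := fun y hy =>
    (hgs.contMDiffAt (g.open_source.mem_nhds hy)).mdifferentiableAt (by simp)
  -- In the coordinates `g = (l, F)` the field `Zᵢ` is `(aᵢ, 0)`. Only the first block has to be
  -- straightened, with the values of `F` as parameters.
  set a : Fin q → M → Fin q → ℝ := fun i y => mvfderiv (𝓡 n) l y (Z i y) with ha
  have has : ∀ i, ContMDiffOn (𝓡 n) 𝓘(ℝ, Fin q → ℝ) ∞ (a i) O := fun i =>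
    contMDiffOn_mvfderiv_apply hO hl (hsys.smooth_field i).contMDiffOn
  have hgZ : ∀ y ∈ g.source, ∀ i, mvfderiv (𝓡 n) g y (Z i y) = (a i y, 0) := by
    intro y hy i
    rw [mvfderiv_congr_of_eventuallyEq (g := fun y => (l y, jointMap F y))
      (by filter_upwards [g.open_source.mem_nhds hy] with z hz using hgf z hz),
      mvfderiv_prodMk (hld y (hgO hy)) (hFd y), hZF]
  set A : FlatModel q r → (Fin q → ℝ) →L[ℝ] (Fin q → ℝ) := fun z =>
    ∑ i, (ContinuousLinearMap.proj i : (Fin q → ℝ) →L[ℝ] ℝ).smulRight (a i (g.symm z)) with hA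
  have hAu : ∀ z u, A z u = ∑ i, u i • a i (g.symm z) := fun z u => by simp [hA]
  have hag : ∀ i, ContDiffOn ℝ ∞ (fun z => a i (g.symm z)) g.target := fun i =>
    contMDiffOn_iff_contDiffOn.1 ((has i).comp hgi fun z hz => hgO (g.map_target hz))
  have hAs : ContDiffOn ℝ ∞ A g.target := by
    refine ContDiffOn.sum fun i _ => ?_
    exact contDiffOn_const.smulRight (hag i)
  have hagd : ∀ i, ∀ z ∈ g.target, DifferentiableAt ℝ (fun z => a i (g.symm z)) z := fun i z hz =>
    ((hag i).contDiffAt (g.open_target.mem_nhds hz)).differentiableAt (by simp)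
  have hDa : ∀ y ∈ g.source, ∀ i v, fderiv ℝ (fun z => a i (g.symm z)) (g y)
      (mvfderiv (𝓡 n) g y v) = mvfderiv (𝓡 n) (a i) y v := by
    intro y hy i v
    rw [← mvfderiv_comp_fderiv (hagd i _ (g.map_source hy)) (hgd y hy)]
    refine congrArg (fun L : TangentSpace (𝓡 n) y →L[ℝ] (Fin q → ℝ) => L v)
      (mvfderiv_congr_of_eventuallyEq ?_)
    filter_upwards [g.open_source.mem_nhds hy] with z hz
    simp [g.left_inv hz]
  have hAA : ∀ y ∈ g.source, ∀ w, ((A (g y) w, 0) : FlatModel q r) =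
      mvfderiv (𝓡 n) g y (∑ i, w i • Z i y) := by
    intro y hy w
    rw [map_sum]
    simp only [map_smul, hgZ y hy, hAu, g.left_inv hy]
    ext : 1
    · simp [Prod.fst_sum]
    · simp [Prod.snd_sum]
  have hfA : ∀ z ∈ g.target, ∀ h u, fderiv ℝ A z h u =
      ∑ i, u i • fderiv ℝ (fun z => a i (g.symm z)) z h := by
    intro z hz h u
    have h1 : HasFDerivAt (fun z => A z u)
        (∑ i, u i • fderiv ℝ (fun z => a i (g.symm z)) z) z := by
      simp only [hAu]
      exact HasFDerivAt.fun_sum fun i _ => (hagd i z hz).hasFDerivAt.const_smul (u i)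
    have h2 : HasFDerivAt (fun z => A z u) _ z :=
      (((hAs.contDiffAt (g.open_target.mem_nhds hz)).differentiableAt
        (by simp)).hasFDerivAt.clm_apply (hasFDerivAt_const u z))
    have h3 := congrArg (fun L => L h) (h2.unique h1)
    simpa using h3
  -- Read on the manifold, both sides are double sums of `Zⱼ (Zᵢ l)`, so the claim is that `Zᵢ` and
  -- `Zⱼ` commute on `l`.
  have hcomm : ∀ z ∈ g.target, ∀ u w,
      fderiv ℝ A z (A z u, 0) w = fderiv ℝ A z (A z w, 0) u := by
    intro z hz u w
    obtain ⟨y, hy, rfl⟩ : ∃ y ∈ g.source, g y = z :=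
      ⟨g.symm z, g.map_target hz, g.right_inv hz⟩
    have h1 : ∀ u w, fderiv ℝ A (g y) (A (g y) u, 0) w =
        ∑ i, ∑ j, (w i * u j) • mvfderiv (𝓡 n) (a i) y (Z j y) := by
      intro u w
      rw [hfA _ hz, hAA y hy]
      refine Finset.sum_congr rfl fun i _ => ?_
      rw [hDa y hy, map_sum, Finset.smul_sum]
      refine Finset.sum_congr rfl fun j _ => ?_
      rw [map_smul, smul_smul]
    rw [h1, h1, Finset.sum_comm]
    refine Finset.sum_congr rfl fun i _ => Finset.sum_congr rfl fun j _ => ?_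
    rw [mul_comm, mvfderiv_mvfderiv_comm hO hl (hsys.smooth_field i) (hsys.smooth_field j) (hgO hy)
      (hsys.commute i j y)]
  have hA0 : (A (g x)).IsInvertible := by
    have : A (g x) = ContinuousLinearMap.id ℝ _ := by
      ext u k
      simp [hAu, g.left_inv hxg, ha, hlZ, Finset.sum_apply, Pi.single_apply]
    exact ⟨ContinuousLinearEquiv.refl ℝ _, this.symm⟩
  obtain ⟨T, hTs, hT⟩ := exists_primitive_of_commuting g.open_target (g.map_source hxg) hAs hA0
    hcomm
  obtain ⟨N, hN, hNo, hxN⟩ := eventually_nhds_iff.1 hT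
  set O' := g.source ∩ g ⁻¹' N with hO'
  have hO'o : IsOpen O' := g.isOpen_inter_preimage hNo
  have hTg : ContMDiffOn (𝓡 n) 𝓘(ℝ, Fin q → ℝ) ∞ (T ∘ g) O' :=
    hTs.contMDiff.comp_contMDiffOn (hgs.mono inter_subset_left)
  have hTgZ : ∀ y ∈ O', ∀ i, mvfderiv (𝓡 n) (T ∘ g) y (Z i y) = Pi.single i 1 := by
    intro y hy i
    rw [mvfderiv_comp_fderiv (hTs.differentiable (by simp) _) (hgd y hy.1)]
    have h1 := hN (g y) hy.2 (Pi.single i 1)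
    rw [hAA y hy.1] at h1
    simpa [Pi.single_apply] using h1
  have hTgd : ∀ y ∈ O', MDifferentiableAt (𝓡 n) 𝓘(ℝ, Fin q → ℝ) (T ∘ g) y := fun y hy =>
    (hTg.contMDiffAt (hO'o.mem_nhds hy)).mdifferentiableAt (by simp)
  have hxO' : x ∈ O' := ⟨hxg, hxN⟩
  obtain ⟨ψ, hxψ, hψO, hψf, hψs, hψi⟩ := exists_openPartialHomeomorph_of_injective_mvfderiv hdim
    hO'o (f := fun y => ((T ∘ g) y, jointMap F y)) (hTg.prodMk_space hF.contMDiffOn) hxO'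
    (injective_mvfderiv_prod_jointMap hsys hind (hTgd x hxO') (hTgZ x hxO'))
  refine ⟨ψ, hxψ, hψs, hψi, fun y hy => by rw [hψf y hy], fun y hy i => ?_⟩
  rw [mvfderiv_congr_of_eventuallyEq (g := fun y => ((T ∘ g) y, jointMap F y))
    (by filter_upwards [ψ.open_source.mem_nhds hy] with z hz using hψf z hz),
    mvfderiv_prodMk (hTgd y (hψO hy)) (hFd y), hZF, hTgZ y (hψO hy)]

end Rectifying

/-! ### The action of `ℝ^q` generated by the frame. -/

section LeafFlow
open Filter Topology

variable {n : ℕ} {M : Type*} [TopologicalSpace M] [ChartedSpace (EuclideanSpace ℝ (Fin n)) M]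
  {q r : ℕ} {Z : Fin q → (x : M) → TangentSpace (𝓡 n) x} {F : Fin r → M → ℝ}

/-- The linear combination `∑ tᵢ Zᵢ` with constant coefficients. -/
def fieldComb (Z : Fin q → (x : M) → TangentSpace (𝓡 n) x) (t : Fin q → ℝ) (x : M) :
    TangentSpace (𝓡 n) x := ∑ i, t i • Z i x

/-- `y` is reached from `x` at time one along the field `∑ tᵢ Zᵢ`. -/
def FlowsTo (Z : Fin q → (x : M) → TangentSpace (𝓡 n) x) (t : Fin q → ℝ) (x y : M) : Prop :=
  ∃ (γ : ℝ → M) (a b : ℝ), a < 0 ∧ 1 < b ∧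
    IsMIntegralCurveOn (I := 𝓡 n) γ (fieldComb Z t) (Ioo a b) ∧ γ 0 = x ∧ γ 1 = y

variable [IsManifold (𝓡 n) ∞ M]

lemma contMDiff_fieldComb
    (hZ : ∀ i, ContMDiff (𝓡 n) (𝓡 n).tangent ∞ (fun x => (⟨x, Z i x⟩ : TangentBundle (𝓡 n) M)))
    (t : Fin q → ℝ) :
    ContMDiff (𝓡 n) (𝓡 n).tangent ∞ (fun x => (⟨x, fieldComb Z t x⟩ : TangentBundle (𝓡 n) M)) := by
  have : IsManifold (𝓡 n) 1 M := IsManifold.of_le (n := ∞) (by simp)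
  exact ContMDiff.sum_section fun i _ => (hZ i).const_smul_section

lemma FlowsTo.unique [T2Space M]
    (hZ : ∀ i, ContMDiff (𝓡 n) (𝓡 n).tangent ∞ (fun x => (⟨x, Z i x⟩ : TangentBundle (𝓡 n) M)))
    {t : Fin q → ℝ} {x y y' : M} (h : FlowsTo Z t x y) (h' : FlowsTo Z t x y') : y = y' := by
  have : IsManifold (𝓡 n) 1 M := IsManifold.of_le (n := ∞) (by simp)
  obtain ⟨γ, a, b, ha, hb, hγ, rfl, rfl⟩ := h
  obtain ⟨γ', a', b', ha', hb', hγ', h0, rfl⟩ := h'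
  refine isMIntegralCurveOn_Ioo_eqOn_of_contMDiff_boundaryless (I := 𝓡 n) (t₀ := 0)
    (a := max a a') (b := min b b') ⟨max_lt ha ha', ?_⟩ ((contMDiff_fieldComb hZ t).of_le (by simp))
    (hγ.mono (Ioo_subset_Ioo (le_max_left _ _) (min_le_left _ _)))
    (hγ'.mono (Ioo_subset_Ioo (le_max_right _ _) (min_le_right _ _))) h0.symm ⟨?_, ?_⟩
  · exact lt_min (by linarith) (by linarith)
  · exact max_lt (by linarith) (by linarith)
  · exact lt_min hb hb'

namespace IsRectifying

variable {ψ : OpenPartialHomeomorph M (FlatModel q r)}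

omit [IsManifold (𝓡 n) ∞ M] in
lemma mdifferentiableAt (hψ : IsRectifying Z F ψ) {x : M} (hx : x ∈ ψ.source) :
    MDifferentiableAt (𝓡 n) 𝓘(ℝ, FlatModel q r) ψ x :=
  (hψ.smooth.contMDiffAt (ψ.open_source.mem_nhds hx)).mdifferentiableAt (by simp)

omit [IsManifold (𝓡 n) ∞ M] in
lemma mdifferentiableAt_symm (hψ : IsRectifying Z F ψ) {z : FlatModel q r} (hz : z ∈ ψ.target) :
    MDifferentiableAt 𝓘(ℝ, FlatModel q r) (𝓡 n) ψ.symm z :=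
  (hψ.smooth_symm.contMDiffAt (ψ.open_target.mem_nhds hz)).mdifferentiableAt (by simp)

omit [IsManifold (𝓡 n) ∞ M] in
lemma mfderiv_symm_mvfderiv (hψ : IsRectifying Z F ψ) {x : M} (hx : x ∈ ψ.source)
    (v : TangentSpace (𝓡 n) x) :
    (mfderiv 𝓘(ℝ, FlatModel q r) (𝓡 n) ψ.symm (ψ x) :
      FlatModel q r →L[ℝ] EuclideanSpace ℝ (Fin n)) (mvfderiv (𝓡 n) ψ x v) = v := by
  have h1 := mfderiv_comp_apply x (hψ.mdifferentiableAt_symm (ψ.map_source hx))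
    (hψ.mdifferentiableAt hx) v
  have h2 : ψ.symm ∘ ψ =ᶠ[𝓝 x] id := by
    filter_upwards [ψ.open_source.mem_nhds hx] with y hy using ψ.left_inv hy
  have h3 := h2.mfderiv_eq (I := 𝓡 n) (I' := 𝓡 n)
  rw [mfderiv_id] at h3
  have h4 := congrArg (fun L : EuclideanSpace ℝ (Fin n) →L[ℝ] EuclideanSpace ℝ (Fin n) => L v) h3
  exact h1.symm.trans h4

omit [IsManifold (𝓡 n) ∞ M] in
lemma mvfderiv_fieldComb (hψ : IsRectifying Z F ψ) {x : M} (hx : x ∈ ψ.source) (t : Fin q → ℝ) :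
    mvfderiv (𝓡 n) ψ x (fieldComb Z t x) = (t, 0) := by
  rw [fieldComb, map_sum]
  simp only [map_smul, hψ.mvfderiv_field x hx]
  ext : 1
  · ext k; simp [Prod.fst_sum, Finset.sum_apply, Pi.single_apply]
  · simp [Prod.snd_sum]

omit [IsManifold (𝓡 n) ∞ M] in
lemma hasMFDerivAt_symm_line (hψ : IsRectifying Z F ψ) (p : FlatModel q r) (t : Fin q → ℝ) {u : ℝ}
    (hu : p + (u • t, 0) ∈ ψ.target) :
    HasMFDerivAt 𝓘(ℝ, ℝ) (𝓡 n) (fun u : ℝ => ψ.symm (p + (u • t, 0))) u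
      ((1 : ℝ →L[ℝ] ℝ).smulRight (fieldComb Z t (ψ.symm (p + (u • t, 0))))) := by
  set x := ψ.symm (p + (u • t, 0)) with hx
  have hxs : x ∈ ψ.source := ψ.map_target hu
  have hψx : ψ x = p + (u • t, 0) := ψ.right_inv hu
  have h1 : HasFDerivAt (fun u : ℝ => p + ((u • t, 0) : FlatModel q r))
      ((1 : ℝ →L[ℝ] ℝ).smulRight ((t, 0) : FlatModel q r)) u := by
    have : HasDerivAt (fun u : ℝ => p + ((u • t, 0) : FlatModel q r)) (t, 0) u := by
      have h := ((hasDerivAt_id u).smul_const t).prodMk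
        (hasDerivAt_const u (0 : EuclideanSpace ℝ (Fin r)))
      simpa using h.const_add p
    exact this.hasFDerivAt
  have h2 := (hψ.mdifferentiableAt_symm hu).hasMFDerivAt.comp u h1.hasMFDerivAt
  refine h2.congr_mfderiv ?_
  have h3 := hψ.mfderiv_symm_mvfderiv hxs (fieldComb Z t x)
  rw [hψ.mvfderiv_fieldComb hxs, hψx] at h3
  refine ContinuousLinearMap.ext fun c : ℝ => ?_
  exact ((mfderiv 𝓘(ℝ, FlatModel q r) (𝓡 n) ψ.symm (p + (u • t, 0)) :
    FlatModel q r →L[ℝ] EuclideanSpace ℝ (Fin n)).map_smul c (t, 0)).trans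
      (congrArg (fun v : EuclideanSpace ℝ (Fin n) => c • v) h3)

omit [IsManifold (𝓡 n) ∞ M] in
lemma flowsTo (hψ : IsRectifying Z F ψ) {x : M} (hx : x ∈ ψ.source) {ε : ℝ}
    (hε : Metric.ball (ψ x) ε ⊆ ψ.target) {t : Fin q → ℝ} (ht : ‖t‖ < ε) :
    FlowsTo Z t x (ψ.symm (ψ x + (t, 0))) := by
  -- Room for running the curve slightly beyond time one, as `FlowsTo` asks for an open interval
  -- containing `[0, 1]`.
  obtain ⟨δ, hδ, hδε⟩ : ∃ δ : ℝ, 0 < δ ∧ (1 + δ) * ‖t‖ < ε := by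
    have h1 : 0 < ε - ‖t‖ := by linarith
    refine ⟨(ε - ‖t‖) / (‖t‖ + 1), by positivity, ?_⟩
    have h2 : (ε - ‖t‖) / (‖t‖ + 1) * ‖t‖ < ε - ‖t‖ := by
      rw [div_mul_eq_mul_div, div_lt_iff₀ (by positivity)]
      nlinarith [norm_nonneg t]
    linarith
  refine ⟨fun u => ψ.symm (ψ x + (u • t, 0)), -δ, 1 + δ, by linarith, by linarith, ?_, ?_, ?_⟩
  · intro u hu
    refine (hψ.hasMFDerivAt_symm_line _ t (hε ?_)).hasMFDerivWithinAt
    rw [mem_ball_iff_norm, add_sub_cancel_left, Prod.norm_def]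
    simp only [norm_zero, norm_smul, Real.norm_eq_abs]
    refine max_lt ?_ ((norm_nonneg t).trans_lt ht)
    refine lt_of_le_of_lt ?_ hδε
    gcongr
    exact abs_le.2 ⟨by linarith [hu.1], hu.2.le⟩
  · simp [ψ.left_inv hx, ← Prod.zero_eq_mk]
  · simp

end IsRectifying

/-- An action of `ℝ^q` whose orbits are the leaves of the fibration by the `Fⱼ` over an open set
and which is generated there by the fields `Zᵢ`. -/
structure IsLeafFlow (Z : Fin q → (x : M) → TangentSpace (𝓡 n) x) (F : Fin r → M → ℝ)
    (U : Set M) (Ψ : (Fin q → ℝ) → M → M) : Prop where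
  zero_apply : ∀ x, Ψ 0 x = x
  add_apply : ∀ s t x, Ψ (s + t) x = Ψ s (Ψ t x)
  jointMap_apply : ∀ t x, jointMap F (Ψ t x) = jointMap F x
  mem : ∀ t, ∀ x ∈ U, Ψ t x ∈ U
  smooth : ∀ t, ContMDiffOn (𝓡 n) (𝓡 n) ∞ (Ψ t) U
  eventually_translation : ∀ x ∈ U, ∀ ψ : OpenPartialHomeomorph M (FlatModel q r),
    IsRectifying Z F ψ → x ∈ ψ.source → ∀ᶠ p : (Fin q → ℝ) × M in 𝓝 (0, x),
      p.2 ∈ ψ.source ∧ Ψ p.1 p.2 ∈ ψ.source ∧ ψ (Ψ p.1 p.2) = ψ p.2 + (p.1, 0)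

lemma exists_isLeafFlow [T2Space M] (hsys : IsIntegrableSystem Z F)
    {B : Set (EuclideanSpace ℝ (Fin r))} (hB : IsOpen B) {ε : ℝ} (hε : 0 < ε)
    (hcharts : ∀ x, jointMap F x ∈ B → ∃ ψ : OpenPartialHomeomorph M (FlatModel q r),
      IsRectifying Z F ψ ∧ x ∈ ψ.source ∧ Metric.ball (ψ x) ε ⊆ ψ.target) :
    ∃ Ψ, IsLeafFlow Z F (jointMap F ⁻¹' B) Ψ := by
  classical
  have hFc : Continuous (jointMap F) := (contMDiff_jointMap hsys.smooth_fun).continuous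
  have hU : IsOpen (jointMap F ⁻¹' B) := hB.preimage hFc
  -- The values lie in the monoid `Function.End M`, so that the extension of local homomorphisms
  -- applies. Off the preimage of `B`, or where no flow line reaches time one, the default is the
  -- identity.
  let f : (Fin q → ℝ) → Function.End M := fun t x =>
    if h : jointMap F x ∈ B ∧ ∃ y, FlowsTo Z t x y then h.2.choose else x
  have hf_out : ∀ t x, jointMap F x ∉ B → f t x = x := fun t x hx => dif_neg fun h => hx h.1
  -- By uniqueness of integral curves the chosen endpoint can be computed in any rectifying chart
  -- that is large enough.
  have hf : ∀ t x (ψ : OpenPartialHomeomorph M (FlatModel q r)), jointMap F x ∈ B →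
      IsRectifying Z F ψ → x ∈ ψ.source → ∀ δ, Metric.ball (ψ x) δ ⊆ ψ.target → ‖t‖ < δ →
      f t x = ψ.symm (ψ x + (t, 0)) := by
    intro t x ψ hx hψ hxψ δ hδ ht
    have h1 := hψ.flowsTo hxψ hδ ht
    have h2 : jointMap F x ∈ B ∧ ∃ y, FlowsTo Z t x y := ⟨hx, _, h1⟩
    have h3 : f t x = h2.2.choose := dif_pos h2
    rw [h3]
    exact h2.2.choose_spec.unique hsys.smooth_field h1
  have htr : ∀ (p : FlatModel q r) (t : Fin q → ℝ) (δ : ℝ), ‖t‖ < δ → p + (t, 0) ∈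
      Metric.ball p δ := by
    intro p t δ ht
    rw [mem_ball_iff_norm, add_sub_cancel_left, Prod.norm_def, norm_zero]
    exact max_lt ht ((norm_nonneg t).trans_lt ht)
  have hfF : ∀ t, ‖t‖ < ε → ∀ x, jointMap F (f t x) = jointMap F x := by
    intro t ht x
    by_cases hx : jointMap F x ∈ B
    · obtain ⟨ψ, hψ, hxψ, hb⟩ := hcharts x hx
      rw [hf t x ψ hx hψ hxψ ε hb ht, ← hψ.snd_eq x hxψ,
        ← hψ.snd_eq _ (ψ.map_target (hb (htr _ _ _ ht))), ψ.right_inv (hb (htr _ _ _ ht))]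
      simp
    · rw [hf_out t x hx]
  have hf0 : f 0 = 1 := by
    funext x
    by_cases hx : jointMap F x ∈ B
    · obtain ⟨ψ, hψ, hxψ, hb⟩ := hcharts x hx
      rw [hf 0 x ψ hx hψ hxψ ε hb (by simpa using hε)]
      simp only [← Prod.zero_eq_mk, add_zero, ψ.left_inv hxψ]
      rfl
    · exact hf_out 0 x hx
  -- With `ε / 2` in place of `ε`, the chart around `x` still contains a ball of the required size
  -- around the point reached after `t`.
  have hfadd : ∀ s t, ‖s‖ < ε / 2 → ‖t‖ < ε / 2 → ‖s + t‖ < ε / 2 → f (s + t) = f s * f t := by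
    intro s t hs ht hst
    funext x
    show f (s + t) x = f s (f t x)
    by_cases hx : jointMap F x ∈ B
    · obtain ⟨ψ, hψ, hxψ, hb⟩ := hcharts x hx
      have hb' := htr (ψ x) t (ε / 2) ht
      have hm : ψ x + (t, 0) ∈ ψ.target := hb (Metric.ball_subset_ball (by linarith) hb')
      have h1 := hf t x ψ hx hψ hxψ ε hb (by linarith)
      have h2 : ψ (f t x) = ψ x + (t, 0) := by rw [h1, ψ.right_inv hm]
      rw [hf s (f t x) ψ (by rwa [hfF t (by linarith)]) hψ (by rw [h1]; exact ψ.map_target hm)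
        (ε / 2) ?_ hs, h2, hf (s + t) x ψ hx hψ hxψ ε hb (by linarith), add_assoc,
        Prod.mk_add_mk t, add_zero, add_comm t s]
      refine Subset.trans (fun z hz => ?_) hb
      rw [h2] at hz
      rw [Metric.mem_ball] at hz hb' ⊢
      linarith [dist_triangle z (ψ x + (t, 0)) (ψ x)]
    · rw [hf_out _ x hx, hf_out t x hx, hf_out s x hx]
  have hfs : ∀ t, ‖t‖ < ε / 2 → ContMDiffOn (𝓡 n) (𝓡 n) ∞ (f t) (jointMap F ⁻¹' B) := by
    intro t ht x hx
    obtain ⟨ψ, hψ, hxψ, hb⟩ := hcharts x hx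
    have hm : ψ x + (t, 0) ∈ ψ.target := hb (htr _ _ _ (by linarith))
    have h1 : ContMDiffAt (𝓡 n) (𝓡 n) ∞ (fun y => ψ.symm (ψ y + (t, 0))) x := by
      refine ContMDiffAt.comp x (g := ψ.symm) (f := fun y => ψ y + (t, 0))
        (hψ.smooth_symm.contMDiffAt (ψ.open_target.mem_nhds hm)) ?_
      exact (hψ.smooth.contMDiffAt (ψ.open_source.mem_nhds hxψ)).add contMDiffAt_const
    refine (h1.congr_of_eventuallyEq ?_).contMDiffWithinAt
    have hc := (ψ.continuousAt hxψ).eventually (Metric.ball_mem_nhds (ψ x) (half_pos hε))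
    filter_upwards [hc, ψ.open_source.mem_nhds hxψ, hU.mem_nhds hx] with y hy hyψ hyU
    refine hf t y ψ hyU hψ hyψ (ε / 2) (Subset.trans (fun z hz => ?_) hb) ht
    rw [Metric.mem_ball] at hz ⊢
    linarith [dist_triangle z (ψ y) (ψ x)]
  obtain ⟨g, hgadd, hgf, hgk⟩ := exists_global_extension_of_local_add (half_pos hε) hf0 hfadd
  -- Each `g t` is an iterate of a small-time map, which is how conservation of `F` and smoothness
  -- pass to all times.
  have hiterF : ∀ s, ‖s‖ < ε / 2 → ∀ (k : ℕ) x, jointMap F ((f s ^ k) x) = jointMap F x := by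
    intro s hs k
    induction k with
    | zero => intro x; rfl
    | succ k ih =>
      intro x
      rw [pow_succ]
      exact (ih _).trans (hfF s (by linarith) x)
  have hgF : ∀ t x, jointMap F (g t x) = jointMap F x := fun t x => by
    obtain ⟨k, s, hs, h⟩ := hgk t
    rw [h]
    exact hiterF s hs k x
  refine ⟨g, fun x => ?_, fun s t x => congrFun (hgadd s t) x, hgF, fun t x hx => ?_, fun t => ?_,
    fun x hx ψ hψ hxψ => ?_⟩
  · rw [hgf 0 (by simpa using half_pos hε), hf0]; rfl
  · rw [mem_preimage, hgF]; exact hx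
  · obtain ⟨k, s, hs, h⟩ := hgk t
    rw [h]
    clear h
    induction k with
    | zero => exact contMDiffOn_id
    | succ k ih =>
      rw [pow_succ]
      refine ContMDiffOn.comp (g := f s ^ k) (f := f s) ih (hfs s hs) fun x hx => ?_
      rw [mem_preimage, mem_preimage, hfF s (by linarith)]; exact hx
  · obtain ⟨δ, hδ, hδt⟩ := Metric.isOpen_iff.1 ψ.open_target (ψ x) (ψ.map_source hxψ)
    -- Below `δ / 2` translations of points near `x` stay in this particular chart; below `ε / 2`
    -- the action agrees with `f`.
    set η := min (δ / 2) (ε / 2) with hη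
    have hη0 : 0 < η := lt_min (half_pos hδ) (half_pos hε)
    have h1 : ∀ᶠ y in 𝓝 x, y ∈ ψ.source ∧ y ∈ jointMap F ⁻¹' B ∧ ψ y ∈ Metric.ball (ψ x) (δ / 2) := by
      filter_upwards [ψ.open_source.mem_nhds hxψ, hU.mem_nhds hx,
        (ψ.continuousAt hxψ).eventually (Metric.ball_mem_nhds (ψ x) (half_pos hδ))] with y h1 h2 h3
      exact ⟨h1, h2, h3⟩
    have h2 : ∀ᶠ t : Fin q → ℝ in 𝓝 0, ‖t‖ < η := by
      filter_upwards [Metric.ball_mem_nhds (0 : Fin q → ℝ) hη0] with t ht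
      simpa using ht
    filter_upwards [h2.prod_nhds h1] with p hp
    obtain ⟨ht, hy, hyU, hyb⟩ := hp
    have hb : Metric.ball (ψ p.2) η ⊆ ψ.target := by
      refine Subset.trans (fun z hz => ?_) hδt
      rw [Metric.mem_ball] at hz hyb ⊢
      linarith [dist_triangle z (ψ p.2) (ψ x), min_le_left (δ / 2) (ε / 2)]
    have hm := hb (htr (ψ p.2) p.1 η ht)
    have h3 : g p.1 p.2 = ψ.symm (ψ p.2 + (p.1, 0)) := by
      rw [hgf p.1 (ht.trans_le (min_le_right _ _))]
      exact hf p.1 p.2 ψ hyU hψ hy η hb ht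
    rw [h3]
    exact ⟨hy, ψ.map_target hm, ψ.right_inv hm⟩

end LeafFlow

/-! ### Lattices in `ℝ^q`. -/

section Lattice
open Filter Topology

/-- A discrete cocompact subgroup of `ℝ^q` is spanned over `ℤ` by a basis of `ℝ^q`. -/
lemma exists_basis_of_discrete_of_cocompact {q : ℕ} (Λ : AddSubgroup (Fin q → ℝ))
    (hdisc : ∀ᶠ t in 𝓝 (0 : Fin q → ℝ), t ∈ Λ → t = 0) {R : ℝ}
    (hcocompact : ∀ t : Fin q → ℝ, ∃ s, ‖s‖ ≤ R ∧ t - s ∈ Λ) :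
    ∃ b : Module.Basis (Fin q) ℝ (Fin q → ℝ),
      ∀ t, t ∈ Λ ↔ ∃ m : Fin q → ℤ, t = ∑ i, (m i : ℝ) • b i := by
  set L : Submodule ℤ (Fin q → ℝ) := AddSubgroup.toIntSubmodule Λ with hL
  have hd : DiscreteTopology L := by
    refine discreteTopology_of_isOpen_singleton_zero ?_
    rw [isOpen_singleton_iff_nhds_eq_pure]
    refine le_antisymm ?_ (pure_le_nhds _)
    rw [le_pure_iff]
    have hc : Tendsto (Subtype.val : L → Fin q → ℝ) (𝓝 0) (𝓝 0) :=
      continuous_subtype_val.tendsto (0 : L)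
    have h1 : ∀ᶠ t : L in 𝓝 0, (t : Fin q → ℝ) = 0 := by
      filter_upwards [hc.eventually hdisc] with t ht using ht t.2
    filter_upwards [h1] with t ht
    exact Subtype.ext ht
  have hZ : IsZLattice ℝ L := by
    refine ⟨?_⟩
    -- If the span were proper, a nonzero functional vanishing on it would be determined by its
    -- values on the ball of radius `R`, hence bounded, which is absurd.
    by_contra hne
    obtain ⟨f, hf0, hf⟩ := Submodule.exists_le_ker_of_lt_top _ (lt_top_iff_ne_top.2 hne)
    obtain ⟨v, hv⟩ : ∃ v, f v ≠ 0 := by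
      by_contra h
      push Not at h
      exact hf0 (LinearMap.ext h)
    have hfc : Continuous f := f.continuous_of_finiteDimensional
    obtain ⟨C, hC⟩ := (isCompact_closedBall (0 : Fin q → ℝ) R).exists_bound_of_continuousOn
      hfc.continuousOn
    have hb : ∀ t, ‖f t‖ ≤ C := by
      intro t
      obtain ⟨s, hs, hts⟩ := hcocompact t
      have h1 : f (t - s) = 0 := hf (Submodule.subset_span hts)
      rw [map_sub, sub_eq_zero] at h1
      rw [h1]
      exact hC s (by simpa using hs)
    obtain ⟨k, hk⟩ := exists_nat_gt (C / ‖f v‖)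
    have h2 := hb ((k : ℝ) • v)
    rw [map_smul, norm_smul, Real.norm_natCast] at h2
    rw [div_lt_iff₀ (norm_pos_iff.2 hv)] at hk
    linarith
  let b₀ := IsZLattice.basis L
  refine ⟨b₀.ofZLatticeBasis ℝ L, fun t => ?_⟩
  have h1 : t ∈ Λ ↔ t ∈ Submodule.span ℤ (range (b₀.ofZLatticeBasis ℝ L)) := by
    rw [b₀.ofZLatticeBasis_span ℝ L]; rfl
  rw [h1, Submodule.mem_span_range_iff_exists_fun]
  refine exists_congr fun m => ?_
  simp only [Int.cast_smul_eq_zsmul]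
  exact eq_comm

end Lattice

/-! ### Compact fibres, transitivity of the action, and the lattice of periods. -/

section Orbits
open Filter Topology

variable {n : ℕ} {M : Type*} [TopologicalSpace M] [ChartedSpace (EuclideanSpace ℝ (Fin n)) M]
  [IsManifold (𝓡 n) ∞ M]
  {q r : ℕ} {Z : Fin q → (x : M) → TangentSpace (𝓡 n) x} {F : Fin r → M → ℝ}

lemma isProperMap_jointMap (hproper : IsProperMap (fun x : M => fun j : Fin r => F j x)) :
    IsProperMap (jointMap F) :=
  (EuclideanSpace.equiv (Fin r) ℝ).symm.toHomeomorph.isProperMap.comp hproper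

/-- Near a compact regular fibre the straightening charts have a uniform size. -/
lemma exists_uniform_isRectifying (hsys : IsIntegrableSystem Z F)
    (hproper : IsProperMap (jointMap F)) (c : EuclideanSpace ℝ (Fin r))
    (hreg : ∀ x, jointMap F x = c → IndependentAt Z F x) :
    ∃ B : Set (EuclideanSpace ℝ (Fin r)), IsOpen B ∧ c ∈ B ∧ ∃ ε : ℝ, 0 < ε ∧
      ∀ x, jointMap F x ∈ B → ∃ ψ : OpenPartialHomeomorph M (FlatModel q r),
        IsRectifying Z F ψ ∧ x ∈ ψ.source ∧ Metric.ball (ψ x) ε ⊆ ψ.target := by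
  let P : ℝ → M → Prop := fun ε x => ∃ ψ : OpenPartialHomeomorph M (FlatModel q r),
    IsRectifying Z F ψ ∧ x ∈ ψ.source ∧ Metric.ball (ψ x) ε ⊆ ψ.target
  have hmono : ∀ ε ε' x, ε' ≤ ε → P ε x → P ε' x := fun ε ε' x h ⟨ψ, h1, h2, h3⟩ =>
    ⟨ψ, h1, h2, (Metric.ball_subset_ball h).trans h3⟩
  have hloc : ∀ x, jointMap F x = c → ∃ ε : ℝ, 0 < ε ∧ ∀ᶠ y in 𝓝 x, P ε y := by
    intro x hx
    obtain ⟨ψ, hxψ, hψ⟩ := exists_isRectifying hsys (hreg x hx)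
    obtain ⟨δ, hδ, hδt⟩ := Metric.isOpen_iff.1 ψ.open_target (ψ x) (ψ.map_source hxψ)
    refine ⟨δ / 2, half_pos hδ, ?_⟩
    filter_upwards [ψ.open_source.mem_nhds hxψ,
      (ψ.continuousAt hxψ).eventually (Metric.ball_mem_nhds (ψ x) (half_pos hδ))] with y hy hyb
    refine ⟨ψ, hψ, hy, Subset.trans (fun z hz => ?_) hδt⟩
    rw [Metric.mem_ball] at hz ⊢
    linarith [dist_triangle z (ψ y) (ψ x)]
  have hK : IsCompact (jointMap F ⁻¹' {c}) := hproper.isCompact_preimage isCompact_singleton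
  -- A finite subcover of the compact fibre gives one `ε` for all its points.
  obtain ⟨ε, hε, h⟩ : ∃ ε : ℝ, 0 < ε ∧ ∀ x ∈ jointMap F ⁻¹' {c}, ∀ᶠ y in 𝓝 x, P ε y := by
    refine hK.induction_on (p := fun s => ∃ ε : ℝ, 0 < ε ∧ ∀ x ∈ s, ∀ᶠ y in 𝓝 x, P ε y)
      ⟨1, one_pos, by simp⟩ ?_ ?_ ?_
    · rintro s t hst ⟨ε, hε, h⟩
      exact ⟨ε, hε, fun x hx => h x (hst hx)⟩
    · rintro s t ⟨ε, hε, h⟩ ⟨ε', hε', h'⟩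
      refine ⟨min ε ε', lt_min hε hε', ?_⟩
      rintro x (hx | hx)
      · exact (h x hx).mono fun y hy => hmono _ _ y (min_le_left _ _) hy
      · exact (h' x hx).mono fun y hy => hmono _ _ y (min_le_right _ _) hy
    · intro x hx
      obtain ⟨ε, hε, h⟩ := hloc x hx
      exact ⟨{y | ∀ᶠ z in 𝓝 y, P ε z}, mem_nhdsWithin_of_mem_nhds (eventually_eventually_nhds.2 h),
        ε, hε, fun y hy => hy⟩
  -- Since the map is closed, a neighbourhood of the fibre contains all nearby fibres, including any
  -- components of theirs that lie away from a given point.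
  have h2 := hproper.isClosedMap.eventually_nhds_fiber c h
  obtain ⟨B, hB, hBo, hcB⟩ := eventually_nhds_iff.1 h2
  exact ⟨B, hBo, hcB, ε, hε, fun x hx => hB _ hx x rfl⟩

namespace IsLeafFlow

variable {B : Set (EuclideanSpace ℝ (Fin r))} {Ψ : (Fin q → ℝ) → M → M}

omit [IsManifold (𝓡 n) ∞ M] in
lemma neg_apply_apply {U : Set M} (hΨ : IsLeafFlow Z F U Ψ) (t : Fin q → ℝ) (x : M) :
    Ψ (-t) (Ψ t x) = x := by
  rw [← hΨ.add_apply, neg_add_cancel, hΨ.zero_apply]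

omit [IsManifold (𝓡 n) ∞ M] in
lemma apply_neg_apply {U : Set M} (hΨ : IsLeafFlow Z F U Ψ) (t : Fin q → ℝ) (x : M) :
    Ψ t (Ψ (-t) x) = x := by
  rw [← hΨ.add_apply, add_neg_cancel, hΨ.zero_apply]

/-- The translations fixing a point. -/
def stabilizer {U : Set M} (hΨ : IsLeafFlow Z F U Ψ) (x : M) : AddSubgroup (Fin q → ℝ) where
  carrier := {t | Ψ t x = x}
  zero_mem' := hΨ.zero_apply x
  add_mem' {s t} hs ht := by
    simp only [mem_ofPred_eq] at hs ht ⊢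
    rw [hΨ.add_apply, ht, hs]
  neg_mem' {t} ht := by
    simp only [mem_ofPred_eq] at ht ⊢
    conv_lhs => rw [← ht]
    exact hΨ.neg_apply_apply t x

-- Two points of one fibre in a rectifying chart differ by a translation in the first factor, which
-- is the action. Thus orbits are open in fibres, with small times for nearby points.
omit [IsManifold (𝓡 n) ∞ M] in
lemma eventually_exists_small (hΨ : IsLeafFlow Z F (jointMap F ⁻¹' B) Ψ)
    (hch : ∀ x, jointMap F x ∈ B → ∃ ψ : OpenPartialHomeomorph M (FlatModel q r),
      x ∈ ψ.source ∧ IsRectifying Z F ψ) {x : M} (hx : jointMap F x ∈ B) {ε : ℝ} (hε : 0 < ε) :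
    ∀ᶠ y in 𝓝 x, jointMap F y = jointMap F x → ∃ t, ‖t‖ < ε ∧ Ψ t x = y := by
  obtain ⟨ψ, hxψ, hψ⟩ := hch x hx
  have hcont : ContinuousAt (fun y => ((ψ y).1 - (ψ x).1, x)) x :=
    ((continuous_fst.continuousAt.comp (ψ.continuousAt hxψ)).sub continuousAt_const).prodMk
      continuousAt_const
  have h0 : ((fun y => ((ψ y).1 - (ψ x).1, x)) x : (Fin q → ℝ) × M) = (0, x) := by simp
  have h1 := hΨ.eventually_translation x hx ψ hψ hxψ
  have hsmall : ∀ᶠ p : (Fin q → ℝ) × M in 𝓝 (0, x), ‖p.1‖ < ε := by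
    have : ContinuousAt (fun p : (Fin q → ℝ) × M => ‖p.1‖) (0, x) := by fun_prop
    exact this.eventually_lt_const (by simpa using hε)
  rw [← h0] at h1 hsmall
  filter_upwards [hcont.eventually h1, hcont.eventually hsmall, ψ.open_source.mem_nhds hxψ]
    with y hy hys hyψ hyF
  refine ⟨(ψ y).1 - (ψ x).1, hys, ψ.injOn hy.2.1 hyψ ?_⟩
  rw [hy.2.2]
  ext : 1
  · simp
  · simp [hψ.snd_eq x hxψ, hψ.snd_eq y hyψ, hyF]

-- Lying on one orbit is an equivalence relation with relatively open classes on the connected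
-- fibre.
omit [IsManifold (𝓡 n) ∞ M] in
lemma exists_apply_eq (hΨ : IsLeafFlow Z F (jointMap F ⁻¹' B) Ψ)
    (hch : ∀ x, jointMap F x ∈ B → ∃ ψ : OpenPartialHomeomorph M (FlatModel q r),
      x ∈ ψ.source ∧ IsRectifying Z F ψ) {c : EuclideanSpace ℝ (Fin r)} (hc : c ∈ B)
    (hconn : IsPreconnected (jointMap F ⁻¹' {c})) {x y : M} (hx : jointMap F x = c)
    (hy : jointMap F y = c) : ∃ t, Ψ t x = y := by
  refine hconn.induction₂ (fun x y => ∃ t, Ψ t x = y) ?_ ?_ ?_ hx hy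
  · intro x hx
    have hx' : jointMap F x = c := hx
    filter_upwards [mem_nhdsWithin_of_mem_nhds
      (hΨ.eventually_exists_small hch (x := x) (by rwa [hx']) one_pos), self_mem_nhdsWithin]
      with y hy hyc
    obtain ⟨t, -, ht⟩ := hy (Eq.trans hyc hx'.symm)
    exact ⟨t, ht⟩
  · rintro x _ _ - - - ⟨s, rfl⟩ ⟨t, rfl⟩
    exact ⟨t + s, hΨ.add_apply _ _ _⟩
  · rintro x _ - - ⟨s, rfl⟩
    exact ⟨-s, hΨ.neg_apply_apply _ _⟩

omit [IsManifold (𝓡 n) ∞ M] in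
/-- The stabiliser of a point on a compact connected leaf is a lattice. -/
lemma exists_basis_stabilizer (hΨ : IsLeafFlow Z F (jointMap F ⁻¹' B) Ψ)
    (hch : ∀ x, jointMap F x ∈ B → ∃ ψ : OpenPartialHomeomorph M (FlatModel q r),
      x ∈ ψ.source ∧ IsRectifying Z F ψ) {c : EuclideanSpace ℝ (Fin r)} (hc : c ∈ B)
    (hconn : IsPreconnected (jointMap F ⁻¹' {c})) (hcomp : IsCompact (jointMap F ⁻¹' {c}))
    {x₀ : M} (hx₀ : jointMap F x₀ = c) :
    ∃ b : Module.Basis (Fin q) ℝ (Fin q → ℝ),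
      ∀ t, Ψ t x₀ = x₀ ↔ ∃ m : Fin q → ℤ, t = ∑ i, (m i : ℝ) • b i := by
  set Λ := hΨ.stabilizer x₀
  have hdisc : ∀ᶠ t in 𝓝 (0 : Fin q → ℝ), t ∈ Λ → t = 0 := by
    obtain ⟨ψ, hxψ, hψ⟩ := hch x₀ (by rwa [hx₀])
    have h1 := hΨ.eventually_translation x₀ (by rwa [mem_preimage, hx₀]) ψ hψ hxψ
    have h2 : ContinuousAt (fun t : Fin q → ℝ => (t, x₀)) 0 := by fun_prop
    filter_upwards [h2.eventually h1] with t ht htΛ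
    have h3 : Ψ t x₀ = x₀ := htΛ
    have h4 := ht.2.2
    simp only [h3] at h4
    simpa using congrArg Prod.fst h4
  -- Compactness bounds the time needed to reach any point of the fibre from `x₀`; this is
  -- cocompactness of the stabiliser.
  obtain ⟨R, hR⟩ : ∃ R : ℝ, ∀ y ∈ jointMap F ⁻¹' {c}, ∃ t, ‖t‖ ≤ R ∧ Ψ t x₀ = y := by
    refine hcomp.induction_on (p := fun s => ∃ R : ℝ, ∀ y ∈ s, ∃ t, ‖t‖ ≤ R ∧ Ψ t x₀ = y)
      ⟨0, by simp⟩ ?_ ?_ ?_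
    · rintro s t hst ⟨R, h⟩
      exact ⟨R, fun y hy => h y (hst hy)⟩
    · rintro s t ⟨R, h⟩ ⟨R', h'⟩
      refine ⟨max R R', ?_⟩
      rintro y (hy | hy)
      · obtain ⟨t, ht, h1⟩ := h y hy
        exact ⟨t, ht.trans (le_max_left _ _), h1⟩
      · obtain ⟨t, ht, h1⟩ := h' y hy
        exact ⟨t, ht.trans (le_max_right _ _), h1⟩
    · intro x hx
      have hx' : jointMap F x = c := hx
      obtain ⟨s, rfl⟩ := hΨ.exists_apply_eq hch hc hconn hx₀ hx
      have h1 := hΨ.eventually_exists_small hch (x := Ψ s x₀) (by rwa [hx']) one_pos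
      refine ⟨_, inter_mem (mem_nhdsWithin_of_mem_nhds h1) self_mem_nhdsWithin, 1 + ‖s‖, ?_⟩
      rintro y ⟨hy, hyc⟩
      obtain ⟨t, ht, h2⟩ := hy (Eq.trans hyc hx'.symm)
      exact ⟨t + s, (norm_add_le _ _).trans (by linarith), by rw [hΨ.add_apply, h2]⟩
  obtain ⟨b, hb⟩ := exists_basis_of_discrete_of_cocompact Λ hdisc (R := R) fun t => by
    obtain ⟨s, hs, h⟩ := hR (Ψ t x₀) (by simp [hΨ.jointMap_apply, hx₀])
    refine ⟨s, hs, ?_⟩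
    show Ψ (t - s) x₀ = x₀
    rw [sub_eq_neg_add, hΨ.add_apply, ← h, hΨ.neg_apply_apply]
  exact ⟨b, hb⟩

end IsLeafFlow
end Orbits

/-! ### Smooth families of periods along a local section. -/

section Tube
open Filter Topology

variable {n : ℕ} {M : Type*} [TopologicalSpace M] [ChartedSpace (EuclideanSpace ℝ (Fin n)) M]
  {q r : ℕ} {Z : Fin q → (x : M) → TangentSpace (𝓡 n) x} {F : Fin r → M → ℝ}

/-- A section `σ` of the fibration by the `Fⱼ` over a ball, together with period matrices `Ω` of
the leaves: `Ω γ` maps `ℤ^q` onto the lattice of periods of the leaf over `γ`. -/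
structure IsPeriodFamily (F : Fin r → M → ℝ) (Ψ : (Fin q → ℝ) → M → M)
    (c : EuclideanSpace ℝ (Fin r)) (ρ : ℝ) (σ : EuclideanSpace ℝ (Fin r) → M)
    (Ω : EuclideanSpace ℝ (Fin r) → (Fin q → ℝ) →L[ℝ] (Fin q → ℝ)) : Prop where
  jointMap_section : ∀ γ ∈ Metric.ball c ρ, jointMap F (σ γ) = γ
  invertible : ∀ γ ∈ Metric.ball c ρ, (Ω γ).IsInvertible
  smooth_period : ContDiffOn ℝ ∞ Ω (Metric.ball c ρ)
  apply_eq_self_iff : ∀ γ ∈ Metric.ball c ρ, ∀ t, Ψ (Ω γ t) (σ γ) = σ γ ↔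
    ∃ m : Fin q → ℤ, t = fun i => (m i : ℝ)
  smooth_orbit : ContMDiffOn 𝓘(ℝ, FlatModel q r) (𝓡 n) ∞
    (fun p : FlatModel q r => Ψ p.1 (σ p.2)) (univ ×ˢ Metric.ball c ρ)
  exists_local_inverse : ∀ t, ∀ γ ∈ Metric.ball c ρ, ∃ K : M → FlatModel q r,
    ContMDiffAt (𝓡 n) 𝓘(ℝ, FlatModel q r) ∞ K (Ψ t (σ γ)) ∧ K (Ψ t (σ γ)) = (t, γ) ∧
      ∀ᶠ y in 𝓝 (Ψ t (σ γ)), Ψ (K y).1 (σ (K y).2) = y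

namespace IsLeafFlow
variable {B : Set (EuclideanSpace ℝ (Fin r))} {Ψ : (Fin q → ℝ) → M → M}
  {ψ : OpenPartialHomeomorph M (FlatModel q r)}

lemma eventually_apply_symm (hΨ : IsLeafFlow Z F (jointMap F ⁻¹' B) Ψ) (hψ : IsRectifying Z F ψ)
    {τ : Fin q → ℝ} {γ : EuclideanSpace ℝ (Fin r)} (hγ : γ ∈ B) (hτ : (τ, γ) ∈ ψ.target) :
    ∀ᶠ p : FlatModel q r in 𝓝 (0, γ), (τ + p.1, p.2) ∈ ψ.target ∧
      Ψ p.1 (ψ.symm (τ, p.2)) = ψ.symm (τ + p.1, p.2) := by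
  have hs : ContinuousAt (fun p : FlatModel q r => ψ.symm (τ, p.2)) (0, γ) :=
    ContinuousAt.comp (g := ψ.symm) (f := fun p : FlatModel q r => (τ, p.2))
      (ψ.continuousAt_symm hτ) (by fun_prop)
  have hc : ContinuousAt (fun p : FlatModel q r => (p.1, ψ.symm (τ, p.2))) (0, γ) :=
    continuous_fst.continuousAt.prodMk hs
  have hmem : jointMap F (ψ.symm (τ, γ)) ∈ B := by
    rw [← hψ.snd_eq _ (ψ.map_target hτ), ψ.right_inv hτ]; exact hγ
  have h1 := hc.eventually (hΨ.eventually_translation _ hmem ψ hψ (ψ.map_target hτ))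
  have h2 : ∀ᶠ p : FlatModel q r in 𝓝 (0, γ), (τ, p.2) ∈ ψ.target := by
    have : ContinuousAt (fun p : FlatModel q r => (τ, p.2)) (0, γ) := by fun_prop
    exact this.eventually (ψ.open_target.mem_nhds hτ)
  filter_upwards [h1, h2] with p hp hp2
  obtain ⟨-, h3, h4⟩ := hp
  rw [ψ.right_inv hp2, Prod.mk_add_mk, add_zero] at h4
  rw [← h4]
  exact ⟨ψ.map_source h3, (ψ.left_inv h3).symm⟩

/-- `IsLeafFlow` records smoothness for fixed time only. Writing `Ψ p.1` as `Ψ t` after `Ψ (p.1 -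
t)` reduces joint smoothness to small times, where the action is a translation in the chart. -/
lemma contMDiffAt_orbit (hB : IsOpen B) (hΨ : IsLeafFlow Z F (jointMap F ⁻¹' B) Ψ)
    (hFc : Continuous (jointMap F)) (hψ : IsRectifying Z F ψ)
    {τ : Fin q → ℝ} {γ : EuclideanSpace ℝ (Fin r)} (hγ : γ ∈ B) (hτ : (τ, γ) ∈ ψ.target)
    (t : Fin q → ℝ) :
    ContMDiffAt 𝓘(ℝ, FlatModel q r) (𝓡 n) ∞
      (fun p : FlatModel q r => Ψ p.1 (ψ.symm (τ, p.2))) (t, γ) := by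
  have hmem : jointMap F (ψ.symm (τ, γ)) ∈ B := by
    rw [← hψ.snd_eq _ (ψ.map_target hτ), ψ.right_inv hτ]; exact hγ
  have hz : ((τ + (t - t), γ) : FlatModel q r) = (τ, γ) := by simp
  have h1 : ContMDiffAt 𝓘(ℝ, FlatModel q r) (𝓡 n) ∞
      (fun p : FlatModel q r => Ψ t (ψ.symm (τ + (p.1 - t), p.2))) (t, γ) := by
    have h2 : ContMDiffAt 𝓘(ℝ, FlatModel q r) 𝓘(ℝ, FlatModel q r) ∞
        (fun p : FlatModel q r => (τ + (p.1 - t), p.2)) (t, γ) := by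
      refine ContDiffAt.contMDiffAt ?_
      fun_prop
    have h3 : ContMDiffAt 𝓘(ℝ, FlatModel q r) (𝓡 n) ∞
        (fun p : FlatModel q r => ψ.symm (τ + (p.1 - t), p.2)) (t, γ) := by
      refine ContMDiffAt.comp (g := ψ.symm) (t, γ) ?_ h2
      rw [hz]
      exact hψ.smooth_symm.contMDiffAt (ψ.open_target.mem_nhds hτ)
    refine ContMDiffAt.comp (g := Ψ t) (t, γ) ?_ h3
    rw [hz]
    exact (hΨ.smooth t).contMDiffAt ((hB.preimage hFc).mem_nhds hmem)
  refine h1.congr_of_eventuallyEq ?_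
  have hc : ContinuousAt (fun p : FlatModel q r => ((p.1 - t, p.2) : FlatModel q r)) (t, γ) := by
    fun_prop
  have h0 : (fun p : FlatModel q r => ((p.1 - t, p.2) : FlatModel q r)) (t, γ) = (0, γ) := by simp
  have h4 := hΨ.eventually_apply_symm hψ hγ hτ
  rw [← h0] at h4
  filter_upwards [hc.eventually h4] with p hp
  rw [← hp.2, ← hΨ.add_apply, add_sub_cancel]

/-- Flowing back by `-t` brings a neighbourhood of the orbit point into the chart, where time and
parameter can be read off after a shift by `t - τ`. -/
lemma exists_orbit_local_inverse (hB : IsOpen B) (hΨ : IsLeafFlow Z F (jointMap F ⁻¹' B) Ψ)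
    (hFc : Continuous (jointMap F)) (hψ : IsRectifying Z F ψ)
    {τ : Fin q → ℝ} {γ : EuclideanSpace ℝ (Fin r)} (hγ : γ ∈ B) (hτ : (τ, γ) ∈ ψ.target)
    (t : Fin q → ℝ) : ∃ K : M → FlatModel q r,
      ContMDiffAt (𝓡 n) 𝓘(ℝ, FlatModel q r) ∞ K (Ψ t (ψ.symm (τ, γ))) ∧
      K (Ψ t (ψ.symm (τ, γ))) = (t, γ) ∧
      ∀ᶠ y in 𝓝 (Ψ t (ψ.symm (τ, γ))), Ψ (K y).1 (ψ.symm (τ, (K y).2)) = y := by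
  set x := ψ.symm (τ, γ) with hx
  have hxs : x ∈ ψ.source := ψ.map_target hτ
  have hψx : ψ x = (τ, γ) := ψ.right_inv hτ
  have hmem : x ∈ jointMap F ⁻¹' B := by
    rw [mem_preimage, ← hψ.snd_eq x hxs, hψx]; exact hγ
  have hback : Ψ (-t) (Ψ t x) = x := hΨ.neg_apply_apply t x
  have hyU : Ψ t x ∈ jointMap F ⁻¹' B := hΨ.mem t x hmem
  have hΨs : ContMDiffAt (𝓡 n) (𝓡 n) ∞ (Ψ (-t)) (Ψ t x) :=
    (hΨ.smooth (-t)).contMDiffAt ((hB.preimage hFc).mem_nhds hyU)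
  have hψΨ : ContMDiffAt (𝓡 n) 𝓘(ℝ, FlatModel q r) ∞ (fun y => ψ (Ψ (-t) y)) (Ψ t x) := by
    refine ContMDiffAt.comp (g := ψ) (f := Ψ (-t)) (Ψ t x) ?_ hΨs
    rw [hback]
    exact hψ.smooth.contMDiffAt (ψ.open_source.mem_nhds hxs)
  refine ⟨fun y => ψ (Ψ (-t) y) + (t - τ, 0), hψΨ.add contMDiffAt_const, ?_, ?_⟩
  · simp only [hback, hψx]; simp
  · have hc : ContinuousAt (fun y => ψ (Ψ (-t) y) + ((-τ, 0) : FlatModel q r)) (Ψ t x) :=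
      hψΨ.continuousAt.add continuousAt_const
    have h0 : (fun y => ψ (Ψ (-t) y) + ((-τ, 0) : FlatModel q r)) (Ψ t x) = (0, γ) := by
      simp only [hback, hψx]; simp
    have h1 := hΨ.eventually_apply_symm hψ hγ hτ
    rw [← h0] at h1
    have h2 : ∀ᶠ y in 𝓝 (Ψ t x), Ψ (-t) y ∈ ψ.source :=
      hΨs.continuousAt.eventually (ψ.open_source.mem_nhds (by rwa [hback]))
    filter_upwards [hc.eventually h1, h2] with y hy hys
    obtain ⟨-, h3⟩ := hy
    have h4 : ((τ + (ψ (Ψ (-t) y) + ((-τ, 0) : FlatModel q r)).1,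
        (ψ (Ψ (-t) y) + ((-τ, 0) : FlatModel q r)).2) : FlatModel q r) = ψ (Ψ (-t) y) := by
      ext : 1 <;> simp
    rw [h4, ψ.left_inv hys] at h3
    have h5 : (ψ (Ψ (-t) y) + ((t - τ, 0) : FlatModel q r)).1 =
        t + (ψ (Ψ (-t) y) + ((-τ, 0) : FlatModel q r)).1 := by
      simp only [Prod.fst_add]; abel
    have h6 : (ψ (Ψ (-t) y) + ((t - τ, 0) : FlatModel q r)).2 =
        (ψ (Ψ (-t) y) + ((-τ, 0) : FlatModel q r)).2 := by simp
    rw [h5, h6, hΨ.add_apply, h3, hΨ.apply_neg_apply]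

theorem exists_isPeriodFamily [T2Space M] (hB : IsOpen B)
    (hΨ : IsLeafFlow Z F (jointMap F ⁻¹' B) Ψ) (hFc : Continuous (jointMap F))
    (hψ : IsRectifying Z F ψ) {c : EuclideanSpace ℝ (Fin r)} (hc : c ∈ B) {x₀ : M}
    (hx₀ : jointMap F x₀ = c) (hx₀ψ : x₀ ∈ ψ.source)
    (b : Module.Basis (Fin q) ℝ (Fin q → ℝ))
    (hb : ∀ t, Ψ t x₀ = x₀ ↔ ∃ m : Fin q → ℤ, t = ∑ i, (m i : ℝ) • b i) :
    ∃ ρ : ℝ, 0 < ρ ∧ Metric.ball c ρ ⊆ B ∧ ∃ σ Ω, σ c = x₀ ∧ IsPeriodFamily (n := n) F Ψ c ρ σ Ω := by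
  set τ := (ψ x₀).1 with hτdef
  have hψx₀ : ψ x₀ = (τ, c) := by rw [← hx₀, ← hψ.snd_eq x₀ hx₀ψ]
  have hτc : (τ, c) ∈ ψ.target := by rw [← hψx₀]; exact ψ.map_source hx₀ψ
  set σ : EuclideanSpace ℝ (Fin r) → M := fun γ => ψ.symm (τ, γ) with hσ
  have hσc : σ c = x₀ := by rw [hσ]; simp only; rw [← hψx₀, ψ.left_inv hx₀ψ]
  -- the domain on which the section is defined
  set O := B ∩ (fun γ => ((τ, γ) : FlatModel q r)) ⁻¹' ψ.target with hO
  have hOo : IsOpen O := hB.inter (ψ.open_target.preimage (by fun_prop))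
  have hcO : c ∈ O := ⟨hc, hτc⟩
  have hσF : ∀ γ ∈ O, jointMap F (σ γ) = γ := fun γ hγ => by
    rw [hσ, ← hψ.snd_eq _ (ψ.map_target hγ.2), ψ.right_inv hγ.2]
  have hσs : ContMDiffOn 𝓘(ℝ, EuclideanSpace ℝ (Fin r)) (𝓡 n) ∞ σ O := by
    refine hψ.smooth_symm.comp (t := ψ.target) (f := fun γ => ((τ, γ) : FlatModel q r)) ?_
      fun γ hγ => hγ.2
    exact ContMDiff.contMDiffOn (ContDiff.contMDiff (by fun_prop))
  have hU : IsOpen (jointMap F ⁻¹' B) := hB.preimage hFc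
  have hbx : ∀ i, Ψ (b i) x₀ = x₀ := fun i => (hb _).2 ⟨Pi.single i 1, by
    simp [Pi.single_apply, ite_smul]⟩
  -- the defect of periodicity of the basis of periods of the central leaf
  have hcont : ∀ i, ContinuousOn (fun γ => Ψ (b i) (σ γ)) O := fun i =>
    ((hΨ.smooth (b i)).continuousOn.comp hσs.continuousOn fun γ hγ => by
      rw [mem_preimage, hσF γ hγ]; exact hγ.1)
  set O₂ := O ∩ ⋂ i, (O ∩ (fun γ => Ψ (b i) (σ γ)) ⁻¹' ψ.source) with hO₂
  have hO₂o : IsOpen O₂ := hOo.inter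
    (isOpen_iInter_of_finite fun i => (hcont i).isOpen_inter_preimage hOo ψ.open_source)
  have hcO₂ : c ∈ O₂ := ⟨hcO, mem_iInter.2 fun i => ⟨hcO, by
    rw [mem_preimage, hσc, hbx]; exact hx₀ψ⟩⟩
  have hO₂s : ∀ γ ∈ O₂, ∀ i, Ψ (b i) (σ γ) ∈ ψ.source := fun γ hγ i => (mem_iInter.1 hγ.2 i).2
  set τ' : Fin q → EuclideanSpace ℝ (Fin r) → Fin q → ℝ := fun i γ =>
    (ψ (Ψ (b i) (σ γ))).1 - τ with hτ'
  have hτ'c : ∀ i, τ' i c = 0 := fun i => by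
    simp only [hτ', hσc, hbx, hψx₀, sub_self]
  have hτ's : ∀ i, ContDiffOn ℝ ∞ (τ' i) O₂ := by
    intro i γ hγ
    have h1 : ContMDiffAt 𝓘(ℝ, EuclideanSpace ℝ (Fin r)) (𝓡 n) ∞ (fun γ => Ψ (b i) (σ γ)) γ := by
      refine ContMDiffAt.comp (g := Ψ (b i)) γ ?_ (hσs.contMDiffAt (hOo.mem_nhds hγ.1))
      exact (hΨ.smooth (b i)).contMDiffAt (hU.mem_nhds (by
        rw [mem_preimage, hσF γ hγ.1]; exact hγ.1.1))
    have h2 : ContMDiffAt 𝓘(ℝ, EuclideanSpace ℝ (Fin r)) 𝓘(ℝ, FlatModel q r) ∞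
        (fun γ => ψ (Ψ (b i) (σ γ))) γ :=
      ContMDiffAt.comp (g := ψ) γ
        (hψ.smooth.contMDiffAt (ψ.open_source.mem_nhds (hO₂s γ hγ i))) h1
    exact ((contDiffAt_fst.comp γ (contMDiffAt_iff_contDiffAt.1 h2)).sub
      contDiffAt_const).contDiffWithinAt
  -- After time `b i` the point `σ γ` returns to its own plaque, displaced by `τ' i γ`. Subtracting
  -- this displacement gives an exact period of the orbit through `σ γ`, and the `i`-th column of `Ω
  -- γ`.
  set Ω : EuclideanSpace ℝ (Fin r) → (Fin q → ℝ) →L[ℝ] (Fin q → ℝ) := fun γ =>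
    ∑ i, (ContinuousLinearMap.proj (R := ℝ) (φ := fun _ : Fin q => ℝ) i).smulRight (b i - τ' i γ)
    with hΩ
  have hΩa : ∀ γ t, Ω γ t = ∑ i, t i • (b i - τ' i γ) := fun γ t => by
    simp [hΩ]
  have hΩs : ContDiffOn ℝ ∞ Ω O₂ :=
    ContDiffOn.sum fun i _ => contDiffOn_const.smulRight (contDiffOn_const.sub (hτ's i))
  have hΩc : ∀ t, Ω c t = ∑ i, t i • b i := fun t => by simp [hΩa, hτ'c]
  have hΩcont : ContinuousAt Ω c := hΩs.continuousOn.continuousAt (hO₂o.mem_nhds hcO₂)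
  have hσcont : ContinuousAt σ c := hσs.continuousOn.continuousAt (hOo.mem_nhds hcO)
  have hΩinv : (Ω c).IsInvertible := by
    refine ⟨b.equivFun.symm.toContinuousLinearEquiv, ?_⟩
    ext1 t
    rw [hΩc]
    simp [Module.Basis.equivFun_symm_apply]
  have evinv : ∀ᶠ γ in 𝓝 c, (Ω γ).IsInvertible :=
    hΩcont.eventually (isOpen_setOf_isInvertible.mem_nhds hΩinv)
  have evper : ∀ᶠ γ in 𝓝 c, ∀ i, Ψ (b i - τ' i γ) (σ γ) = σ γ := by
    refine eventually_all.2 fun i => ?_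
    have h1 : ContinuousAt (fun γ => ((τ' i γ, γ) : FlatModel q r)) c :=
      ((hτ's i).continuousOn.continuousAt (hO₂o.mem_nhds hcO₂)).prodMk continuousAt_id
    have h2 := hΨ.eventually_apply_symm hψ hc hτc
    have h0 : (fun γ => ((τ' i γ, γ) : FlatModel q r)) c = (0, c) := by simp [hτ'c]
    rw [← h0] at h2
    filter_upwards [h1.eventually h2, hO₂o.mem_nhds hcO₂] with γ hγ hγO
    have h3 : ψ (Ψ (b i) (σ γ)) = (τ + τ' i γ, γ) := by
      ext : 1
      · simp [hτ']
      · rw [hψ.snd_eq _ (hO₂s γ hγO i), hΨ.jointMap_apply, hσF γ hγO.1]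
    have h4 : Ψ (τ' i γ) (σ γ) = Ψ (b i) (σ γ) := by
      rw [← ψ.left_inv (hO₂s γ hγO i), h3]; exact hγ.2
    rw [sub_eq_neg_add, hΨ.add_apply, ← h4, hΨ.neg_apply_apply]
  -- The closed ball of radius `1 / 2` in the sup norm is the cube into which rounding moves any
  -- vector. On this compact cube, nonzero periods are excluded uniformly in `γ`: near `0` by
  -- straightening, elsewhere because `Ψ (Ω c t₀) (σ c) ≠ σ c` is an open condition.
  have evinj : ∀ᶠ γ in 𝓝 c, ∀ t ∈ Metric.closedBall (0 : Fin q → ℝ) (1 / 2),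
      Ψ (Ω γ t) (σ γ) = σ γ → t = 0 := by
    refine (isCompact_closedBall _ _).eventually_forall_of_forall_eventually fun t₀ ht₀ => ?_
    have hap : ContinuousAt (fun z : EuclideanSpace ℝ (Fin r) × (Fin q → ℝ) => Ω z.1 z.2)
        (c, t₀) :=
      ContinuousAt.clm_apply (ContinuousAt.comp (g := Ω) (f := Prod.fst) hΩcont continuousAt_fst)
        continuousAt_snd
    have hσ1 : ContinuousAt (fun z : EuclideanSpace ℝ (Fin r) × (Fin q → ℝ) => σ z.1) (c, t₀) :=
      ContinuousAt.comp (g := σ) (f := Prod.fst) hσcont continuousAt_fst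
    by_cases h0 : t₀ = 0
    · subst h0
      have h1 := hΨ.eventually_translation x₀ (by rwa [mem_preimage, hx₀]) ψ hψ hx₀ψ
      have h2 : (fun z : EuclideanSpace ℝ (Fin r) × (Fin q → ℝ) => (Ω z.1 z.2, σ z.1)) (c, 0) =
          (0, x₀) := by simp [hσc]
      rw [← h2] at h1
      filter_upwards [(hap.prodMk hσ1).eventually h1,
        (continuousAt_fst (p := (c, (0 : Fin q → ℝ)))).eventually evinv] with z hz hzi hzf
      have h3 := hz.2.2
      simp only [hzf] at h3
      have h4 : Ω z.1 z.2 = 0 := by simpa using congrArg Prod.fst h3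
      exact hzi.injective (by rw [h4, map_zero])
    · have hne : Ψ (Ω c t₀) (σ c) ≠ σ c := by
        rw [hσc]
        intro h
        obtain ⟨k, hk⟩ := (hb _).1 h
        rw [hΩc] at hk
        have hk' : ∀ i, t₀ i = k i := fun i => by
          have := congrArg (fun v => b.repr v i) hk
          simpa [map_sum, Finsupp.single_apply] using this
        refine h0 (funext fun i => ?_)
        have h5 : |t₀ i| ≤ 1 / 2 := (norm_le_pi_norm t₀ i).trans (by simpa using ht₀)
        rw [hk' i] at h5 ⊢
        have h6 : |k i| < 1 := by
          have : ((|k i| : ℤ) : ℝ) < 1 := by push_cast; linarith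
          exact_mod_cast this
        simp [Int.abs_lt_one_iff.1 h6]
      have horb : ContinuousAt (fun z : EuclideanSpace ℝ (Fin r) × (Fin q → ℝ) =>
          Ψ (Ω z.1 z.2) (σ z.1)) (c, t₀) :=
        ContinuousAt.comp (g := fun p : FlatModel q r => Ψ p.1 (ψ.symm (τ, p.2)))
          (f := fun z : EuclideanSpace ℝ (Fin r) × (Fin q → ℝ) => (Ω z.1 z.2, z.1))
          (hΨ.contMDiffAt_orbit hB hFc hψ hc hτc (Ω c t₀)).continuousAt
          (hap.prodMk continuousAt_fst)
      filter_upwards [(horb.ne_iff_eventually_ne hσ1).1 hne] with z hz hzf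
      exact absurd hzf hz
  obtain ⟨ρ, hρ, hρs⟩ := Metric.eventually_nhds_iff_ball.1
    ((hO₂o.eventually_mem hcO₂).and (evinv.and (evper.and evinj)))
  refine ⟨ρ, hρ, fun γ hγ => (hρs γ hγ).1.1.1, σ, Ω, hσc, ?_⟩
  refine ⟨fun γ hγ => hσF γ (hρs γ hγ).1.1, fun γ hγ => (hρs γ hγ).2.1,
    hΩs.mono fun γ hγ => (hρs γ hγ).1, fun γ hγ t => ?_, ?_, fun t γ hγ => ?_⟩
  · have hint : ∀ k : Fin q → ℤ, Ω γ (fun i => (k i : ℝ)) ∈ hΨ.stabilizer (σ γ) := fun k => by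
      rw [hΩa]
      refine sum_mem fun i _ => ?_
      rw [Int.cast_smul_eq_zsmul]
      exact zsmul_mem (show b i - τ' i γ ∈ hΨ.stabilizer (σ γ) from (hρs γ hγ).2.2.1 i) _
    constructor
    · intro h
      -- Integral vectors give periods, so rounding leaves a period inside the cube, which must
      -- vanish; hence there are no periods besides the integral ones.
      have h1 : Ω γ (t - fun i => (round (t i) : ℝ)) ∈ hΨ.stabilizer (σ γ) := by
        rw [map_sub]
        exact sub_mem (show Ω γ t ∈ hΨ.stabilizer (σ γ) from h) (hint fun i => round (t i))
      have h2 := (hρs γ hγ).2.2.2 _ (by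
        rw [mem_closedBall_zero_iff, pi_norm_le_iff_of_nonneg (by norm_num)]
        exact fun i => abs_sub_round (t i)) h1
      exact ⟨fun i => round (t i), sub_eq_zero.1 h2⟩
    · rintro ⟨k, rfl⟩
      exact hint k
  · rintro ⟨t, γ⟩ ⟨-, hγ⟩
    exact (hΨ.contMDiffAt_orbit hB hFc hψ (hρs γ hγ).1.1.1 (hρs γ hγ).1.1.2 t).contMDiffWithinAt
  · exact hΨ.exists_orbit_local_inverse hB hFc hψ (hρs γ hγ).1.1.1 (hρs γ hγ).1.1.2 t

end IsLeafFlow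
end Tube

/-! ### Smoothness of the torus covering, and diffeomorphisms built from local sections. -/

section TorusCover
open Filter Topology

namespace Torus

variable {q : ℕ}

/-- The representative in `[0, 1)^q` of a point of the torus. -/
def lift (t : Torus q) : Fin q → ℝ := fun k => (AddCircle.equivIco (1 : ℝ) 0 (t k) : ℝ)

lemma proj_lift (t : Torus q) : proj (lift t) = t :=
  funext fun k => (AddCircle.equivIco (1 : ℝ) 0).symm_apply_apply (t k)

lemma proj_add (θ η : Fin q → ℝ) : proj (θ + η) = proj θ + proj η := rfl

lemma contMDiffOn_cubeChart (a : Fin q → ℝ) :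
    ContMDiffOn 𝓘(ℝ, Fin q → ℝ) 𝓘(ℝ, Fin q → ℝ) ∞ (cubeChart a) (cubeChart a).source :=
  contMDiffOn_of_mem_maximalAtlas (IsManifold.subset_maximalAtlas ⟨a, rfl⟩)

lemma contMDiff_proj : ContMDiff 𝓘(ℝ, Fin q → ℝ) 𝓘(ℝ, Fin q → ℝ) ∞ (proj : (Fin q → ℝ) → Torus q) := by
  intro θ
  have h : θ ∈ (cubeChart fun k => θ k - 1 / 2).target := by
    rw [cubeChart_target]
    intro k _
    constructor <;> linarith
  exact (contMDiffOn_symm_of_mem_maximalAtlas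
    (IsManifold.subset_maximalAtlas (mem_range_self (f := cubeChart) _))).contMDiffAt
      ((cubeChart _).open_target.mem_nhds h)

end Torus

/-- A smooth injective map with smooth local sections is a diffeomorphism onto an open set. -/
lemma exists_openPartialHomeomorph_of_local_inverse {E E' H H' A M : Type*}
    [NormedAddCommGroup E] [NormedSpace ℝ E] [TopologicalSpace H] {I : ModelWithCorners ℝ E H}
    [NormedAddCommGroup E'] [NormedSpace ℝ E'] [TopologicalSpace H'] {I' : ModelWithCorners ℝ E' H'}
    [TopologicalSpace A] [ChartedSpace H A] [TopologicalSpace M] [ChartedSpace H' M] [Nonempty A]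
    {T : A → M} {S : Set A} (hS : IsOpen S) (hT : ContMDiffOn I I' ∞ T S) (hinj : InjOn T S)
    (hloc : ∀ p ∈ S, ∃ L : M → A, ContMDiffAt I' I ∞ L (T p) ∧ L (T p) = p ∧
      ∀ᶠ y in 𝓝 (T p), T (L y) = y) :
    ∃ Φ : OpenPartialHomeomorph A M, Φ.source = S ∧ (∀ p, Φ p = T p) ∧
      ContMDiffOn I' I ∞ Φ.symm Φ.target := by
  set e := BijOn.toPartialEquiv T S (T '' S) hinj.bijOn_image with he
  have hes : e.source = S := rfl
  have het : e.target = T '' S := rfl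
  have heT : ∀ p, e p = T p := fun p => rfl
  have key : ∀ y ∈ T '' S, ContMDiffAt I' I ∞ e.symm y ∧ T '' S ∈ 𝓝 y := by
    rintro _ ⟨p, hp, rfl⟩
    obtain ⟨L, hL, hLp, hTL⟩ := hloc p hp
    have h1 : ∀ᶠ y in 𝓝 (T p), L y ∈ S :=
      hL.continuousAt.eventually (hS.mem_nhds (by rwa [hLp]))
    refine ⟨hL.congr_of_eventuallyEq ?_, ?_⟩
    · filter_upwards [h1, hTL] with y hy hyT
      conv_lhs => rw [← hyT]
      exact e.left_inv hy
    · filter_upwards [h1, hTL] with y hy hyT using ⟨_, hy, hyT⟩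
  refine ⟨⟨⟨e, hT.continuousOn, fun y hy => (key y hy).1.continuousAt.continuousWithinAt⟩, hS, ?_⟩,
    rfl, fun p => rfl, fun y hy => (key y hy).1.contMDiffWithinAt⟩
  rw [isOpen_iff_mem_nhds]
  exact fun y hy => (key y hy).2

end TorusCover

/-! ### Angular coordinates on a tube of orbits. -/

section Tube
open Filter Topology

variable {n : ℕ} {M : Type*} [TopologicalSpace M] [ChartedSpace (EuclideanSpace ℝ (Fin n)) M]
  {q r : ℕ} {Z : Fin q → (x : M) → TangentSpace (𝓡 n) x} {F : Fin r → M → ℝ}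

namespace IsLeafFlow
variable {B : Set (EuclideanSpace ℝ (Fin r))} {Ψ : (Fin q → ℝ) → M → M}

/-- The group law moves the base point to `Ψ (u • v) x`, and near time `u` the orbit is a straight
line in a chart there. -/
lemma hasMFDerivAt_smul (hΨ : IsLeafFlow Z F (jointMap F ⁻¹' B) Ψ)
    (hch : ∀ x, jointMap F x ∈ B → ∃ ψ : OpenPartialHomeomorph M (FlatModel q r),
      x ∈ ψ.source ∧ IsRectifying Z F ψ) {x : M} (hx : jointMap F x ∈ B) (v : Fin q → ℝ) (u : ℝ) :
    HasMFDerivAt 𝓘(ℝ, ℝ) (𝓡 n) (fun s : ℝ => Ψ (s • v) x) u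
      ((1 : ℝ →L[ℝ] ℝ).smulRight (fieldComb Z v (Ψ (u • v) x))) := by
  set y := Ψ (u • v) x with hy
  have hyB : jointMap F y ∈ B := by rwa [hy, hΨ.jointMap_apply]
  obtain ⟨ψ, hyψ, hψ⟩ := hch y hyB
  have h1 := hΨ.eventually_translation y hyB ψ hψ hyψ
  have hc : ContinuousAt (fun s : ℝ => ((s - u) • v, y)) u := by fun_prop
  have h0 : (fun s : ℝ => ((s - u) • v, y)) u = (0, y) := by simp
  rw [← h0] at h1
  set p : FlatModel q r := ψ y - (u • v, 0) with hp
  have hpu : p + (u • v, 0) = ψ y := sub_add_cancel _ _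
  have h2 := hψ.hasMFDerivAt_symm_line p v (u := u) (by rw [hpu]; exact ψ.map_source hyψ)
  have h3 : (fun s : ℝ => Ψ (s • v) x) =ᶠ[𝓝 u] fun s => ψ.symm (p + (s • v, 0)) := by
    filter_upwards [hc.eventually h1] with s hs
    have h4 : Ψ (s • v) x = Ψ ((s - u) • v) y := by
      rw [hy, ← hΨ.add_apply, ← add_smul, sub_add_cancel]
    rw [h4, ← ψ.left_inv hs.2.1, hs.2.2, hp]
    congr 1
    rw [sub_smul]
    ext : 1
    · simp; abel
    · simp
  have h5 : ψ.symm (p + (u • v, 0)) = y := by rw [hpu, ψ.left_inv hyψ]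
  have h6 := h2.congr_of_eventuallyEq h3
  rw [h5] at h6
  exact h6

end IsLeafFlow

/-- A tube of leaves with angular coordinates normalised by the periods. -/
structure IsLeafTube (Z : Fin q → (x : M) → TangentSpace (𝓡 n) x) (F : Fin r → M → ℝ)
    (Ψ : (Fin q → ℝ) → M → M) (c : EuclideanSpace ℝ (Fin r)) (ρ : ℝ)
    (σ : EuclideanSpace ℝ (Fin r) → M)
    (Ω : EuclideanSpace ℝ (Fin r) → (Fin q → ℝ) →L[ℝ] (Fin q → ℝ))
    (Φ : OpenPartialHomeomorph (Torus q × EuclideanSpace ℝ (Fin r)) M) : Prop where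
  tubular : IsTubularChart (n := n) (jointMap F ⁻¹' {c}) Φ
  jointMap_eq : ∀ x ∈ Φ.target, jointMap F x = c + ρ • (Φ.symm x).2
  exists_eq : ∀ x ∈ Φ.target, ∃ t, Ψ t (σ (jointMap F x)) = x
  angularField_eq : ∀ x ∈ Φ.target, ∀ k,
    angularField Φ k x = fieldComb Z (Ω (jointMap F x) (Pi.single k 1)) x

theorem IsLeafFlow.exists_isLeafTube {B : Set (EuclideanSpace ℝ (Fin r))} {Ψ : (Fin q → ℝ) → M → M}
    (hΨ : IsLeafFlow Z F (jointMap F ⁻¹' B) Ψ)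
    (hch : ∀ x, jointMap F x ∈ B → ∃ ψ : OpenPartialHomeomorph M (FlatModel q r),
      x ∈ ψ.source ∧ IsRectifying Z F ψ) {c : EuclideanSpace ℝ (Fin r)} {ρ : ℝ} (hρ : 0 < ρ)
    (hρB : Metric.ball c ρ ⊆ B)
    (hconn : IsPreconnected (jointMap F ⁻¹' {c})) {σ : EuclideanSpace ℝ (Fin r) → M}
    {Ω : EuclideanSpace ℝ (Fin r) → (Fin q → ℝ) →L[ℝ] (Fin q → ℝ)}
    (hper : IsPeriodFamily (n := n) F Ψ c ρ σ Ω) :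
    ∃ Φ, IsLeafTube Z F Ψ c ρ σ Ω Φ := by
  set g : EuclideanSpace ℝ (Fin r) → EuclideanSpace ℝ (Fin r) := fun γ' => c + ρ • γ' with hg
  have hgb : ∀ γ' ∈ Metric.ball (0 : EuclideanSpace ℝ (Fin r)) 1, g γ' ∈ Metric.ball c ρ := by
    intro γ' h
    rw [mem_ball_zero_iff] at h
    rw [mem_ball_iff_norm, hg, add_sub_cancel_left, norm_smul, Real.norm_of_nonneg hρ.le]
    nlinarith
  -- `Torus.lift` is discontinuous, but by periodicity any representative gives the same value;
  -- smoothness is checked with representatives from the cube charts.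
  set T : Torus q × EuclideanSpace ℝ (Fin r) → M := fun p =>
    Ψ (Ω (g p.2) p.1.lift) (σ (g p.2)) with hT
  have hint : ∀ γ ∈ Metric.ball c ρ, ∀ k : Fin q → ℤ,
      Ψ (Ω γ fun i => (k i : ℝ)) (σ γ) = σ γ := fun γ hγ k =>
    (hper.apply_eq_self_iff γ hγ _).2 ⟨k, rfl⟩
  have hTproj : ∀ θ, ∀ γ' ∈ Metric.ball (0 : EuclideanSpace ℝ (Fin r)) 1,
      T (Torus.proj θ, γ') = Ψ (Ω (g γ') θ) (σ (g γ')) := by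
    intro θ γ' h
    obtain ⟨k, hk⟩ := (Torus.proj_eq_proj_iff (Torus.proj θ).lift θ).1 (Torus.proj_lift _)
    have h1 : θ = (Torus.proj θ).lift + fun i => (k i : ℝ) := funext hk
    rw [hT]
    simp only
    conv_rhs => rw [h1, map_add, hΨ.add_apply, hint _ (hgb _ h)]
  have hTF : ∀ p ∈ (univ : Set (Torus q)) ×ˢ Metric.ball (0 : EuclideanSpace ℝ (Fin r)) 1,
      jointMap F (T p) = g p.2 := fun p hp => by
    rw [hT, hΨ.jointMap_apply, hper.jointMap_section _ (hgb _ hp.2)]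
  have hSo : IsOpen ((univ : Set (Torus q)) ×ˢ Metric.ball (0 : EuclideanSpace ℝ (Fin r)) 1) :=
    isOpen_univ.prod Metric.isOpen_ball
  have hginj : ∀ γ₁ γ₂, g γ₁ = g γ₂ → γ₁ = γ₂ := fun γ₁ γ₂ h =>
    smul_right_injective _ hρ.ne' (add_left_cancel h)
  have hinj : InjOn T ((univ : Set (Torus q)) ×ˢ Metric.ball 0 1) := by
    rintro ⟨t₁, γ₁⟩ h₁ ⟨t₂, γ₂⟩ h₂ h
    have h3 := hTF _ h₁
    rw [h, hTF _ h₂] at h3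
    obtain rfl := hginj _ _ h3
    have h4 : Ψ (Ω (g γ₂) (t₂.lift - t₁.lift)) (σ (g γ₂)) = σ (g γ₂) := by
      rw [map_sub, sub_eq_neg_add, hΨ.add_apply]
      have h5 : Ψ (Ω (g γ₂) t₁.lift) (σ (g γ₂)) = Ψ (Ω (g γ₂) t₂.lift) (σ (g γ₂)) := h
      rw [← h5, hΨ.neg_apply_apply]
    obtain ⟨k, hk⟩ := (hper.apply_eq_self_iff _ (hgb _ h₁.2) _).1 h4
    have h6 : Torus.proj t₁.lift = Torus.proj t₂.lift :=
      (Torus.proj_eq_proj_iff _ _).2 ⟨k, fun i => by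
        have := congrFun hk i
        simp only [Pi.sub_apply] at this
        linarith⟩
    rw [Torus.proj_lift, Torus.proj_lift] at h6
    rw [h6]
  have hTs : ContMDiffOn (𝓘(ℝ, Fin q → ℝ).prod (𝓡 r)) (𝓡 n) ∞ T (univ ×ˢ Metric.ball 0 1) := by
    rintro ⟨t, γ'⟩ hp
    have hγ := hgb _ hp.2
    set e := Torus.cubeChart (Torus.corner t) with he
    have hte : t ∈ e.source := Torus.mem_cubeChart_source_corner t
    have h1 : ContMDiffAt (𝓘(ℝ, Fin q → ℝ).prod (𝓡 r)) 𝓘(ℝ, Fin q → ℝ) ∞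
        (fun p : Torus q × EuclideanSpace ℝ (Fin r) => e p.1) (t, γ') :=
      ContMDiffAt.comp (g := e) (t, γ')
        ((Torus.contMDiffOn_cubeChart _).contMDiffAt (e.open_source.mem_nhds hte)) contMDiffAt_fst
    have h2 : ContMDiffAt (𝓘(ℝ, Fin q → ℝ).prod (𝓡 r)) 𝓘(ℝ, FlatModel q r) ∞
        (fun p : Torus q × EuclideanSpace ℝ (Fin r) => ((e p.1, p.2) : FlatModel q r)) (t, γ') :=
      h1.prodMk_space contMDiffAt_snd
    have h3 : ContDiffAt ℝ ∞ (fun z : FlatModel q r => ((Ω (g z.2) z.1, g z.2) : FlatModel q r))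
        (e t, γ') := by
      have hg' : ContDiffAt ℝ ∞ (fun z : FlatModel q r => g z.2) (e t, γ') := by
        rw [hg]; fun_prop
      have hΩ' : ContDiffAt ℝ ∞ (fun z : FlatModel q r => Ω (g z.2)) (e t, γ') :=
        ContDiffAt.comp (g := Ω) (f := fun z : FlatModel q r => g z.2) (e t, γ')
          (hper.smooth_period.contDiffAt (Metric.isOpen_ball.mem_nhds hγ)) hg'
      exact (hΩ'.clm_apply contDiffAt_fst).prodMk hg'
    have h41 : ((Ω (g γ') (e t), g γ') : FlatModel q r) ∈ univ ×ˢ Metric.ball c ρ :=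
      mem_prod.2 ⟨mem_univ _, hγ⟩
    have h40 : ContMDiffAt 𝓘(ℝ, FlatModel q r) (𝓡 n) ∞
        (fun p : FlatModel q r => Ψ p.1 (σ p.2)) (Ω (g γ') (e t), g γ') :=
      hper.smooth_orbit.contMDiffAt ((isOpen_univ.prod Metric.isOpen_ball).mem_nhds h41)
    have h4 : ContMDiffAt 𝓘(ℝ, FlatModel q r) (𝓡 n) ∞
        (fun z : FlatModel q r => Ψ (Ω (g z.2) z.1) (σ (g z.2))) (e t, γ') :=
      ContMDiffAt.comp (g := fun p : FlatModel q r => Ψ p.1 (σ p.2)) (e t, γ') h40 h3.contMDiffAt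
    have h5 := ContMDiffAt.comp (g := fun z : FlatModel q r => Ψ (Ω (g z.2) z.1) (σ (g z.2)))
      (f := fun p : Torus q × EuclideanSpace ℝ (Fin r) => ((e p.1, p.2) : FlatModel q r))
      (t, γ') h4 h2
    refine (h5.congr_of_eventuallyEq ?_).contMDiffWithinAt
    filter_upwards [hSo.mem_nhds hp, (e.open_source.preimage continuous_fst).mem_nhds hte]
      with p hpS hpe
    have h6 : Torus.proj (e p.1) = p.1 := e.left_inv hpe
    have h7 := hTproj (e p.1) p.2 hpS.2
    rw [h6] at h7
    exact h7
  have hloc : ∀ p ∈ (univ : Set (Torus q)) ×ˢ Metric.ball (0 : EuclideanSpace ℝ (Fin r)) 1,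
      ∃ L : M → Torus q × EuclideanSpace ℝ (Fin r),
        ContMDiffAt (𝓡 n) (𝓘(ℝ, Fin q → ℝ).prod (𝓡 r)) ∞ L (T p) ∧ L (T p) = p ∧
        ∀ᶠ y in 𝓝 (T p), T (L y) = y := by
    rintro ⟨t, γ'⟩ hp
    have hγ := hgb _ hp.2
    obtain ⟨K, hK, hKp, hKev⟩ := hper.exists_local_inverse (Ω (g γ') t.lift) (g γ') hγ
    have hTp : T (t, γ') = Ψ (Ω (g γ') t.lift) (σ (g γ')) := rfl
    rw [← hTp] at hK hKp hKev
    have hK1 : ContMDiffAt (𝓡 n) 𝓘(ℝ, Fin q → ℝ) ∞ (fun y => (K y).1) (T (t, γ')) :=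
      ContMDiffAt.comp (g := Prod.fst) (T (t, γ')) contDiffAt_fst.contMDiffAt hK
    have hK2 : ContMDiffAt (𝓡 n) 𝓘(ℝ, EuclideanSpace ℝ (Fin r)) ∞ (fun y => (K y).2)
        (T (t, γ')) :=
      ContMDiffAt.comp (g := Prod.snd) (T (t, γ')) contDiffAt_snd.contMDiffAt hK
    have hJ : ContDiffAt ℝ ∞ (fun z : FlatModel q r => (Ω z.2).inverse z.1) (K (T (t, γ'))) := by
      rw [hKp]
      have h1 : ContDiffAt ℝ ∞ (fun z : FlatModel q r => Ω z.2) (Ω (g γ') t.lift, g γ') :=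
        ContDiffAt.comp (g := Ω) (f := fun z : FlatModel q r => z.2) _
          (hper.smooth_period.contDiffAt (Metric.isOpen_ball.mem_nhds hγ)) contDiffAt_snd
      have h2 : ContDiffAt ℝ ∞ (fun z : FlatModel q r => (Ω z.2).inverse)
          (Ω (g γ') t.lift, g γ') :=
        ContDiffAt.comp (g := ContinuousLinearMap.inverse) (f := fun z : FlatModel q r => Ω z.2) _
          (hper.invertible _ hγ).contDiffAt_inverse h1
      exact h2.clm_apply contDiffAt_fst
    have hJ' : ContMDiffAt (𝓡 n) 𝓘(ℝ, Fin q → ℝ) ∞ (fun y => (Ω (K y).2).inverse (K y).1)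
        (T (t, γ')) :=
      ContMDiffAt.comp (g := fun z : FlatModel q r => (Ω z.2).inverse z.1) (T (t, γ'))
        hJ.contMDiffAt hK
    refine ⟨fun y => (Torus.proj ((Ω (K y).2).inverse (K y).1), ρ⁻¹ • ((K y).2 - c)), ?_, ?_, ?_⟩
    · refine ContMDiffAt.prodMk ?_ ?_
      · exact ContMDiffAt.comp (g := Torus.proj) (T (t, γ')) Torus.contMDiff_proj.contMDiffAt hJ'
      · have h1 : ContDiffAt ℝ ∞ (fun z : EuclideanSpace ℝ (Fin r) => ρ⁻¹ • (z - c))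
          (K (T (t, γ'))).2 := by fun_prop
        exact ContMDiffAt.comp (g := fun z : EuclideanSpace ℝ (Fin r) => ρ⁻¹ • (z - c))
          (T (t, γ')) h1.contMDiffAt hK2
    · simp only [hKp]
      rw [(hper.invertible _ hγ).inverse_apply_eq.2 rfl, Torus.proj_lift]
      simp [hg, smul_smul, hρ.ne']
    · have h1 : ∀ᶠ y in 𝓝 (T (t, γ')), (K y).2 ∈ Metric.ball c ρ :=
        hK2.continuousAt.eventually (Metric.isOpen_ball.mem_nhds (by simp only [hKp]; exact hγ))
      filter_upwards [h1, hKev] with y hy hyK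
      have hgy : g (ρ⁻¹ • ((K y).2 - c)) = (K y).2 := by
        simp [hg, smul_smul, hρ.ne']
      have hyb : ρ⁻¹ • ((K y).2 - c) ∈ Metric.ball (0 : EuclideanSpace ℝ (Fin r)) 1 := by
        rw [mem_ball_iff_norm] at hy
        rw [mem_ball_zero_iff, norm_smul, norm_inv, Real.norm_of_nonneg hρ.le,
          inv_mul_lt_iff₀ hρ, mul_one]
        exact hy
      rw [hTproj _ _ hyb, hgy, (hper.invertible _ hy).self_apply_inverse]
      exact hyK
  obtain ⟨Φ, hΦs, hΦT, hΦsymm⟩ := exists_openPartialHomeomorph_of_local_inverse hSo hTs hinj hloc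
  have hΦmem : ∀ x ∈ Φ.target, Φ.symm x ∈ (univ : Set (Torus q)) ×ˢ Metric.ball 0 1 :=
    fun x hx => by rw [← hΦs]; exact Φ.map_target hx
  have hTsymm : ∀ x ∈ Φ.target, T (Φ.symm x) = x := fun x hx => by
    rw [← hΦT]; exact Φ.right_inv hx
  have hjoint : ∀ x ∈ Φ.target, jointMap F x = g (Φ.symm x).2 := fun x hx => by
    conv_lhs => rw [← hTsymm x hx]
    exact hTF _ (hΦmem x hx)
  have hg0 : g 0 = c := by simp [hg]
  have hcb : c ∈ Metric.ball c ρ := Metric.mem_ball_self hρ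
  refine ⟨Φ, ⟨hΦs, ?_, hΦsymm, ?_⟩, hjoint, fun x hx => ?_, fun x hx k => ?_⟩
  · rw [hΦs]
    exact hTs.congr fun p _ => hΦT p
  · ext y
    constructor
    · rintro ⟨⟨t, γ'⟩, ⟨-, h⟩, rfl⟩
      obtain rfl : γ' = 0 := h
      have h2 : ((t, 0) : Torus q × EuclideanSpace ℝ (Fin r)) ∈ univ ×ˢ Metric.ball 0 1 := by simp
      rw [hΦT, mem_preimage, hTF _ h2]
      exact hg0
    · intro hy
      -- Transitivity on the connected central fibre is what makes the zero section fill all of `N`.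
      obtain ⟨s, hs⟩ := hΨ.exists_apply_eq hch (hρB hcb) hconn (hper.jointMap_section c hcb) hy
      refine ⟨(Torus.proj ((Ω c).inverse s), 0), ⟨mem_univ _, rfl⟩, ?_⟩
      rw [hΦT, hTproj _ _ (by simp), hg0, (hper.invertible c hcb).self_apply_inverse, hs]
  · refine ⟨Ω (g (Φ.symm x).2) (Φ.symm x).1.lift, ?_⟩
    rw [hjoint x hx]
    exact hTsymm x hx
  · set v := Ω (jointMap F x) (Pi.single k 1) with hv
    have hxB : jointMap F x ∈ B := by rw [hjoint x hx]; exact hρB (hgb _ (hΦmem x hx).2)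
    -- Moving the `k`-th angle by `s` is the action of `s • Ω e_k`.
    have h1 : (fun s : ℝ => Φ ((Φ.symm x).1 + Torus.proj (Pi.single k s), (Φ.symm x).2)) =
        fun s : ℝ => Ψ (s • v) x := by
      funext s
      have h2 : (Φ.symm x).1 + Torus.proj (Pi.single k s) =
          Torus.proj (Pi.single k s + (Φ.symm x).1.lift) := by
        rw [Torus.proj_add, Torus.proj_lift, add_comm]
      have h3 : (Pi.single k s : Fin q → ℝ) = s • Pi.single k 1 := by
        rw [← Pi.single_smul, smul_eq_mul, mul_one]
      rw [h2, hΦT, hTproj _ _ (hΦmem x hx).2, map_add, hΨ.add_apply, h3, map_smul, hv, hjoint x hx]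
      congr 1
      exact hTsymm x hx
    have h4 := (hΨ.hasMFDerivAt_smul hch hxB v 0).mfderiv
    rw [← h1] at h4
    have h5 := congrArg (fun L : ℝ →L[ℝ] EuclideanSpace ℝ (Fin n) => L 1) h4
    have h6 : Ψ ((0 : ℝ) • v) x = x := by rw [zero_smul, hΨ.zero_apply]
    have h7 := congrArg (fun y => (fieldComb Z v y : EuclideanSpace ℝ (Fin n))) h6
    exact (Eq.trans h5 (one_smul ℝ (fieldComb Z v (Ψ ((0 : ℝ) • v) x) :
      EuclideanSpace ℝ (Fin n)))).trans h7

end Tube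

/-! ### The central torus as an embedded submanifold. -/

section ZeroSection
open Filter Topology

variable {n : ℕ} {M : Type*} [TopologicalSpace M] [ChartedSpace (EuclideanSpace ℝ (Fin n)) M]
  {q r : ℕ}

namespace IsTubularChart

variable {N : Set M} {Φ : OpenPartialHomeomorph (Torus q × EuclideanSpace ℝ (Fin r)) M}

/-- The chart of `M` given by an angular chart of the torus in a tube. -/
def tubeChart (Φ : OpenPartialHomeomorph (Torus q × EuclideanSpace ℝ (Fin r)) M)
    (L : FlatModel q r ≃L[ℝ] EuclideanSpace ℝ (Fin n)) (a : Fin q → ℝ) :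
    OpenPartialHomeomorph M (EuclideanSpace ℝ (Fin n)) :=
  (Φ.symm.trans ((Torus.cubeChart a).prod (OpenPartialHomeomorph.refl _))).trans
    L.toHomeomorph.toOpenPartialHomeomorph

lemma tubeChart_mem_maximalAtlas [IsManifold (𝓡 n) ∞ M] (hΦ : IsTubularChart (n := n) N Φ)
    (L : FlatModel q r ≃L[ℝ] EuclideanSpace ℝ (Fin n)) (a : Fin q → ℝ) :
    tubeChart Φ L a ∈ IsManifold.maximalAtlas (𝓡 n) ∞ M := by
  set e := Torus.cubeChart a with he
  have hsrc : ∀ x ∈ (tubeChart Φ L a).source, x ∈ Φ.target ∧ (Φ.symm x).1 ∈ e.source := by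
    intro x hx
    simp only [tubeChart, mfld_simps] at hx
    exact ⟨hx.1, hx.2⟩
  have htgt : ∀ z ∈ (tubeChart Φ L a).target,
      (L.symm z).1 ∈ e.target ∧ (e.symm (L.symm z).1, (L.symm z).2) ∈ Φ.source := by
    intro z hz
    simp only [tubeChart, mfld_simps] at hz
    exact ⟨hz.1, hz.2⟩
  refine OpenPartialHomeomorph.mem_maximalAtlas_of_contMDiffOn (I := 𝓡 n) (n := ∞) _ ?_ ?_
  · intro x hx
    obtain ⟨hx1, hx2⟩ := hsrc x hx
    have h1 : ContMDiffAt (𝓡 n) (𝓘(ℝ, Fin q → ℝ).prod (𝓡 r)) ∞ Φ.symm x :=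
      hΦ.smooth_symm.contMDiffAt (Φ.open_target.mem_nhds hx1)
    have h2 : ContMDiffAt (𝓡 n) 𝓘(ℝ, Fin q → ℝ) ∞ (fun y => e (Φ.symm y).1) x :=
      ContMDiffAt.comp (g := e) (f := fun y => (Φ.symm y).1) x
        ((Torus.contMDiffOn_cubeChart a).contMDiffAt (e.open_source.mem_nhds hx2)) h1.fst
    have h3 : ContMDiffAt (𝓡 n) 𝓘(ℝ, FlatModel q r) ∞
        (fun y => ((e (Φ.symm y).1, (Φ.symm y).2) : FlatModel q r)) x := h2.prodMk_space h1.snd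
    exact (ContMDiffAt.comp (g := L) x L.contDiff.contMDiff.contMDiffAt h3).contMDiffWithinAt
  · intro z hz
    obtain ⟨hz1, hz2⟩ := htgt z hz
    have h1 : ContMDiffAt (𝓡 n) 𝓘(ℝ, Fin q → ℝ) ∞ (fun y => (L.symm y).1) z :=
      (contDiffAt_fst.comp z L.symm.contDiff.contDiffAt).contMDiffAt
    have h2 : ContMDiffAt (𝓡 n) (𝓡 r) ∞ (fun y => (L.symm y).2) z :=
      (contDiffAt_snd.comp z L.symm.contDiff.contDiffAt).contMDiffAt
    have h3 : ContMDiffAt (𝓡 n) 𝓘(ℝ, Fin q → ℝ) ∞ (fun y => e.symm (L.symm y).1) z :=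
      ContMDiffAt.comp (g := e.symm) (f := fun y => (L.symm y).1) z
        Torus.contMDiff_proj.contMDiffAt h1
    exact (ContMDiffAt.comp (g := Φ) (f := fun y => (e.symm (L.symm y).1, (L.symm y).2)) z
      (hΦ.smooth.contMDiffAt (Φ.open_source.mem_nhds hz2)) (h3.prodMk h2)).contMDiffWithinAt

/-- In a cube chart of the torus and the corresponding `tubeChart`, the zero section is `θ ↦ L (θ,
0)`, the normal form of an immersion. It is injective and the torus is compact, hence an embedding.
-/
theorem exists_isSmoothEmbedding [T2Space M] [IsManifold (𝓡 n) ∞ M] (hdim : q + r = n)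
    (hΦ : IsTubularChart (n := n) N Φ) :
    ∃ e : Torus q → M, IsSmoothEmbedding 𝓘(ℝ, Fin q → ℝ) (𝓡 n) ∞ e ∧ range e = N := by
  have hmem : ∀ t : Torus q, (t, (0 : EuclideanSpace ℝ (Fin r))) ∈ Φ.source := fun t => by
    rw [hΦ.source_eq]; simp
  have hcont : Continuous fun t : Torus q => Φ (t, 0) :=
    Φ.continuousOn.comp_continuous (by fun_prop) hmem
  have hL : Module.finrank ℝ (FlatModel q r) = Module.finrank ℝ (EuclideanSpace ℝ (Fin n)) := by
    simp [FlatModel, hdim]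
  let L : FlatModel q r ≃L[ℝ] EuclideanSpace ℝ (Fin n) := ContinuousLinearEquiv.ofFinrankEq hL
  refine ⟨fun t => Φ (t, 0), ⟨⟨EuclideanSpace ℝ (Fin r), inferInstance, inferInstance, ?_⟩, ?_⟩, ?_⟩
  · intro t
    refine IsImmersionAtOfComplement.mk_of_continuousAt hcont.continuousAt L
      (Torus.cubeChart (Torus.corner t)) (tubeChart Φ L (Torus.corner t))
      (Torus.mem_cubeChart_source_corner t) ?_ (IsManifold.subset_maximalAtlas ⟨_, rfl⟩)
      (hΦ.tubeChart_mem_maximalAtlas L _) ?_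
    · simp only [tubeChart, mfld_simps]
      refine ⟨Φ.map_source (hmem t), ?_⟩
      rw [Φ.left_inv (hmem t)]
      exact Torus.mem_cubeChart_source_corner t
    · intro θ hθ
      simp only [mfld_simps] at hθ
      have h1 := (Torus.cubeChart (Torus.corner t)).right_inv hθ
      have h2 := Φ.left_inv (hmem ((Torus.cubeChart (Torus.corner t)).symm θ))
      simp only [tubeChart, mfld_simps]
      rw [h2, h1]
      rfl
  · refine (hcont.isClosedEmbedding fun t t' h => ?_).isEmbedding
    exact congrArg Prod.fst (Φ.injOn (hmem t) (hmem t') h)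
  · rw [← hΦ.image_zero]
    ext x
    constructor
    · rintro ⟨t, rfl⟩
      exact ⟨(t, 0), by simp, rfl⟩
    · rintro ⟨⟨t, γ⟩, ⟨-, h⟩, rfl⟩
      obtain rfl : γ = 0 := h
      exact ⟨t, rfl⟩

end IsTubularChart
end ZeroSection

/-! ### Generators in a frame, and tangency of the fields to the leaves. -/

section Generators
open Filter Topology

variable {n : ℕ} {M : Type*} [TopologicalSpace M] [ChartedSpace (EuclideanSpace ℝ (Fin n)) M]
  {q r : ℕ} {Z : Fin q → (x : M) → TangentSpace (𝓡 n) x} {F : Fin r → M → ℝ}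
  {V : (x : M) → TangentSpace (𝓡 n) x} {f g : M → ℝ} {x : M}

lemma lieDeriv_congr (h : f =ᶠ[𝓝 x] g) : lieDeriv V f x = lieDeriv V g x := by
  rw [lieDeriv, lieDeriv, mvfderiv_congr_of_eventuallyEq h]

lemma lieDeriv_eventuallyEq (h : f =ᶠ[𝓝 x] g) : lieDeriv V f =ᶠ[𝓝 x] lieDeriv V g :=
  h.eventuallyEq_nhds.mono fun _ hy => lieDeriv_congr hy

lemma lieDeriv_const (c : ℝ) : lieDeriv V (fun _ => c) x = 0 := by
  rw [lieDeriv, mvfderiv_const]; rfl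

lemma lieDeriv_eq_zero_of_eventually_const {c : ℝ} (h : ∀ᶠ y in 𝓝 x, f y = c) :
    lieDeriv V f x = 0 :=
  (lieDeriv_congr h).trans (lieDeriv_const c)

lemma lieDeriv_add (hf : MDifferentiableAt (𝓡 n) 𝓘(ℝ, ℝ) f x)
    (hg : MDifferentiableAt (𝓡 n) 𝓘(ℝ, ℝ) g x) :
    lieDeriv V (fun y => f y + g y) x = lieDeriv V f x + lieDeriv V g x :=
  congrArg (fun L : EuclideanSpace ℝ (Fin n) →L[ℝ] ℝ => L (V x)) (mvfderiv_add hf hg)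

lemma lieDeriv_mul (hf : MDifferentiableAt (𝓡 n) 𝓘(ℝ, ℝ) f x)
    (hg : MDifferentiableAt (𝓡 n) 𝓘(ℝ, ℝ) g x) :
    lieDeriv V (fun y => f y * g y) x = f x * lieDeriv V g x + g x * lieDeriv V f x :=
  congrArg (fun L : EuclideanSpace ℝ (Fin n) →L[ℝ] ℝ => L (V x)) (mvfderiv_mul hf hg)

lemma lieDeriv_const_mul (c : ℝ) (hf : MDifferentiableAt (𝓡 n) 𝓘(ℝ, ℝ) f x) :
    lieDeriv V (fun y => c * f y) x = c * lieDeriv V f x := by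
  rw [lieDeriv_mul mdifferentiableAt_const hf, lieDeriv_const, mul_zero, add_zero]

lemma lieDeriv_sum {ι : Type*} (s : Finset ι) {h : ι → M → ℝ}
    (hh : ∀ i ∈ s, MDifferentiableAt (𝓡 n) 𝓘(ℝ, ℝ) (h i) x) :
    MDifferentiableAt (𝓡 n) 𝓘(ℝ, ℝ) (fun y => ∑ i ∈ s, h i y) x ∧
      lieDeriv V (fun y => ∑ i ∈ s, h i y) x = ∑ i ∈ s, lieDeriv V (h i) x := by
  classical
  induction s using Finset.induction_on with
  | empty => simpa using ⟨mdifferentiableAt_const, lieDeriv_const 0⟩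
  | insert a s ha ih =>
    obtain ⟨h1, h2⟩ := ih fun i hi => hh i (Finset.mem_insert_of_mem hi)
    have h3 := hh a (Finset.mem_insert_self a s)
    simp only [Finset.sum_insert ha]
    exact ⟨h3.add h1, by rw [lieDeriv_add h3 h1, h2]⟩

lemma lieDeriv_eq_sum {t : Fin q → ℝ} (h : V x = fieldComb Z t x) :
    lieDeriv V f x = ∑ k, t k * lieDeriv (Z k) f x := by
  rw [lieDeriv, h, fieldComb, map_sum]
  simp [lieDeriv]

lemma ContMDiffOn.mdifferentiableAt_of_isOpen {W : Set M} (hW : IsOpen W)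
    (hf : ContMDiffOn (𝓡 n) 𝓘(ℝ, ℝ) ∞ f W) (hx : x ∈ W) :
    MDifferentiableAt (𝓡 n) 𝓘(ℝ, ℝ) f x :=
  (hf.contMDiffAt (hW.mem_nhds hx)).mdifferentiableAt (by simp)

variable [IsManifold (𝓡 n) ∞ M]

lemma contMDiffOn_lieDeriv {W : Set M} (hW : IsOpen W) (hf : ContMDiffOn (𝓡 n) 𝓘(ℝ, ℝ) ∞ f W)
    (hV : ContMDiffOn (𝓡 n) (𝓡 n).tangent ∞
      (fun x => (⟨x, V x⟩ : TangentBundle (𝓡 n) M)) W) :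
    ContMDiffOn (𝓡 n) 𝓘(ℝ, ℝ) ∞ (lieDeriv V f) W :=
  contMDiffOn_mvfderiv_apply hW hf hV

/-- The commutation hypotheses concern globally smooth functions, whereas the test functions used
below are chart coordinates. As generators are local, extension of germs bridges the gap. -/
lemma exists_contMDiff_eventuallyEq [T2Space M] {O : Set M} (hO : IsOpen O)
    (hf : ContMDiffOn (𝓡 n) 𝓘(ℝ, ℝ) ∞ f O) (hx : x ∈ O) :
    ∃ g, ContMDiff (𝓡 n) 𝓘(ℝ, ℝ) ∞ g ∧ g =ᶠ[𝓝 x] f := by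
  obtain ⟨φ, -, hφ⟩ := (SmoothBumpFunction.nhds_basis_tsupport (I := 𝓡 n) x).mem_iff.1
    (hO.mem_nhds hx)
  refine ⟨fun y => φ y • f y, contMDiff_of_tsupport fun y hy => ?_, ?_⟩
  · have hy' : y ∈ O := hφ (tsupport_smul_subset_left _ _ hy)
    exact φ.contMDiff.contMDiffAt.smul (hf.contMDiffAt (hO.mem_nhds hy'))
  · filter_upwards [φ.eventuallyEq_one] with y hy
    rw [hy]; exact one_smul ℝ _

namespace SDS

variable {U : Set M} {m : ℕ}

lemma generator_congr (X : SDS n M U m) (h : f =ᶠ[𝓝 x] g) : X.generator f x = X.generator g x := by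
  simp only [generator]
  rw [lieDeriv_congr h]
  congr 2
  exact Finset.sum_congr rfl fun i _ => lieDeriv_congr (lieDeriv_eventuallyEq h)

lemma generator_eventuallyEq (X : SDS n M U m) (h : f =ᶠ[𝓝 x] g) :
    X.generator f =ᶠ[𝓝 x] X.generator g :=
  h.eventuallyEq_nhds.mono fun _ hy => X.generator_congr hy

lemma generator_const (X : SDS n M U m) (c : ℝ) : X.generator (fun _ => c) x = 0 := by
  have h : ∀ V : (x : M) → TangentSpace (𝓡 n) x, lieDeriv V (fun _ : M => c) = fun _ => 0 :=
    fun V => funext fun y => lieDeriv_const c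
  simp [generator, h, lieDeriv_const]

/-- The first order coefficients of the generator in a frame `Z`. -/
def driftCoeff (Z : Fin q → (x : M) → TangentSpace (𝓡 n) x) (β : Fin (m + 1) → M → Fin q → ℝ)
    (l : Fin q) (x : M) : ℝ :=
  β 0 x l + (1 / 2) * ∑ i : Fin m, ∑ k, β i.succ x k * lieDeriv (Z k) (fun y => β i.succ y l) x

omit [TopologicalSpace M] [ChartedSpace (EuclideanSpace ℝ (Fin n)) M] [IsManifold (𝓡 n) ∞ M] in
/-- The second order coefficients of the generator in a frame. -/
def diffusionCoeff (β : Fin (m + 1) → M → Fin q → ℝ) (k l : Fin q) (x : M) : ℝ :=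
  ∑ i : Fin m, β i.succ x k * β i.succ x l

/-- Squaring `∑ βₗ Zₗ` produces, by the product rule, first order terms `βₖ Zₖ(βₗ) Zₗ`, which join
the drift in `driftCoeff`. -/
lemma generator_eq_of_fieldComb (X : SDS n M U m) {W : Set M} (hW : IsOpen W)
    (hZ : ∀ i, ContMDiff (𝓡 n) (𝓡 n).tangent ∞ (fun x => (⟨x, Z i x⟩ : TangentBundle (𝓡 n) M)))
    {β : Fin (m + 1) → M → Fin q → ℝ}
    (hβ : ∀ i l, ContMDiffOn (𝓡 n) 𝓘(ℝ, ℝ) ∞ (fun x => β i x l) W)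
    (hX : ∀ i, ∀ x ∈ W, X.field i x = fieldComb Z (β i x) x)
    (hf : ContMDiffOn (𝓡 n) 𝓘(ℝ, ℝ) ∞ f W) (hx : x ∈ W) :
    X.generator f x = ∑ l, driftCoeff Z β l x * lieDeriv (Z l) f x +
      (1 / 2) * ∑ k, ∑ l, diffusionCoeff β k l x * lieDeriv (Z k) (lieDeriv (Z l) f) x := by
  have hZf : ∀ l, MDifferentiableAt (𝓡 n) 𝓘(ℝ, ℝ) (lieDeriv (Z l) f) x := fun l =>
    (contMDiffOn_lieDeriv hW hf (hZ l).contMDiffOn).mdifferentiableAt_of_isOpen hW hx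
  have hβx : ∀ i l, MDifferentiableAt (𝓡 n) 𝓘(ℝ, ℝ) (fun x => β i x l) x := fun i l =>
    (hβ i l).mdifferentiableAt_of_isOpen hW hx
  have h1 : ∀ i, lieDeriv (X.field i) f =ᶠ[𝓝 x] fun y => ∑ l, β i y l * lieDeriv (Z l) f y := by
    intro i
    filter_upwards [hW.mem_nhds hx] with y hy using lieDeriv_eq_sum (hX i y hy)
  have h2 : ∀ i, lieDeriv (X.field i) (lieDeriv (X.field i) f) x =
      (∑ l, (∑ k, β i x k * lieDeriv (Z k) (fun y => β i y l) x) * lieDeriv (Z l) f x) +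
        ∑ k, ∑ l, β i x k * β i x l * lieDeriv (Z k) (lieDeriv (Z l) f) x := by
    intro i
    rw [lieDeriv_congr (h1 i), lieDeriv_eq_sum (hX i x hx)]
    have h3 : ∀ k, lieDeriv (Z k) (fun y => ∑ l, β i y l * lieDeriv (Z l) f y) x =
        ∑ l, (β i x l * lieDeriv (Z k) (lieDeriv (Z l) f) x +
          lieDeriv (Z l) f x * lieDeriv (Z k) (fun y => β i y l) x) := fun k => by
      rw [(lieDeriv_sum (h := fun l y => β i y l * lieDeriv (Z l) f y) _
        fun l _ => (hβx i l).mul (hZf l)).2]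
      exact Finset.sum_congr rfl fun l _ => lieDeriv_mul (hβx i l) (hZf l)
    simp only [h3, Finset.mul_sum, Finset.sum_mul, mul_add, Finset.sum_add_distrib]
    rw [add_comm]
    congr 1
    · rw [Finset.sum_comm]
      exact Finset.sum_congr rfl fun l _ => Finset.sum_congr rfl fun k _ => by ring
    · exact Finset.sum_congr rfl fun l _ => Finset.sum_congr rfl fun k _ => by ring
  simp only [generator, h2, driftCoeff, diffusionCoeff, add_mul, Finset.sum_add_distrib, mul_add]
  rw [lieDeriv_eq_sum (hX 0 x hx), add_assoc]
  congr 2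
  · rw [Finset.sum_comm, Finset.mul_sum]
    refine Finset.sum_congr rfl fun l _ => ?_
    rw [mul_assoc, Finset.sum_mul]
  · congr 1
    rw [Finset.sum_comm]
    refine Finset.sum_congr rfl fun k _ => ?_
    rw [Finset.sum_comm]
    refine Finset.sum_congr rfl fun l _ => ?_
    rw [Finset.sum_mul]

namespace IsIntegrableWith

variable {X : SDS n M univ m}

lemma generator_lieDeriv [T2Space M] (hX : X.IsIntegrableWith Z F) {O : Set M} (hO : IsOpen O)
    (hf : ContMDiffOn (𝓡 n) 𝓘(ℝ, ℝ) ∞ f O) (hx : x ∈ O) (i : Fin q) :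
    X.generator (lieDeriv (Z i) f) x = lieDeriv (Z i) (X.generator f) x := by
  obtain ⟨g, hg, hgf⟩ := exists_contMDiff_eventuallyEq hO hf hx
  rw [← X.generator_congr (lieDeriv_eventuallyEq hgf),
    ← lieDeriv_congr (X.generator_eventuallyEq hgf)]
  exact hX.commute_field i g hg x

lemma contMDiff_field (X : SDS n M univ m) (i : Fin (m + 1)) : ContMDiff (𝓡 n) (𝓡 n).tangent ∞
    (fun x => (⟨x, X.field i x⟩ : TangentBundle (𝓡 n) M)) :=
  contMDiffOn_univ.1 (X.smooth i)

/-- All fields of the system are tangent to the leaves. -/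
lemma lieDeriv_field_eq_zero (hX : X.IsIntegrableWith Z F) (i : Fin (m + 1)) (j : Fin r) (x : M) :
    lieDeriv (X.field i) (F j) x = 0 := by
  have hF := hX.system.smooth_fun j
  have hFd : ∀ y, MDifferentiableAt (𝓡 n) 𝓘(ℝ, ℝ) (F j) y := fun y =>
    (hF y).mdifferentiableAt (by simp)
  -- Commutation applied to the constant `1`, which the generator annihilates.
  have h0 : ∀ y, X.generator (F j) y = 0 := by
    intro y
    have h := hX.commute_fun j (fun _ => 1) contMDiff_const y
    simpa only [mul_one, generator_const, mul_zero] using h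
  have h1 : ∀ y, X.generator (fun z => F j z * F j z) y = 0 := fun y => by
    rw [hX.commute_fun j (F j) hF y, h0, mul_zero]
  have hsq : ∀ (i : Fin (m + 1)) y, lieDeriv (X.field i) (fun z => F j z * F j z) y =
      2 * (F j y * lieDeriv (X.field i) (F j) y) := fun i y => by
    rw [lieDeriv_mul (hFd y) (hFd y)]; ring
  have hsq2 : ∀ (i : Fin (m + 1)) y,
      lieDeriv (X.field i) (lieDeriv (X.field i) fun z => F j z * F j z) y =
      2 * (F j y * lieDeriv (X.field i) (lieDeriv (X.field i) (F j)) y +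
        lieDeriv (X.field i) (F j) y ^ 2) := fun i y => by
    have hd : MDifferentiableAt (𝓡 n) 𝓘(ℝ, ℝ) (lieDeriv (X.field i) (F j)) y :=
      (contMDiffOn_lieDeriv isOpen_univ hF.contMDiffOn
        (X.smooth i)).mdifferentiableAt_of_isOpen isOpen_univ (mem_univ y)
    rw [funext (hsq i), lieDeriv_const_mul (f := fun z => F j z * lieDeriv (X.field i) (F j) z) 2
      ((hFd y).mul hd), lieDeriv_mul (hFd y) hd]
    ring
  -- The sum of squares is `A(Fⱼ²) - 2 Fⱼ A(Fⱼ)`, and both terms vanish. The drift then follows from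
  -- `A(Fⱼ) = 0`.
  have hsum : ∀ y, ∑ i : Fin m, lieDeriv (X.field i.succ) (F j) y ^ 2 = 0 := by
    intro y
    have h2 := h1 y
    have h3 := h0 y
    simp only [generator, hsq, hsq2, ← Finset.mul_sum, Finset.sum_add_distrib] at h2 h3
    linear_combination h2 - 2 * F j y * h3
  have hsucc : ∀ (i : Fin m) y, lieDeriv (X.field i.succ) (F j) y = 0 := fun i y => by
    have := (Finset.sum_eq_zero_iff_of_nonneg fun i _ => sq_nonneg _).1 (hsum y) i
      (Finset.mem_univ i)
    exact pow_eq_zero_iff two_ne_zero |>.1 this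
  refine Fin.cases ?_ (fun i => hsucc i x) i
  have h3 := h0 x
  have h4 : ∀ i : Fin m, lieDeriv (X.field i.succ) (F j) = fun _ => 0 := fun i =>
    funext (hsucc i)
  simpa [generator, h4, lieDeriv_const] using h3

end IsIntegrableWith
end SDS
end Generators

/-! ### Coefficients of the generator are constant along the leaves. -/

section NormalForm
open Filter Topology

variable {n : ℕ} {M : Type*} [TopologicalSpace M] [ChartedSpace (EuclideanSpace ℝ (Fin n)) M]
  [IsManifold (𝓡 n) ∞ M]
  {q r : ℕ} {Z : Fin q → (x : M) → TangentSpace (𝓡 n) x} {F : Fin r → M → ℝ}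

namespace IsRectifying
variable {ψ : OpenPartialHomeomorph M (FlatModel q r)}

omit [IsManifold (𝓡 n) ∞ M] in
lemma contMDiffOn_coord (hψ : IsRectifying Z F ψ) (l : Fin q) :
    ContMDiffOn (𝓡 n) 𝓘(ℝ, ℝ) ∞ (fun y => (ψ y).1 l) ψ.source := by
  have h : ContDiff ℝ ∞ fun z : FlatModel q r => z.1 l := by fun_prop
  exact h.contMDiff.comp_contMDiffOn hψ.smooth

omit [IsManifold (𝓡 n) ∞ M] in
lemma lieDeriv_coord (hψ : IsRectifying Z F ψ) {x : M} (hx : x ∈ ψ.source)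
    (V : (x : M) → TangentSpace (𝓡 n) x) (l : Fin q) :
    lieDeriv V (fun y => (ψ y).1 l) x = (mvfderiv (𝓡 n) ψ x (V x)).1 l :=
  mvfderiv_clm_comp ((ContinuousLinearMap.proj (R := ℝ) (φ := fun _ : Fin q => ℝ) l).comp
    (ContinuousLinearMap.fst ℝ (Fin q → ℝ) (EuclideanSpace ℝ (Fin r)))) (hψ.mdifferentiableAt hx) (V x)

omit [IsManifold (𝓡 n) ∞ M] in
lemma lieDeriv_field_coord (hψ : IsRectifying Z F ψ) {x : M} (hx : x ∈ ψ.source) (k l : Fin q) :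
    lieDeriv (Z k) (fun y => (ψ y).1 l) x = if k = l then 1 else 0 := by
  rw [hψ.lieDeriv_coord hx, hψ.mvfderiv_field x hx]
  simp [Pi.single_apply, eq_comm]

omit [IsManifold (𝓡 n) ∞ M] in
lemma eq_fieldComb (hψ : IsRectifying Z F ψ) (hF : ∀ j, ContMDiff (𝓡 n) 𝓘(ℝ, ℝ) ∞ (F j))
    {x : M} (hx : x ∈ ψ.source) {v : TangentSpace (𝓡 n) x}
    (hv : ∀ j, mvfderiv (𝓡 n) (F j) x v = 0) :
    v = fieldComb Z (mvfderiv (𝓡 n) ψ x v).1 x := by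
  have h1 : (mvfderiv (𝓡 n) ψ x v).2 = mvfderiv (𝓡 n) (jointMap F) x v := by
    have h2 := mvfderiv_clm_comp (ContinuousLinearMap.snd ℝ (Fin q → ℝ) (EuclideanSpace ℝ (Fin r)))
      (hψ.mdifferentiableAt hx) v
    have h3 : (fun y => ContinuousLinearMap.snd ℝ (Fin q → ℝ) (EuclideanSpace ℝ (Fin r)) (ψ y))
        =ᶠ[𝓝 x] jointMap F := by
      filter_upwards [ψ.open_source.mem_nhds hx] with y hy using hψ.snd_eq y hy
    rw [mvfderiv_congr_of_eventuallyEq h3] at h2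
    exact h2.symm
  have h4 : mvfderiv (𝓡 n) (jointMap F) x v = 0 := by
    ext j
    rw [mvfderiv_jointMap_apply hF]
    exact hv j
  have h5 : mvfderiv (𝓡 n) ψ x v =
      mvfderiv (𝓡 n) ψ x (fieldComb Z (mvfderiv (𝓡 n) ψ x v).1 x) := by
    rw [hψ.mvfderiv_fieldComb hx]
    exact Prod.ext rfl (h1.trans h4)
  have h6 := hψ.mfderiv_symm_mvfderiv hx v
  rw [h5] at h6
  exact h6.symm.trans (hψ.mfderiv_symm_mvfderiv hx _)

end IsRectifying

namespace SDS
namespace IsIntegrableWith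

variable {m : ℕ} {X : SDS n M univ m} {U : Set M}

/-- The coefficients are chosen pointwise; smoothness holds because in a rectifying chart they are
the derivatives `Xᵢ(tₗ)` of the coordinates. -/
lemma exists_fieldComb (hX : X.IsIntegrableWith Z F) (hU : IsOpen U)
    (hch : ∀ x ∈ U, ∃ ψ : OpenPartialHomeomorph M (FlatModel q r),
      x ∈ ψ.source ∧ IsRectifying Z F ψ) :
    ∃ β : Fin (m + 1) → M → Fin q → ℝ,
      (∀ i, ∀ x ∈ U, X.field i x = fieldComb Z (β i x) x) ∧
      ∀ i l, ContMDiffOn (𝓡 n) 𝓘(ℝ, ℝ) ∞ (fun x => β i x l) U := by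
  have h1 : ∀ (i : Fin (m + 1)) (x : M), ∃ t, x ∈ U → X.field i x = fieldComb Z t x := by
    intro i x
    by_cases hx : x ∈ U
    · obtain ⟨ψ, hxψ, hψ⟩ := hch x hx
      exact ⟨_, fun _ => hψ.eq_fieldComb hX.system.smooth_fun hxψ
        fun j => hX.lieDeriv_field_eq_zero i j x⟩
    · exact ⟨0, fun h => absurd h hx⟩
  choose β hβ using h1
  refine ⟨β, hβ, fun i l x hx => ?_⟩
  obtain ⟨ψ, hxψ, hψ⟩ := hch x hx
  have h2 : ContMDiffAt (𝓡 n) 𝓘(ℝ, ℝ) ∞ (lieDeriv (X.field i) fun y => (ψ y).1 l) x :=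
    (contMDiffOn_lieDeriv ψ.open_source (hψ.contMDiffOn_coord l)
      (contMDiff_field X i).contMDiffOn).contMDiffAt (ψ.open_source.mem_nhds hxψ)
  refine (h2.congr_of_eventuallyEq ?_).contMDiffWithinAt
  filter_upwards [ψ.open_source.mem_nhds hxψ, hU.mem_nhds hx] with y hy hyU
  rw [hψ.lieDeriv_coord hy, hβ i y hyU, hψ.mvfderiv_fieldComb hy]

variable {β : Fin (m + 1) → M → Fin q → ℝ}

lemma contMDiffOn_driftCoeff (hU : IsOpen U)
    (hZ : ∀ i, ContMDiff (𝓡 n) (𝓡 n).tangent ∞ (fun x => (⟨x, Z i x⟩ : TangentBundle (𝓡 n) M)))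
    (hβ : ∀ i l, ContMDiffOn (𝓡 n) 𝓘(ℝ, ℝ) ∞ (fun x => β i x l) U) (l : Fin q) :
    ContMDiffOn (𝓡 n) 𝓘(ℝ, ℝ) ∞ (driftCoeff Z β l) U := by
  refine (hβ 0 l).add (contMDiffOn_const.mul ?_)
  refine contMDiffOn_finsetSum fun i _ => contMDiffOn_finsetSum fun k _ => ?_
  exact (hβ i.succ k).mul (contMDiffOn_lieDeriv hU (hβ i.succ l) (hZ k).contMDiffOn)

omit [IsManifold (𝓡 n) ∞ M] in
lemma contMDiffOn_diffusionCoeff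
    (hβ : ∀ i l, ContMDiffOn (𝓡 n) 𝓘(ℝ, ℝ) ∞ (fun x => β i x l) U) (k l : Fin q) :
    ContMDiffOn (𝓡 n) 𝓘(ℝ, ℝ) ∞ (diffusionCoeff β k l) U :=
  contMDiffOn_finsetSum fun i _ => (hβ i.succ k).mul (hβ i.succ l)

/-- The coefficients are recovered from the generator on the leaf coordinates `tₗ` and their
products: `A tₗ = bₗ` and `A(tₖ tₗ) = bₗ tₖ + bₖ tₗ + aₖₗ`. Since `Zⱼ` lowers the degree of such
polynomials, commutation first gives `Zⱼ bₗ = 0` and then `Zⱼ aₖₗ = 0`. -/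
lemma lieDeriv_coeff_eq_zero [T2Space M] (hX : X.IsIntegrableWith Z F) (hU : IsOpen U)
    (hch : ∀ x ∈ U, ∃ ψ : OpenPartialHomeomorph M (FlatModel q r),
      x ∈ ψ.source ∧ IsRectifying Z F ψ)
    (hXβ : ∀ i, ∀ x ∈ U, X.field i x = fieldComb Z (β i x) x)
    (hβ : ∀ i l, ContMDiffOn (𝓡 n) 𝓘(ℝ, ℝ) ∞ (fun x => β i x l) U) (j : Fin q) {x : M}
    (hx : x ∈ U) :
    (∀ l, lieDeriv (Z j) (driftCoeff Z β l) x = 0) ∧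
      ∀ k l, lieDeriv (Z j) (diffusionCoeff β k l) x = 0 := by
  obtain ⟨ψ, hxψ, hψ⟩ := hch x hx
  have hZ := hX.system.smooth_field
  set W := ψ.source ∩ U with hWdef
  have hW : IsOpen W := ψ.open_source.inter hU
  have hxW : x ∈ W := ⟨hxψ, hx⟩
  have hev : ∀ y ∈ W, ∀ᶠ z in 𝓝 y, z ∈ W := fun y hy => hW.mem_nhds hy
  set t : Fin q → M → ℝ := fun l y => (ψ y).1 l with ht
  have hts : ∀ l, ContMDiffOn (𝓡 n) 𝓘(ℝ, ℝ) ∞ (t l) W := fun l =>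
    (hψ.contMDiffOn_coord l).mono inter_subset_left
  have htd : ∀ l, ∀ y ∈ W, MDifferentiableAt (𝓡 n) 𝓘(ℝ, ℝ) (t l) y := fun l y hy =>
    (hts l).mdifferentiableAt_of_isOpen hW hy
  set δ : Fin q → Fin q → ℝ := fun k l => if k = l then 1 else 0 with hδ
  have hZt : ∀ k l, ∀ y ∈ W, lieDeriv (Z k) (t l) y = δ k l := fun k l y hy =>
    hψ.lieDeriv_field_coord hy.1 k l
  set b := driftCoeff Z β with hb
  set a := diffusionCoeff β with ha
  have hform : ∀ f : M → ℝ, ContMDiffOn (𝓡 n) 𝓘(ℝ, ℝ) ∞ f W → ∀ y ∈ W, X.generator f y =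
      ∑ l, b l y * lieDeriv (Z l) f y +
        (1 / 2) * ∑ k, ∑ l, a k l y * lieDeriv (Z k) (lieDeriv (Z l) f) y := fun f hf y hy =>
    X.generator_eq_of_fieldComb hW hZ (fun i l => (hβ i l).mono inter_subset_right)
      (fun i z hz => hXβ i z hz.2) hf hy
  have hbd : ∀ l, MDifferentiableAt (𝓡 n) 𝓘(ℝ, ℝ) (b l) x := fun l =>
    (contMDiffOn_driftCoeff hU hZ hβ l).mdifferentiableAt_of_isOpen hU hx
  have had : ∀ k l, MDifferentiableAt (𝓡 n) 𝓘(ℝ, ℝ) (a k l) x := fun k l =>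
    (contMDiffOn_diffusionCoeff hβ k l).mdifferentiableAt_of_isOpen hU hx
  -- an affine function of the coordinates
  have haff : ∀ f : M → ℝ, ContMDiffOn (𝓡 n) 𝓘(ℝ, ℝ) ∞ f W → ∀ d : Fin q → ℝ,
      (∀ k, ∀ y ∈ W, lieDeriv (Z k) f y = d k) → ∀ y ∈ W, X.generator f y = ∑ l, b l y * d l := by
    intro f hf d hd y hy
    have h0 : ∀ k l, lieDeriv (Z k) (lieDeriv (Z l) f) y = 0 := fun k l =>
      lieDeriv_eq_zero_of_eventually_const ((hev y hy).mono fun z hz => hd l z hz)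
    rw [hform f hf y hy]
    simp [h0, hd _ y hy]
  have hδb : ∀ l y, ∑ p, b p y * δ p l = b l y := fun l y => by simp [hδ]
  have hbt : ∀ l, ∀ y ∈ W, X.generator (t l) y = b l y := fun l y hy => by
    rw [haff (t l) (hts l) (fun k => δ k l) (fun k y hy => hZt k l y hy) y hy, hδb]
  have hb0 : ∀ l, lieDeriv (Z j) (b l) x = 0 := by
    intro l
    have h1 := hX.generator_lieDeriv hW (hts l) hxW j
    have h2 : lieDeriv (Z j) (t l) =ᶠ[𝓝 x] fun _ => δ j l :=
      (hev x hxW).mono fun y hy => hZt j l y hy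
    rw [X.generator_congr h2, generator_const,
      lieDeriv_congr ((hev x hxW).mono fun y hy => hbt l y hy)] at h1
    exact h1.symm
  refine ⟨hb0, fun k l => ?_⟩
  have hasymm : ∀ y, a l k y = a k l y := fun y =>
    Finset.sum_congr rfl fun i _ => mul_comm _ _
  have hfs : ContMDiffOn (𝓡 n) 𝓘(ℝ, ℝ) ∞ (fun y => t k y * t l y) W := (hts k).mul (hts l)
  have hZf : ∀ p, ∀ y ∈ W, lieDeriv (Z p) (fun y => t k y * t l y) y =
      δ p l * t k y + δ p k * t l y := fun p y hy => by
    rw [lieDeriv_mul (htd k y hy) (htd l y hy), hZt p l y hy, hZt p k y hy]; ring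
  have hgs : ∀ p, ContMDiffOn (𝓡 n) 𝓘(ℝ, ℝ) ∞ (fun y => δ p l * t k y + δ p k * t l y) W :=
    fun p => (contMDiffOn_const.mul (hts k)).add (contMDiffOn_const.mul (hts l))
  have hZg : ∀ p o, ∀ y ∈ W, lieDeriv (Z o) (fun y => δ p l * t k y + δ p k * t l y) y =
      δ p l * δ o k + δ p k * δ o l := fun p o y hy => by
    rw [lieDeriv_add (f := fun y => δ p l * t k y) (g := fun y => δ p k * t l y)
      (mdifferentiableAt_const.mul (htd k y hy)) (mdifferentiableAt_const.mul (htd l y hy)),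
      lieDeriv_const_mul _ (htd k y hy), lieDeriv_const_mul _ (htd l y hy), hZt o k y hy,
      hZt o l y hy]
  have hAf : ∀ y ∈ W, X.generator (fun y => t k y * t l y) y =
      b l y * t k y + b k y * t l y + a k l y := by
    intro y hy
    have h1 : ∀ o p, lieDeriv (Z o) (lieDeriv (Z p) fun y => t k y * t l y) y =
        δ p l * δ o k + δ p k * δ o l := fun o p =>
      (lieDeriv_congr ((hev y hy).mono fun z hz => hZf p z hz)).trans (hZg p o y hy)
    rw [hform _ hfs y hy]
    simp only [hZf _ y hy, h1]
    have h2 : ∑ p, b p y * (δ p l * t k y + δ p k * t l y) = b l y * t k y + b k y * t l y := by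
      simp only [mul_add, ← mul_assoc, Finset.sum_add_distrib, ← Finset.sum_mul, hδb]
    -- Both orders of differentiation contribute, and the symmetry of `a` cancels the factor `1 /
    -- 2`.
    have h3 : ∑ o, ∑ p, a o p y * (δ p l * δ o k + δ p k * δ o l) = a k l y + a l k y := by
      simp [hδ, mul_add, Finset.sum_add_distrib]
    rw [h2, h3, hasymm]
    ring
  have h1 := hX.generator_lieDeriv hW hfs hxW j
  have h2 : lieDeriv (Z j) (fun y => t k y * t l y) =ᶠ[𝓝 x]
      fun y => δ j l * t k y + δ j k * t l y := (hev x hxW).mono fun y hy => hZf j y hy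
  rw [X.generator_congr h2, lieDeriv_congr ((hev x hxW).mono fun y hy => hAf y hy),
    haff _ (hgs j) (fun o => δ j l * δ o k + δ j k * δ o l) (hZg j) x hxW,
    lieDeriv_add (f := fun y => b l y * t k y + b k y * t l y)
      (((hbd l).mul (htd k x hxW)).add ((hbd k).mul (htd l x hxW))) (had k l),
    lieDeriv_add (f := fun y => b l y * t k y) (g := fun y => b k y * t l y)
      ((hbd l).mul (htd k x hxW)) ((hbd k).mul (htd l x hxW)),
    lieDeriv_mul (hbd l) (htd k x hxW), lieDeriv_mul (hbd k) (htd l x hxW), hb0, hb0,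
    hZt j k x hxW, hZt j l x hxW] at h1
  have h3 : ∑ o, b o x * (δ j l * δ o k + δ j k * δ o l) = δ j l * b k x + δ j k * b l x := by
    have h4 : ∀ e p, ∑ o, b o x * (e * δ o p) = e * b p x := fun e p => by
      rw [← hδb p x, Finset.mul_sum]
      exact Finset.sum_congr rfl fun o _ => by ring
    simp only [mul_add, Finset.sum_add_distrib, h4]
  rw [h3] at h1
  linear_combination -h1

end IsIntegrableWith
end SDS

omit [IsManifold (𝓡 n) ∞ M] in
/-- A first integral of the fields `Zⱼ` is constant along their flow. -/
lemma IsLeafFlow.apply_eq_of_lieDeriv_eq_zero {B : Set (EuclideanSpace ℝ (Fin r))}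
    {Ψ : (Fin q → ℝ) → M → M} (hΨ : IsLeafFlow Z F (jointMap F ⁻¹' B) Ψ)
    (hch : ∀ x, jointMap F x ∈ B → ∃ ψ : OpenPartialHomeomorph M (FlatModel q r),
      x ∈ ψ.source ∧ IsRectifying Z F ψ) {h : M → ℝ}
    (hd : ∀ x, jointMap F x ∈ B → MDifferentiableAt (𝓡 n) 𝓘(ℝ, ℝ) h x)
    (hZ : ∀ j x, jointMap F x ∈ B → lieDeriv (Z j) h x = 0) (t : Fin q → ℝ) {x : M}
    (hx : jointMap F x ∈ B) : h (Ψ t x) = h x := by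
  have h1 : ∀ u : ℝ, HasDerivAt (fun u : ℝ => h (Ψ (u • t) x)) 0 u := by
    intro u
    have hy : jointMap F (Ψ (u • t) x) ∈ B := by rwa [hΨ.jointMap_apply]
    have h2 := (hd _ hy).hasMFDerivAt.comp u (hΨ.hasMFDerivAt_smul hch hx t u)
    have h3 : (mfderiv (𝓡 n) 𝓘(ℝ, ℝ) h (Ψ (u • t) x) : EuclideanSpace ℝ (Fin n) →L[ℝ] ℝ)
        (fieldComb Z t (Ψ (u • t) x)) = 0 := by
      refine (lieDeriv_eq_sum (V := fieldComb Z t) (f := h) (t := t) rfl).trans ?_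
      exact Finset.sum_eq_zero fun k _ => by rw [hZ k _ hy, mul_zero]
    have h4 : ∀ (L : EuclideanSpace ℝ (Fin n) →L[ℝ] ℝ) (v : EuclideanSpace ℝ (Fin n)) (φ : ℝ → ℝ),
        L v = 0 → HasFDerivAt φ (L.comp ((1 : ℝ →L[ℝ] ℝ).smulRight v)) u → HasDerivAt φ 0 u :=
      fun L v φ h0 hφ => hφ.hasDerivAt.congr_deriv (by simp [h0])
    exact h4 _ _ _ h3 (hasMFDerivAt_iff_hasFDerivAt.1 h2)
  have h5 := is_const_of_deriv_eq_zero (fun u => (h1 u).differentiableAt) (fun u => (h1 u).deriv) 1 0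
  simpa [hΨ.zero_apply] using h5

end NormalForm

/-! ### The normal form on a tube. -/

section NormalFormOnTube
open Filter Topology

variable {n : ℕ} {M : Type*} [TopologicalSpace M] [ChartedSpace (EuclideanSpace ℝ (Fin n)) M]
  {q r : ℕ} {Z : Fin q → (x : M) → TangentSpace (𝓡 n) x} {F : Fin r → M → ℝ}
  {Ψ : (Fin q → ℝ) → M → M} {c : EuclideanSpace ℝ (Fin r)} {ρ : ℝ}
  {σ : EuclideanSpace ℝ (Fin r) → M}
  {Ω : EuclideanSpace ℝ (Fin r) → (Fin q → ℝ) →L[ℝ] (Fin q → ℝ)}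

lemma IsPeriodFamily.contMDiffOn_section {U : Set M} (hΨ : IsLeafFlow Z F U Ψ)
    (hper : IsPeriodFamily (n := n) F Ψ c ρ σ Ω) :
    ContMDiffOn (𝓡 r) (𝓡 n) ∞ σ (Metric.ball c ρ) := by
  have h1 : ContMDiffOn (𝓡 r) 𝓘(ℝ, FlatModel q r) ∞
      (fun γ : EuclideanSpace ℝ (Fin r) => ((0, γ) : FlatModel q r)) (Metric.ball c ρ) :=
    ContMDiff.contMDiffOn (ContDiff.contMDiff (by fun_prop))
  have h2 := hper.smooth_orbit.comp h1 fun γ hγ => mem_prod.2 ⟨mem_univ _, hγ⟩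
  exact h2.congr fun γ _ => (hΨ.zero_apply _).symm

lemma lieDeriv_comp_jointMap (hF : ∀ j, ContMDiff (𝓡 n) 𝓘(ℝ, ℝ) ∞ (F j)) {x : M} {i : Fin q}
    (hZF : ∀ j, lieDeriv (Z i) (F j) x = 0) {g : EuclideanSpace ℝ (Fin r) → ℝ}
    (hg : DifferentiableAt ℝ g (jointMap F x)) :
    lieDeriv (Z i) (fun y => g (jointMap F y)) x = 0 := by
  have h1 : mvfderiv (𝓡 n) (jointMap F) x (Z i x) = 0 := by
    ext j
    rw [mvfderiv_jointMap_apply hF]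
    exact hZF j
  refine (mvfderiv_comp_fderiv hg ((contMDiff_jointMap hF x).mdifferentiableAt (by simp))
    (Z i x)).trans ?_
  rw [h1, map_zero]

variable [IsManifold (𝓡 n) ∞ M]

/-- On a tube of leaves an integrable system is diffusion equivalent to a system whose coefficients
in the angular frame are constant on the leaves. -/
theorem IsLeafTube.exists_normalForm [T2Space M] {m : ℕ} {X : SDS n M univ m}
    (hX : X.IsIntegrableWith Z F) {B : Set (EuclideanSpace ℝ (Fin r))} (hB : IsOpen B)
    (hΨ : IsLeafFlow Z F (jointMap F ⁻¹' B) Ψ)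
    (hch : ∀ x, jointMap F x ∈ B → ∃ ψ : OpenPartialHomeomorph M (FlatModel q r),
      x ∈ ψ.source ∧ IsRectifying Z F ψ) (hρ : 0 < ρ) (hρB : Metric.ball c ρ ⊆ B)
    (hper : IsPeriodFamily (n := n) F Ψ c ρ σ Ω)
    {Φ : OpenPartialHomeomorph (Torus q × EuclideanSpace ℝ (Fin r)) M}
    (hΦ : IsLeafTube Z F Ψ c ρ σ Ω Φ) :
    ∃ (Y : SDS n M Φ.target m) (a : Fin (m + 1) → Fin q → EuclideanSpace ℝ (Fin r) → ℝ),
      X.DiffusionEquivOn Y Φ.target ∧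
      (∀ i k, ContDiffOn ℝ ∞ (a i k) (Metric.ball 0 1)) ∧
      ∀ i, ∀ x ∈ Φ.target, Y.field i x = ∑ k, a i k (Φ.symm x).2 • angularField Φ k x := by
  have hF := hX.system.smooth_fun
  have hZ := hX.system.smooth_field
  have hFs : ContMDiff (𝓡 n) (𝓡 r) ∞ (jointMap F) := contMDiff_jointMap hF
  have hU : IsOpen (jointMap F ⁻¹' B) := hB.preimage hFs.continuous
  have hball : ∀ γ' ∈ Metric.ball (0 : EuclideanSpace ℝ (Fin r)) 1,
      c + ρ • γ' ∈ Metric.ball c ρ := by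
    intro γ' h
    rw [mem_ball_zero_iff] at h
    rw [mem_ball_iff_norm, add_sub_cancel_left, norm_smul, Real.norm_of_nonneg hρ.le]
    nlinarith
  have htgt : ∀ x ∈ Φ.target, jointMap F x ∈ Metric.ball c ρ := by
    intro x hx
    have h1 := Φ.map_target hx
    rw [hΦ.tubular.source_eq] at h1
    rw [hΦ.jointMap_eq x hx]
    exact hball _ h1.2
  have hσU : ∀ γ ∈ Metric.ball c ρ, σ γ ∈ jointMap F ⁻¹' B := fun γ hγ => by
    rw [mem_preimage, hper.jointMap_section γ hγ]; exact hρB hγ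
  obtain ⟨β, hXβ, hβ⟩ := hX.exists_fieldComb hU hch
  have hcoeff := fun (j : Fin q) (x : M) (hx : x ∈ jointMap F ⁻¹' B) =>
    hX.lieDeriv_coeff_eq_zero hU hch hXβ hβ j hx
  have hbs := SDS.IsIntegrableWith.contMDiffOn_driftCoeff hU hZ hβ
  have has := SDS.IsIntegrableWith.contMDiffOn_diffusionCoeff hβ
  have hconst : ∀ h : M → ℝ, ContMDiffOn (𝓡 n) 𝓘(ℝ, ℝ) ∞ h (jointMap F ⁻¹' B) →
      (∀ j x, x ∈ jointMap F ⁻¹' B → lieDeriv (Z j) h x = 0) → ∀ x ∈ Φ.target,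
      h (σ (jointMap F x)) = h x := by
    intro h hs hZh x hx
    obtain ⟨t, ht⟩ := hΦ.exists_eq x hx
    have h1 := hΨ.apply_eq_of_lieDeriv_eq_zero hch
      (fun x hx => hs.mdifferentiableAt_of_isOpen hU hx) hZh t (hσU _ (htgt x hx))
    rw [ht] at h1
    exact h1.symm
  -- The diffusion fields are frozen at their values on the section. The drift is not `β 0` but the
  -- full first order coefficient, since the frozen fields no longer contribute first order terms
  -- through their squares.
  set η : Fin (m + 1) → EuclideanSpace ℝ (Fin r) → Fin q → ℝ := fun i γ =>
    Fin.cases (fun l => SDS.driftCoeff Z β l (σ γ)) (fun i => β i.succ (σ γ)) i with hη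
  have hηs : ∀ i l, ContDiffOn ℝ ∞ (fun γ => η i γ l) (Metric.ball c ρ) := by
    intro i l
    rw [← contMDiffOn_iff_contDiffOn]
    refine Fin.cases ?_ (fun i => ?_) i
    · exact (hbs l).comp (hper.contMDiffOn_section hΨ) hσU
    · exact (hβ i.succ l).comp (hper.contMDiffOn_section hΨ) hσU
  have hηF : ∀ i l, ContMDiffOn (𝓡 n) 𝓘(ℝ, ℝ) ∞ (fun x => η i (jointMap F x) l) Φ.target :=
    fun i l => (contMDiffOn_iff_contDiffOn.2 (hηs i l)).comp hFs.contMDiffOn htgt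
  let Y : SDS n M Φ.target m :=
    { field := fun i x => fieldComb Z (η i (jointMap F x)) x
      smooth := fun i => by
        have : IsManifold (𝓡 n) 1 M := IsManifold.of_le (n := ∞) (by simp)
        exact ContMDiffOn.sum_section fun l _ => (hηF i l).smul_section (hZ l).contMDiffOn }
  -- The inverse period matrix passes from the frame `Z` to the angular frame, and `c + ρ • γ'`
  -- undoes the rescaling of the ball to radius one.
  refine ⟨Y, fun i k γ' => (Ω (c + ρ • γ')).inverse (η i (c + ρ • γ')) k, ?_, fun i k => ?_,
    fun i x hx => ?_⟩
  · intro f hf x hx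
    have hxU : Φ.target ⊆ jointMap F ⁻¹' B := fun y hy => hρB (htgt y hy)
    rw [X.generator_eq_of_fieldComb Φ.open_target hZ (fun i l => (hβ i l).mono hxU)
        (fun i y hy => hXβ i y (hxU hy)) hf hx,
      Y.generator_eq_of_fieldComb (β := fun i x => η i (jointMap F x)) Φ.open_target hZ hηF
        (fun i y _ => rfl) hf hx]
    -- The `Zₖ` kill functions of `F`, so the correction terms for `Y` vanish and only `η 0`
    -- remains.
    have h1 : ∀ l, SDS.driftCoeff Z (fun i x => η i (jointMap F x)) l x =
        SDS.driftCoeff Z β l x := by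
      intro l
      have h2 : ∀ (i : Fin m) k, lieDeriv (Z k) (fun y => η i.succ (jointMap F y) l) x = 0 :=
        fun i k => lieDeriv_comp_jointMap (g := fun γ => η i.succ γ l) hF
          (fun j => hX.system.first_integral k j x)
          (((hηs i.succ l).contDiffAt (Metric.isOpen_ball.mem_nhds (htgt x hx))).differentiableAt
            (by simp))
      rw [← hconst _ (hbs l) (fun j x hx => (hcoeff j x hx).1 l) x hx, SDS.driftCoeff]
      simp only [h2, mul_zero, Finset.sum_const_zero, add_zero]
      rfl
    have h3 : ∀ k l, SDS.diffusionCoeff (fun i x => η i (jointMap F x)) k l x =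
        SDS.diffusionCoeff β k l x := fun k l =>
      hconst _ (has k l) (fun j x hx => (hcoeff j x hx).2 k l) x hx
    simp only [h1, h3]
  · have hg : ContDiffOn ℝ ∞ (fun γ' : EuclideanSpace ℝ (Fin r) => c + ρ • γ')
        (Metric.ball 0 1) := by fun_prop
    have hinv : ContDiffOn ℝ ∞ (fun γ => (Ω γ).inverse) (Metric.ball c ρ) := fun γ hγ =>
      ((hper.invertible γ hγ).contDiffAt_inverse.comp_contDiffWithinAt γ
        (hper.smooth_period γ hγ))
    have h1 : ContDiffOn ℝ ∞ (fun γ => (Ω γ).inverse (η i γ)) (Metric.ball c ρ) :=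
      hinv.clm_apply (contDiffOn_pi.2 (hηs i))
    exact (contDiffOn_pi.1 h1 k).comp hg hball
  · show fieldComb Z (η i (jointMap F x)) x = _
    have h1 : ∀ t : Fin q → ℝ, ∑ k, t k • angularField Φ k x =
        fieldComb Z (Ω (jointMap F x) t) x := by
      intro t
      have h2 : t = ∑ k, t k • (Pi.single k 1 : Fin q → ℝ) := by
        ext j; simp [Finset.sum_apply, Pi.single_apply]
      simp only [hΦ.angularField_eq x hx, fieldComb]
      conv_rhs => rw [h2]
      simp only [map_sum, map_smul, Finset.sum_apply, Pi.smul_apply, smul_eq_mul, Finset.sum_smul,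
        Finset.smul_sum, smul_smul]
      exact Finset.sum_comm
    rw [h1]
    simp only [← hΦ.jointMap_eq x hx]
    rw [(hper.invertible _ (htgt x hx)).self_apply_inverse]

end NormalFormOnTube

end

/-! ### Assembly. -/

theorem mainTheorem5 {n m q r : ℕ} {M : Type*} [TopologicalSpace M] [T2Space M]
    [ChartedSpace (EuclideanSpace ℝ (Fin n)) M] [IsManifold (𝓡 n) ∞ M]
    (X : SDS n M univ m)
    (Z : Fin q → (x : M) → TangentSpace (𝓡 n) x) (F : Fin r → M → ℝ)
    (hX : X.IsIntegrableWith Z F)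
    (hproper : IsProperMap (fun x : M => fun j : Fin r => F j x))
    (c : Fin r → ℝ)
    (hconn : IsConnected {x : M | ∀ j, F j x = c j})
    (hreg : ∀ x ∈ {x : M | ∀ j, F j x = c j}, IndependentAt Z F x) :
    -- the level set `N` is (the image of) a smoothly embedded torus
    (∃ e : Torus q → M, IsSmoothEmbedding 𝓘(ℝ, Fin q → ℝ) (𝓡 n) ∞ e ∧
      range e = {x : M | ∀ j, F j x = c j}) ∧
    -- coordinates on a tubular neighbourhood in which `X` has the normal form `Y`
    ∃ Φ : OpenPartialHomeomorph (Torus q × EuclideanSpace ℝ (Fin r)) M,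
      IsTubularChart (n := n) {x : M | ∀ j, F j x = c j} Φ ∧
      ∃ (Y : SDS n M Φ.target m) (a : Fin (m + 1) → Fin q → EuclideanSpace ℝ (Fin r) → ℝ),
        X.DiffusionEquivOn Y Φ.target ∧
        (∀ i k, ContDiffOn ℝ ∞ (a i k) (Metric.ball 0 1)) ∧
        ∀ i, ∀ x ∈ Φ.target,
          Y.field i x = ∑ k, a i k (Φ.symm x).2 • angularField Φ k x := by
  have hN : {x : M | ∀ j, F j x = c j} = jointMap F ⁻¹' {WithLp.toLp 2 c} := by
    ext x
    simp [jointMap, funext_iff]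
  rw [hN] at hconn hreg ⊢
  set c' : EuclideanSpace ℝ (Fin r) := WithLp.toLp 2 c
  have hsys := hX.system
  have hFc : Continuous (jointMap F) := (contMDiff_jointMap hsys.smooth_fun).continuous
  have hprop := isProperMap_jointMap hproper
  obtain ⟨B, hB, hcB, ε, hε, hcharts⟩ := exists_uniform_isRectifying hsys hprop c' hreg
  have hch : ∀ x, jointMap F x ∈ B → ∃ ψ : OpenPartialHomeomorph M (FlatModel q r),
      x ∈ ψ.source ∧ IsRectifying Z F ψ := fun x hx => by
    obtain ⟨ψ, hψ, hxψ, -⟩ := hcharts x hx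
    exact ⟨ψ, hxψ, hψ⟩
  obtain ⟨Ψ, hΨ⟩ := exists_isLeafFlow hsys hB hε hcharts
  obtain ⟨x₀, hx₀⟩ := hconn.nonempty
  have hx₀' : jointMap F x₀ = c' := hx₀
  obtain ⟨b, hb⟩ := hΨ.exists_basis_stabilizer hch hcB hconn.isPreconnected
    (hprop.isCompact_preimage isCompact_singleton) hx₀'
  obtain ⟨ψ, hx₀ψ, hψ⟩ := hch x₀ (by rwa [hx₀'])
  obtain ⟨ρ, hρ, hρB, σ, Ω, -, hper⟩ := hΨ.exists_isPeriodFamily hB hFc hψ hcB hx₀' hx₀ψ b hb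
  obtain ⟨Φ, hΦ⟩ := hΨ.exists_isLeafTube hch hρ hρB hconn.isPreconnected hper
  exact ⟨hΦ.tubular.exists_isSmoothEmbedding hsys.dim_eq, Φ, hΦ.tubular,
    hΦ.exists_normalForm hX hB hΨ hch hρ hρB hper⟩
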